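/- **Setting.** A *time-varying ISAN* of sequence length $T$ and hidden dimension $k$ over a finite nonempty alphabet $\Sigma$ is given by matrices $A_{z,t}\in\mathbb{R}^{k\times k}$, $B_t\in\mathbb{R}^{\Sigma\times k}$ ($z\in\Sigma$, $t\in\{1,\dots,T\}$) and an initial state $x_0\in\mathbb{R}^k$. It defines a distribution on $\Sigma^T$: for $t=1,\dots,T$, the token $z_t$ is sampled from $\mathrm{softmax}(B_t x_{t-1})$, and then $x_t=A_{z_t,t}\,x_{t-1}$. A *logit query* to an ISAN $M$ specifies a prefix $h$ of fewer than $T$ tokens and returns the mean-centered logits $$L_M[z\mid h]=\log\Pr_M[z\mid h]-\frac{1}{|\Sigma|}\sum_{z'\in\Sigma}\log\Pr_M[z'\mid h]\qquad(z\in\Sigma)$$ (a longer prefix is answered by zeros). Algorithms are uniform randomized real-RAM programs with logit queries: real arithmetic, comparison of reals, the real exponential function and the toss of a coin with a computed real bias take one unit of time per operation, as do index arithmetic and memory accesses; storing a natural number takes in addition time equal to its number of bits, and a query takes in addition time equal to the length of the prefix plus $|\Sigma|$. **Theorem.** There are a single randomized program and a polynomial $P$ in four variables such that the following holds for all integers $d,T\ge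 0$, every alphabet $\Sigma=\{0,\dots,|\Sigma|-1\}$ with $|\Sigma|\ge 1$, every real $\varepsilon>0$, and every time-varying ISAN $M$ over $\Sigma^T$ of hidden dimension at most $d$. On input $(d,|\Sigma|,T,\varepsilon)$ and with logit-query access to $M$, the program halts for every outcome of its coins, it always uses time at most $P(d,|\Sigma|,T,1/\varepsilon)$ and makes at most $P(d,|\Sigma|,T,1/\varepsilon)$ queries, and it outputs the parameters of a time-varying ISAN $M'$ over $\Sigma^T$ of hidden dimension $d$ such that $$\mathbb{E}\big[D_{\mathrm{TV}}(M,M')\big]\le\varepsilon,$$ where the expectation is over the coins of the program and $D_{\mathrm{TV}}(M,M')=\tfrac12\sum_{z\in\Sigma^T}|\Pr_M[z]-\Pr_{M'}[z]|$. -/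

import Mathlib

noncomputable section

namespace LogitLearning

/-! ## Time-varying ISANs over the alphabet `Σ = Fin n` -/

/-- A time-varying ISAN of sequence length `T` over `Fin n` with hidden dimension `d`.
Time steps are numbered from `0`: `A t z` is the matrix usually written `A_{z,t+1}`, and `B t` is
the one usually written `B_{t+1}`. -/
structure ISAN (n T d : ℕ) where
  /-- the transition matrices -/
  A : Fin T → Fin n → Matrix (Fin d) (Fin d) ℝ
  /-- the readout matrices -/
  B : Fin T → Matrix (Fin n) (Fin d) ℝ
  /-- the initial state -/
  x₀ : Fin d → ℝ

/-- The softmax of a vector. -/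
def softmax {n : ℕ} (v : Fin n → ℝ) (z : Fin n) : ℝ :=
  Real.exp (v z) / ∑ z', Real.exp (v z')

/-- The mean-centered logits `log p z - (1/n) ∑ log p z'` of a distribution `p` on tokens. -/
def meanCenteredLogit {n : ℕ} (p : Fin n → ℝ) (z : Fin n) : ℝ :=
  Real.log (p z) - (1 / (n : ℝ)) * ∑ z', Real.log (p z')

namespace ISAN

variable {n T d : ℕ}

/-- The hidden state after the tokens `h` of a prefix of length `t ≤ T`. -/
def hidden (M : ISAN n T d) : (t : ℕ) → t ≤ T → (Fin t → Fin n) → (Fin d → ℝ)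
  | 0, _, _ => M.x₀
  | t + 1, ht, h =>
    Matrix.mulVec (M.A ⟨t, ht⟩ (h (Fin.last t)))
      (hidden M t (Nat.le_of_succ_le ht) (fun j => h j.castSucc))

/-- The conditional distribution of the next token after the prefix `h` of length `t < T`. -/
def nextProb (M : ISAN n T d) (t : ℕ) (ht : t < T) (h : Fin t → Fin n) : Fin n → ℝ :=
  softmax (Matrix.mulVec (M.B ⟨t, ht⟩) (M.hidden t ht.le h))

/-- The probability of the token sequence `z` under the ISAN. -/
def prob (M : ISAN n T d) (z : Fin T → Fin n) : ℝ :=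
  ∏ t : Fin T, M.nextProb t t.isLt (fun j => z (Fin.castLE t.isLt.le j)) (z t)

end ISAN

/-- Total variation distance of two distributions on a finite type, given by their masses. -/
def tvDist {α : Type*} [Fintype α] (p q : α → ℝ) : ℝ :=
  (1 / 2) * ∑ a, |p a - q a|

/-- A logit oracle answers a prefix `h` of length `t` by a vector indexed by the tokens. -/
abbrev LogitOracle (n : ℕ) := (t : ℕ) → (Fin t → Fin n) → Fin n → ℝ

/-- Logit-query access to an ISAN: the answer to a prefix is the vector of mean-centered logits
of the next token.  Prefixes of length `T` or more, after which there is no next token, are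
answered by zeros. -/
def ISAN.oracle {n T d : ℕ} (M : ISAN n T d) : LogitOracle n := fun t h z =>
  if ht : t < T then meanCenteredLogit (M.nextProb t ht h) z else 0

/-! ## A randomized real RAM with logit queries

The memory consists of arrays of natural numbers and arrays of real numbers, both indexed by
natural numbers; array cells can be addressed by computed indices.  A program is a finite syntactic
object, the only constants in it are natural numbers, and real numbers can influence the control
flow only through comparisons and biased coins. -/

/-- The memory of the machine, with a clock and a counter of the oracle queries.  The two counters
cannot be read by programs. -/
structure State where
  /-- cell `i` of the array number `a` of natural numbers -/
  nat : ℕ → ℕ → ℕ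
  /-- cell `i` of the array number `a` of real numbers -/
  real : ℕ → ℕ → ℝ
  /-- the time used so far -/
  steps : ℕ
  /-- the number of oracle queries made so far -/
  queries : ℕ

/-- Expressions for natural numbers. -/
inductive NExp where
  | const (k : ℕ)
  | read (a : ℕ) (i : NExp)
  | add (e f : NExp)
  | sub (e f : NExp)
  | mul (e f : NExp)

/-- Expressions for real numbers. -/
inductive RExp where
  | cast (e : NExp)
  | read (a : ℕ) (i : NExp)
  | add (e f : RExp)
  | sub (e f : RExp)
  | mul (e f : RExp)
  | div (e f : RExp)
  | exp (e : RExp)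

/-- Conditions. -/
inductive BExp where
  | natLt (e f : NExp)
  | natEq (e f : NExp)
  | realLt (e f : RExp)
  | realEq (e f : RExp)
  | not (b : BExp)
  | and (b c : BExp)

/-- The value of an expression (subtraction is truncated at `0`). -/
def NExp.eval (s : State) : NExp → ℕ
  | const k => k
  | read a i => s.nat a (i.eval s)
  | add e f => e.eval s + f.eval s
  | sub e f => e.eval s - f.eval s
  | mul e f => e.eval s * f.eval s

/-- The value of an expression (with `x / 0 = 0`). -/
def RExp.eval (s : State) : RExp → ℝ
  | cast e => (e.eval s : ℝ)
  | read a i => s.real a (i.eval s)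
  | add e f => e.eval s + f.eval s
  | sub e f => e.eval s - f.eval s
  | mul e f => e.eval s * f.eval s
  | div e f => e.eval s / f.eval s
  | exp e => Real.exp (e.eval s)

/-- The truth value of a condition. -/
def BExp.eval (s : State) : BExp → Prop
  | natLt e f => e.eval s < f.eval s
  | natEq e f => e.eval s = f.eval s
  | realLt e f => e.eval s < f.eval s
  | realEq e f => e.eval s = f.eval s
  | not b => ¬ b.eval s
  | and b c => b.eval s ∧ c.eval s

/-- The time to evaluate an expression: one unit per operation, constant or memory access. -/
def NExp.cost : NExp → ℕ
  | const _ => 1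
  | read _ i => i.cost + 1
  | add e f => e.cost + f.cost + 1
  | sub e f => e.cost + f.cost + 1
  | mul e f => e.cost + f.cost + 1

/-- The time to evaluate an expression: one unit per operation, constant or memory access. -/
def RExp.cost : RExp → ℕ
  | cast e => e.cost + 1
  | read _ i => i.cost + 1
  | add e f => e.cost + f.cost + 1
  | sub e f => e.cost + f.cost + 1
  | mul e f => e.cost + f.cost + 1
  | div e f => e.cost + f.cost + 1
  | exp e => e.cost + 1

/-- The time to evaluate a condition. -/
def BExp.cost : BExp → ℕ
  | natLt e f => e.cost + f.cost + 1
  | natEq e f => e.cost + f.cost + 1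
  | realLt e f => e.cost + f.cost + 1
  | realEq e f => e.cost + f.cost + 1
  | not b => b.cost + 1
  | and b c => b.cost + c.cost + 1

/-- Programs.
* `setNat a i e`: store the value of `e` in the cell `i` of the array `a` of naturals;
* `setReal a i e`: the same for real numbers;
* `flip a i e`: toss a coin that shows heads with probability `e` (clamped to `[0, 1]`), and store
  `1` for heads and `0` for tails in the cell `i` of the array `a` of naturals;
* `query a i len b j`: ask the oracle about the prefix of length `len` stored in the cells
  `i, …, i + len - 1` of the array `a` of naturals, and store the answer in the cells
  `j, …, j + n - 1` of the array `b` of reals, where `n` is the number of tokens. -/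
inductive Cmd where
  | skip
  | setNat (a : ℕ) (i e : NExp)
  | setReal (a : ℕ) (i : NExp) (e : RExp)
  | flip (a : ℕ) (i : NExp) (e : RExp)
  | query (a : ℕ) (i len : NExp) (b : ℕ) (j : NExp)
  | seq (c₁ c₂ : Cmd)
  | branch (b : BExp) (c₁ c₂ : Cmd)
  | loop (b : BExp) (c : Cmd)

namespace State

/-- Let the time `k` pass. -/
def tick (s : State) (k : ℕ) : State := { s with steps := s.steps + k }

/-- Overwrite a cell of an array of natural numbers. -/
def writeNat (s : State) (a i v : ℕ) : State :=
  { s with nat := Function.update s.nat a (Function.update (s.nat a) i v) }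

/-- Overwrite a cell of an array of real numbers. -/
def writeReal (s : State) (a i : ℕ) (v : ℝ) : State :=
  { s with real := Function.update s.real a (Function.update (s.real a) i v) }

open Classical in
/-- The answer of the oracle to the prefix stored in the cells `i, …, i + len - 1` of the array `a`;
it is `0` if one of these cells does not hold a token. -/
def answer {n : ℕ} (s : State) (O : LogitOracle n) (a i len : ℕ) (z : Fin n) : ℝ :=
  if h : ∀ j : Fin len, s.nat a (i + j) < n then O len (fun j => ⟨s.nat a (i + j), h j⟩) z else 0

/-- The memory after a query whose answer is the vector `v`, stored from the cell `j` of the array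
`b` on. -/
def writeAnswer {n : ℕ} (s : State) (b j : ℕ) (v : Fin n → ℝ) : State :=
  { s with
    real := Function.update s.real b
      (fun m => if h : j ≤ m ∧ m - j < n then v ⟨m - j, h.2⟩ else s.real b m)
    queries := s.queries + 1 }

end State

/-- A coin that shows heads with probability `r`, clamped to `[0, 1]`. -/
def coin (r : ℝ) : PMF Bool :=
  PMF.ofFintype
    (fun heads => if heads then min 1 (ENNReal.ofReal r) else 1 - min 1 (ENNReal.ofReal r))
    (by simp [add_tsub_cancel_of_le])

/-- `Exec O c s μ`: run from the memory `s` with the oracle `O`, the program `c` halts for every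
outcome of the coins, and `μ` is the distribution of the final memory.

Operations on real numbers, including the exponential function, take unit time.  Storing a natural
number takes time proportional to its number of binary digits, so that multiplication cannot create
huge numbers for free.  A query takes time for reading the prefix and for writing the answer. -/
inductive Exec {n : ℕ} (O : LogitOracle n) : Cmd → State → PMF State → Prop
  | skip (s : State) : Exec O Cmd.skip s (PMF.pure (s.tick 1))
  | setNat (s : State) (a : ℕ) (i e : NExp) :
      Exec O (Cmd.setNat a i e) s
        (PMF.pure ((s.writeNat a (i.eval s) (e.eval s)).tick
          (1 + i.cost + e.cost + Nat.size (e.eval s))))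
  | setReal (s : State) (a : ℕ) (i : NExp) (e : RExp) :
      Exec O (Cmd.setReal a i e) s
        (PMF.pure ((s.writeReal a (i.eval s) (e.eval s)).tick (1 + i.cost + e.cost)))
  | flip (s : State) (a : ℕ) (i : NExp) (e : RExp) :
      Exec O (Cmd.flip a i e) s
        ((coin (e.eval s)).map fun heads =>
          (s.writeNat a (i.eval s) (if heads then 1 else 0)).tick (1 + i.cost + e.cost))
  | query (s : State) (a : ℕ) (i len : NExp) (b : ℕ) (j : NExp) :
      Exec O (Cmd.query a i len b j) s
        (PMF.pure ((s.writeAnswer b (j.eval s) (s.answer O a (i.eval s) (len.eval s))).tick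
          (1 + i.cost + len.cost + j.cost + len.eval s + n)))
  | seq (s : State) (c₁ c₂ : Cmd) (μ : PMF State) (κ : State → PMF State) :
      Exec O c₁ s μ → (∀ s' ∈ μ.support, Exec O c₂ s' (κ s')) →
      Exec O (Cmd.seq c₁ c₂) s (μ.bind κ)
  | branchTrue (s : State) (b : BExp) (c₁ c₂ : Cmd) (μ : PMF State) :
      b.eval s → Exec O c₁ (s.tick (1 + b.cost)) μ → Exec O (Cmd.branch b c₁ c₂) s μ
  | branchFalse (s : State) (b : BExp) (c₁ c₂ : Cmd) (μ : PMF State) :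
      ¬ b.eval s → Exec O c₂ (s.tick (1 + b.cost)) μ → Exec O (Cmd.branch b c₁ c₂) s μ
  | loopFalse (s : State) (b : BExp) (c : Cmd) :
      ¬ b.eval s → Exec O (Cmd.loop b c) s (PMF.pure (s.tick (1 + b.cost)))
  | loopTrue (s : State) (b : BExp) (c : Cmd) (μ : PMF State) (κ : State → PMF State) :
      b.eval s → Exec O c (s.tick (1 + b.cost)) μ →
      (∀ s' ∈ μ.support, Exec O (Cmd.loop b c) s' (κ s')) →
      Exec O (Cmd.loop b c) s (μ.bind κ)

/-- The initial memory: `d`, `n`, `T` are in the first three cells of the array `0` of naturals, `ε`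
is in the first cell of the array `0` of reals, and all other cells hold `0`. -/
def State.init (d n T : ℕ) (ε : ℝ) : State where
  nat := fun a i =>
    if a = 0 then (if i = 0 then d else if i = 1 then n else if i = 2 then T else 0) else 0
  real := fun a i => if a = 0 ∧ i = 0 then ε else 0
  steps := 0
  queries := 0

/-- The ISAN described by the final memory: its initial state is in the array `1` of reals, its
transition matrices are in the array `2` and its readout matrices are in the array `3`, all of them
listed in lexicographic order of their indices. -/
def State.output (d n T : ℕ) (s : State) : ISAN n T d where
  A := fun t z => Matrix.of fun i j => s.real 2 (((t * n + z) * d + i) * d + j)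
  B := fun t => Matrix.of fun z i => s.real 3 ((t * n + z) * d + i)
  x₀ := fun i => s.real 1 i

end LogitLearning

end

/-! Fix a level `i`. The logit of a token after a prefix of length `i` and a given continuation is a
linear functional of the hidden state reached after the prefix (`ISAN.isLinear_oracle`). Hence the
table whose rows are the prefixes of length `i` and whose columns are the tests (continuation,
token) has rank at most the hidden dimension `k ≤ d`. A hypothesis `Hyp` keeps, at each level, a
nonsingular square piece of this table together with its inverse `K`, that is, combinations of
prefixes dual to the tests. It predicts by interpolation: the state is the vector of test values,
and transitions and readouts are the test values and logits of the dual combinations.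

A sequence `z` is drawn from `M` itself, since mean-centered logits determine the conditional
probabilities. Along `z` it is checked, for every `i ≤ t < T`, whether interpolation at level `i`
reproduces the logits at time `t` of all one-token extensions of the stored prefixes of the previous
level. If all errors vanish, a telescoping argument (`Hyp.Good.predict`) shows that the model
described by the hypothesis gives `z` exactly its true probability (`Hyp.Realizes.prob_eq`). So the
total variation distance is at most the probability under `M` that a fresh sequence fails the check
(`ISAN.tvDist_le`). If some error is nonzero, the offending prefix and test enlarge the nonsingular
piece by one row and one column (`Hyp.Inv.pivot`). By the rank bound (`Hyp.Inv.r_lt`) this happens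
at most `T * d` times over all levels.

The failure probability is never estimated. A number of rounds with `rounds * ε ≥ d * T` is fixed,
and the hypothesis of a uniformly random round is output. The failure probabilities of the rounds
add up, in expectation, to at most the number of refinements, so their average is at most `ε`.
`run_rounds` proves this backwards: with `j` rounds left, the expected loss is at most `(T * d -
total) / j`.

For the machine, `Run` combines termination with a worst-case time bound, a postcondition and a
bound for an expectation. The time bound is syntactic: when every loop has at most `W` iterations
and every stored number and query length is at most `W`, the time is at most `Cmd.bound W`, a
polynomial in `W`. Real arithmetic is exact, so zero tests of interpolation errors are exact and no
conditioning issues arise. -/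

noncomputable section

namespace LogitLearning

open scoped ENNReal

/-! ## A program logic for the randomized real RAM -/

/-- The memory without the counters. -/
structure Mem where
  /-- the arrays of natural numbers -/
  nat : ℕ → ℕ → ℕ
  /-- the arrays of real numbers -/
  real : ℕ → ℕ → ℝ

namespace Mem

/-- The state with the given memory and counters. -/
def st (m : Mem) (k q : ℕ) : State := ⟨m.nat, m.real, k, q⟩

/-- Overwrite a cell of an array of natural numbers. -/
def setN (m : Mem) (a i v : ℕ) : Mem :=
  { m with nat := Function.update m.nat a (Function.update (m.nat a) i v) }

/-- Overwrite a cell of an array of real numbers. -/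
def setR (m : Mem) (a i : ℕ) (v : ℝ) : Mem :=
  { m with real := Function.update m.real a (Function.update (m.real a) i v) }

variable (m : Mem) (a b i j v : ℕ) (x : ℝ)

@[simp] lemma setN_real : (m.setN a i v).real = m.real := rfl
@[simp] lemma setR_nat : (m.setR a i x).nat = m.nat := rfl
@[simp] lemma setN_nat_self : (m.setN a i v).nat a = Function.update (m.nat a) i v := by
  simp [setN]
@[simp] lemma setR_real_self : (m.setR a i x).real a = Function.update (m.real a) i x := by
  simp [setR]

variable {a b}

@[simp] lemma setN_nat_of_ne (h : b ≠ a) : (m.setN a i v).nat b = m.nat b := by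
  simp [setN, h]
@[simp] lemma setR_real_of_ne (h : b ≠ a) : (m.setR a i x).real b = m.real b := by
  simp [setR, h]

end Mem

/-- The memory of a state. -/
def State.mem (s : State) : Mem := ⟨s.nat, s.real⟩

/-- The value of an expression in a memory. -/
def NExp.ev (e : NExp) (m : Mem) : ℕ := e.eval (m.st 0 0)

/-- The value of an expression in a memory. -/
def RExp.ev (e : RExp) (m : Mem) : ℝ := e.eval (m.st 0 0)

/-- The truth value of a condition in a memory. -/
def BExp.ev (b : BExp) (m : Mem) : Prop := b.eval (m.st 0 0)

lemma NExp.eval_eq (e : NExp) (s : State) : e.eval s = e.ev s.mem := by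
  unfold NExp.ev
  induction e with
  | const k => rfl
  | read a i ih => simp [NExp.eval, ih]; rfl
  | add e f he hf => simp [NExp.eval, he, hf]
  | sub e f he hf => simp [NExp.eval, he, hf]
  | mul e f he hf => simp [NExp.eval, he, hf]

lemma RExp.eval_eq (e : RExp) (s : State) : e.eval s = e.ev s.mem := by
  unfold RExp.ev
  induction e with
  | cast e => simp only [RExp.eval, NExp.eval_eq]; rfl
  | read a i => simp only [RExp.eval, NExp.eval_eq]; rfl
  | add e f he hf => simp [RExp.eval, he, hf]
  | sub e f he hf => simp [RExp.eval, he, hf]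
  | mul e f he hf => simp [RExp.eval, he, hf]
  | div e f he hf => simp [RExp.eval, he, hf]
  | exp e he => simp [RExp.eval, he]

lemma BExp.eval_eq (b : BExp) (s : State) : b.eval s ↔ b.ev s.mem := by
  unfold BExp.ev
  induction b with
  | natLt e f => simp only [BExp.eval, NExp.eval_eq]; rfl
  | natEq e f => simp only [BExp.eval, NExp.eval_eq]; rfl
  | realLt e f => simp only [BExp.eval, RExp.eval_eq]; rfl
  | realEq e f => simp only [BExp.eval, RExp.eval_eq]; rfl
  | not b hb => simp [BExp.eval, hb]
  | and b c hb hc => simp [BExp.eval, hb, hc]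

section ev
variable (m : Mem) (e f : NExp) (x y : RExp) (a k : ℕ)

@[simp] lemma NExp.ev_const : (NExp.const k).ev m = k := rfl
@[simp] lemma NExp.ev_read : (NExp.read a e).ev m = m.nat a (e.ev m) := rfl
@[simp] lemma NExp.ev_add : (NExp.add e f).ev m = e.ev m + f.ev m := rfl
@[simp] lemma NExp.ev_sub : (NExp.sub e f).ev m = e.ev m - f.ev m := rfl
@[simp] lemma NExp.ev_mul : (NExp.mul e f).ev m = e.ev m * f.ev m := rfl
@[simp] lemma RExp.ev_cast : (RExp.cast e).ev m = (e.ev m : ℝ) := rfl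
@[simp] lemma RExp.ev_read : (RExp.read a e).ev m = m.real a (e.ev m) := rfl
@[simp] lemma RExp.ev_add : (RExp.add x y).ev m = x.ev m + y.ev m := rfl
@[simp] lemma RExp.ev_sub : (RExp.sub x y).ev m = x.ev m - y.ev m := rfl
@[simp] lemma RExp.ev_mul : (RExp.mul x y).ev m = x.ev m * y.ev m := rfl
@[simp] lemma RExp.ev_div : (RExp.div x y).ev m = x.ev m / y.ev m := rfl
@[simp] lemma RExp.ev_exp : (RExp.exp x).ev m = Real.exp (x.ev m) := rfl
@[simp] lemma BExp.ev_natLt : (BExp.natLt e f).ev m ↔ e.ev m < f.ev m := Iff.rfl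
@[simp] lemma BExp.ev_natEq : (BExp.natEq e f).ev m ↔ e.ev m = f.ev m := Iff.rfl
@[simp] lemma BExp.ev_realLt : (BExp.realLt x y).ev m ↔ x.ev m < y.ev m := Iff.rfl
@[simp] lemma BExp.ev_realEq : (BExp.realEq x y).ev m ↔ x.ev m = y.ev m := Iff.rfl

end ev

/-- The entry `y` of the answer of the oracle to the first `len` cells of `b`. -/
def ask {n : ℕ} (O : LogitOracle n) (b : ℕ → ℕ) (len y : ℕ) : ℝ :=
  if h : (∀ j : Fin len, b j < n) ∧ y < n then O len (fun j => ⟨b j, h.1 j⟩) ⟨y, h.2⟩ else 0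

lemma ask_congr {n : ℕ} (O : LogitOracle n) {b b' : ℕ → ℕ} {len : ℕ} (y : ℕ)
    (h : ∀ j < len, b j = b' j) : ask O b len y = ask O b' len y := by
  have h' : ∀ j : Fin len, b j = b' j := fun j => h j j.2
  simp only [ask, h']

/-- The effect of a query on the memory. -/
def Mem.ask {n : ℕ} (m : Mem) (O : LogitOracle n) (a i len b j : ℕ) : Mem :=
  { m with
    real := Function.update m.real b (fun c =>
      if j ≤ c ∧ c - j < n then LogitLearning.ask O (fun l => m.nat a (i + l)) len (c - j)
      else m.real b c) }

/-- An upper bound for the time of a program all of whose loops have at most `W` iterations, that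
stores no natural number larger than `W` and makes no query longer than `W`, for an alphabet of at
most `W` tokens. -/
def Cmd.bound (W : ℕ) : Cmd → ℕ
  | skip => 1
  | setNat _ i e => 1 + i.cost + e.cost + W
  | setReal _ i e => 1 + i.cost + e.cost
  | flip _ i e => 1 + i.cost + e.cost
  | query _ i len _ j => 1 + i.cost + len.cost + j.cost + W + W
  | seq c₁ c₂ => c₁.bound W + c₂.bound W
  | branch b c₁ c₂ => 1 + b.cost + (c₁.bound W + c₂.bound W)
  | loop b c => (W + 1) * (1 + b.cost + c.bound W)

/-- The nesting depth of the loops is fixed by the program, and each loop contributes a factor `W +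
1`. Natural coefficients are kept because they make the polynomial monotone on nonnegative reals. -/
lemma Cmd.exists_polynomial_bound (c : Cmd) :
    ∃ p : Polynomial ℕ, ∀ W, c.bound W = p.eval W := by
  induction c with
  | skip => exact ⟨1, by simp [bound]⟩
  | setNat a i e => exact ⟨.C (1 + i.cost + e.cost) + .X, by simp [bound]⟩
  | setReal a i e => exact ⟨.C (1 + i.cost + e.cost), by simp [bound]⟩
  | flip a i e => exact ⟨.C (1 + i.cost + e.cost), by simp [bound]⟩
  | query a i len b j =>
    exact ⟨.C (1 + i.cost + len.cost + j.cost) + .X + .X, by simp [bound]⟩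
  | seq c₁ c₂ h₁ h₂ =>
    obtain ⟨p, hp⟩ := h₁
    obtain ⟨q, hq⟩ := h₂
    exact ⟨p + q, by simp [bound, hp, hq]⟩
  | branch b c₁ c₂ h₁ h₂ =>
    obtain ⟨p, hp⟩ := h₁
    obtain ⟨q, hq⟩ := h₂
    exact ⟨.C (1 + b.cost) + (p + q), by simp [bound, hp, hq]⟩
  | loop b c h =>
    obtain ⟨p, hp⟩ := h
    exact ⟨(.X + 1) * (.C (1 + b.cost) + p), by simp [bound, hp]⟩

/-- The arrays of natural numbers that a program may change. -/
def Cmd.wn : Cmd → List ℕ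
  | skip => []
  | setNat a _ _ => [a]
  | setReal _ _ _ => []
  | flip a _ _ => [a]
  | query _ _ _ _ _ => []
  | seq c₁ c₂ => c₁.wn ++ c₂.wn
  | branch _ c₁ c₂ => c₁.wn ++ c₂.wn
  | loop _ c => c.wn

/-- The arrays of real numbers that a program may change. -/
def Cmd.wr : Cmd → List ℕ
  | skip => []
  | setNat _ _ _ => []
  | setReal a _ _ => [a]
  | flip _ _ _ => []
  | query _ _ _ b _ => [b]
  | seq c₁ c₂ => c₁.wr ++ c₂.wr
  | branch _ c₁ c₂ => c₁.wr ++ c₂.wr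
  | loop _ c => c.wr

/-- The two memories agree on all arrays that the program `c` does not write to. -/
structure Frame (c : Cmd) (m m' : Mem) : Prop where
  nat : ∀ a, a ∉ c.wn → m'.nat a = m.nat a
  real : ∀ a, a ∉ c.wr → m'.real a = m.real a

lemma Frame.refl (c : Cmd) (m : Mem) : Frame c m m := ⟨fun _ _ => rfl, fun _ _ => rfl⟩

lemma Frame.trans {c c' : Cmd} {m m' m'' : Mem} (h : Frame c m m') (h' : Frame c' m' m'')
    (hn : c'.wn ⊆ c.wn) (hr : c'.wr ⊆ c.wr) : Frame c m m'' :=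
  ⟨fun a ha => (h'.nat a fun h => ha (hn h)).trans (h.nat a ha),
    fun a ha => (h'.real a fun h => ha (hr h)).trans (h.real a ha)⟩

lemma Frame.mono {c c' : Cmd} {m m' : Mem} (h : Frame c' m m')
    (hn : c'.wn ⊆ c.wn) (hr : c'.wr ⊆ c.wr) : Frame c m m' :=
  (Frame.refl c m).trans h hn hr

/-! ### Hoare rules with time bounds and expectations -/

section Exec
variable {n : ℕ} {O : LogitOracle n}

lemma Exec.frame {c : Cmd} {s : State} {μ : PMF State} (h : Exec O c s μ) :
    ∀ s' ∈ μ.support, Frame c s.mem s'.mem := by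
  induction h with
  | skip s => simp [State.tick, State.mem, Frame.refl]
  | setNat s a i e =>
    simp only [PMF.support_pure, Set.mem_singleton_iff, forall_eq]
    refine ⟨fun b hb => ?_, fun b hb => rfl⟩
    have : b ≠ a := by simpa [Cmd.wn] using hb
    simp [State.tick, State.mem, State.writeNat, this]
  | setReal s a i e =>
    simp only [PMF.support_pure, Set.mem_singleton_iff, forall_eq]
    refine ⟨fun b hb => rfl, fun b hb => ?_⟩
    have : b ≠ a := by simpa [Cmd.wr] using hb
    simp [State.tick, State.mem, State.writeReal, this]
  | flip s a i e =>
    intro s' hs'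
    rw [PMF.support_map] at hs'
    obtain ⟨x, -, rfl⟩ := hs'
    refine ⟨fun b hb => ?_, fun b hb => rfl⟩
    have : b ≠ a := by simpa [Cmd.wn] using hb
    simp [State.tick, State.mem, State.writeNat, this]
  | query s a i len b j =>
    simp only [PMF.support_pure, Set.mem_singleton_iff, forall_eq]
    refine ⟨fun b hb => rfl, fun c hc => ?_⟩
    have : c ≠ b := by simpa [Cmd.wr] using hc
    simp [State.tick, State.mem, State.writeAnswer, this]
  | seq s c₁ c₂ μ κ _ _ h₁ h₂ =>
    intro s' hs'
    obtain ⟨t, ht, hts⟩ := (PMF.mem_support_bind_iff _ _ _).1 hs'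
    exact ((h₁ t ht).mono (c := .seq c₁ c₂) (by simp [Cmd.wn]) (by simp [Cmd.wr])).trans
      (h₂ t ht s' hts) (by simp [Cmd.wn]) (by simp [Cmd.wr])
  | branchTrue s b c₁ c₂ μ _ _ h =>
    intro s' hs'
    exact (h s' hs').mono (by simp [Cmd.wn]) (by simp [Cmd.wr])
  | branchFalse s b c₁ c₂ μ _ _ h =>
    intro s' hs'
    exact (h s' hs').mono (by simp [Cmd.wn]) (by simp [Cmd.wr])
  | loopFalse s b c _ => simp [State.tick, State.mem, Frame.refl]
  | loopTrue s b c μ κ _ _ _ h₁ h₂ =>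
    intro s' hs'
    obtain ⟨t, ht, hts⟩ := (PMF.mem_support_bind_iff _ _ _).1 hs'
    exact ((h₁ t ht).mono (c := .loop b c) (by simp [Cmd.wn]) (by simp [Cmd.wr])).trans
      (h₂ t ht s' hts) (by simp [Cmd.wn]) (by simp [Cmd.wr])

/-- A program makes at most one query per unit of time. -/
lemma Exec.queries_le {c : Cmd} {s : State} {μ : PMF State} (h : Exec O c s μ) :
    ∀ s' ∈ μ.support, s'.queries + s.steps ≤ s'.steps + s.queries := by
  induction h with
  | skip s => simp [State.tick]; omega
  | setNat s a i e => simp [State.tick, State.writeNat]; omega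
  | setReal s a i e => simp [State.tick, State.writeReal]; omega
  | flip s a i e =>
    intro s' hs'
    rw [PMF.support_map] at hs'
    obtain ⟨x, -, rfl⟩ := hs'
    simp [State.tick, State.writeNat]; omega
  | query s a i len b j => simp [State.tick, State.writeAnswer]; omega
  | seq s c₁ c₂ μ κ _ _ h₁ h₂ =>
    intro s' hs'
    obtain ⟨t, ht, hts⟩ := (PMF.mem_support_bind_iff _ _ _).1 hs'
    have := h₁ t ht
    have := h₂ t ht s' hts
    omega
  | branchTrue s b c₁ c₂ μ _ _ h =>
    intro s' hs'
    have := h s' hs'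
    simp [State.tick] at this; omega
  | branchFalse s b c₁ c₂ μ _ _ h =>
    intro s' hs'
    have := h s' hs'
    simp [State.tick] at this; omega
  | loopFalse s b c _ => simp [State.tick]; omega
  | loopTrue s b c μ κ _ _ _ h₁ h₂ =>
    intro s' hs'
    obtain ⟨t, ht, hts⟩ := (PMF.mem_support_bind_iff _ _ _).1 hs'
    have := h₁ t ht
    have := h₂ t ht s' hts
    simp [State.tick] at *; omega

/-- From the memory `m` the program `c` halts for every outcome of the coins, within time `B`; the
final memory always satisfies `Q`, and the expectation of `f` in the final memory is at most `v`. -/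
def Run (O : LogitOracle n) (B : ℕ) (c : Cmd) (m : Mem) (Q : Mem → Prop) (f : Mem → ℝ≥0∞)
    (v : ℝ≥0∞) : Prop :=
  ∀ k q, ∃ μ, Exec O c (m.st k q) μ ∧ (∀ s ∈ μ.support, s.steps ≤ k + B ∧ Q s.mem) ∧
    ∑' s, μ s * f s.mem ≤ v

/-- `Run` without an expectation, with the syntactic time bound. -/
abbrev Det (O : LogitOracle n) (W : ℕ) (c : Cmd) (m : Mem) (Q : Mem → Prop) : Prop :=
  Run O (c.bound W) c m Q (fun _ => 0) 0

variable {B B' B₁ B₂ W : ℕ} {c c₁ c₂ : Cmd} {m : Mem} {Q Q' : Mem → Prop} {f g : Mem → ℝ≥0∞}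
  {v v' : ℝ≥0∞}

lemma tsum_pure_mul (s : State) (f : Mem → ℝ≥0∞) :
    ∑' s', (PMF.pure s) s' * f s'.mem = f s.mem := by
  rw [tsum_eq_single s]
  · simp
  · intro s' hs'; simp [PMF.pure_apply, hs']

lemma tsum_bind_mul (μ : PMF State) (κ : State → PMF State) (f : Mem → ℝ≥0∞) :
    ∑' s, (μ.bind κ) s * f s.mem = ∑' s', μ s' * ∑' s, κ s' s * f s.mem := by
  simp only [PMF.bind_apply, ← ENNReal.tsum_mul_right, ← ENNReal.tsum_mul_left, mul_assoc]
  exact ENNReal.tsum_comm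

lemma Run.mono (h : Run O B c m Q f v) (hB : B ≤ B') (hQ : ∀ m', Q m' → Q' m' ∧ g m' ≤ f m')
    (hv : v ≤ v') : Run O B' c m Q' g v' := by
  intro k q
  obtain ⟨μ, h₁, h₂, h₃⟩ := h k q
  refine ⟨μ, h₁, fun s hs => ⟨(h₂ s hs).1.trans (by omega), (hQ _ (h₂ s hs).2).1⟩, ?_⟩
  refine le_trans (ENNReal.tsum_le_tsum fun s => ?_) (h₃.trans hv)
  by_cases hs : s ∈ μ.support
  · gcongr; exact (hQ _ (h₂ s hs).2).2
  · rw [PMF.mem_support_iff, not_not] at hs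
    simp [hs]

/-- Postconditions need only mention what changes. For a concrete program, the claim that an array
is untouched is a membership statement settled by `decide`. -/
lemma Run.frame (h : Run O B c m Q f v) :
    Run O B c m (fun m' => Q m' ∧ Frame c m m') f v := by
  intro k q
  obtain ⟨μ, h₁, h₂, h₃⟩ := h k q
  exact ⟨μ, h₁, fun s hs => ⟨(h₂ s hs).1, (h₂ s hs).2, h₁.frame s hs⟩, h₃⟩

/-- The expectation of a bounded function. -/
lemma Run.const {f' : Mem → ℝ≥0∞} (h : Run O B c m Q f' v') (hf : ∀ m', Q m' → f m' ≤ v) :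
    Run O B c m Q f v := by
  intro k q
  obtain ⟨μ, h₁, h₂, h₃⟩ := h k q
  refine ⟨μ, h₁, h₂, ?_⟩
  calc ∑' s, μ s * f s.mem ≤ ∑' s, μ s * v := by
        refine ENNReal.tsum_le_tsum fun s => ?_
        by_cases hs : s ∈ μ.support
        · gcongr; exact hf _ (h₂ s hs).2
        · rw [PMF.mem_support_iff, not_not] at hs
          simp [hs]
    _ = v := by rw [ENNReal.tsum_mul_right, PMF.tsum_coe, one_mul]

lemma Det.mono (h : Det O W c m Q) (hQ : ∀ m', Q m' → Frame c m m' → Q' m') :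
    Det O W c m Q' :=
  Run.mono h.frame le_rfl (fun m' hm => ⟨hQ m' hm.1 hm.2, le_rfl⟩) le_rfl

/-- The intermediate function `g` plays the role of a pre-expectation: it bounds the conditional
expectation of `f` given the memory between the two programs. -/
lemma Run.seq (h₁ : Run O B₁ c₁ m Q g v) (h₂ : ∀ m', Q m' → Run O B₂ c₂ m' Q' f (g m')) :
    Run O (B₁ + B₂) (.seq c₁ c₂) m Q' f v := by
  classical
  intro k q
  obtain ⟨μ, e₁, hμ, hv⟩ := h₁ k q
  have key : ∀ s ∈ μ.support, ∃ ν, Exec O c₂ s ν ∧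
      (∀ s' ∈ ν.support, s'.steps ≤ s.steps + B₂ ∧ Q' s'.mem) ∧
      ∑' s', ν s' * f s'.mem ≤ g s.mem := fun s hs => h₂ s.mem (hμ s hs).2 s.steps s.queries
  choose! κ hκ using key
  refine ⟨μ.bind κ, .seq _ _ _ _ _ e₁ fun s hs => (hκ s hs).1, fun s hs => ?_, ?_⟩
  · obtain ⟨t, ht, hts⟩ := (PMF.mem_support_bind_iff _ _ _).1 hs
    have h1 := (hμ t ht).1
    have h2 := (hκ t ht).2.1 s hts
    exact ⟨by omega, h2.2⟩
  · rw [tsum_bind_mul]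
    refine le_trans (ENNReal.tsum_le_tsum fun s => ?_) hv
    by_cases hs : s ∈ μ.support
    · gcongr; exact (hκ s hs).2.2
    · rw [PMF.mem_support_iff, not_not] at hs
      simp [hs]

lemma Run.loop_step {b : BExp} (hb : b.ev m) (h₁ : Run O B₁ c m Q g v)
    (h₂ : ∀ m', Q m' → Run O B₂ (.loop b c) m' Q' f (g m')) :
    Run O (1 + b.cost + B₁ + B₂) (.loop b c) m Q' f v := by
  classical
  intro k q
  obtain ⟨μ, e₁, hμ, hv⟩ := h₁ (k + (1 + b.cost)) q
  have key : ∀ s ∈ μ.support, ∃ ν, Exec O (.loop b c) s ν ∧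
      (∀ s' ∈ ν.support, s'.steps ≤ s.steps + B₂ ∧ Q' s'.mem) ∧
      ∑' s', ν s' * f s'.mem ≤ g s.mem := fun s hs => h₂ s.mem (hμ s hs).2 s.steps s.queries
  choose! κ hκ using key
  refine ⟨μ.bind κ, .loopTrue _ _ _ _ _ ((BExp.eval_eq _ _).2 hb) e₁
    fun s hs => (hκ s hs).1, fun s hs => ?_, ?_⟩
  · obtain ⟨t, ht, hts⟩ := (PMF.mem_support_bind_iff _ _ _).1 hs
    have h1 := (hμ t ht).1
    have h2 := (hκ t ht).2.1 s hts
    exact ⟨by omega, h2.2⟩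
  · rw [tsum_bind_mul]
    refine le_trans (ENNReal.tsum_le_tsum fun s => ?_) hv
    by_cases hs : s ∈ μ.support
    · gcongr; exact (hκ s hs).2.2
    · rw [PMF.mem_support_iff, not_not] at hs
      simp [hs]

lemma Run.of_pure {s' : ℕ → ℕ → State} {m' : Mem}
    (h : ∀ k q, Exec O c (m.st k q) (PMF.pure (s' k q)))
    (hs : ∀ k q, (s' k q).steps ≤ k + B) (hm : ∀ k q, (s' k q).mem = m') (hQ : Q m')
    (hf : f m' ≤ v) : Run O B c m Q f v := by
  intro k q
  refine ⟨_, h k q, fun s hs' => ?_, ?_⟩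
  · rw [PMF.support_pure, Set.mem_singleton_iff] at hs'
    subst hs'
    exact ⟨hs k q, by rw [hm]; exact hQ⟩
  · rw [tsum_pure_mul, hm]; exact hf

lemma Run.loop_exit {b : BExp} (hb : ¬ b.ev m) (hQ : Q m) (hf : f m ≤ v) :
    Run O (1 + b.cost) (.loop b c) m Q f v :=
  Run.of_pure (fun _ _ => .loopFalse _ _ _ (fun h => hb ((BExp.eval_eq _ _).1 h)))
    (fun _ _ => le_rfl) (fun _ _ => rfl) hQ hf

lemma Run.skip (hQ : Q m) (hf : f m ≤ v) : Run O 1 .skip m Q f v :=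
  Run.of_pure (fun _ _ => .skip _) (fun _ _ => le_rfl) (fun _ _ => rfl) hQ hf

lemma Run.setNat {a : ℕ} {i e : NExp} (hW : e.ev m ≤ W)
    (hQ : Q (m.setN a (i.ev m) (e.ev m))) (hf : f (m.setN a (i.ev m) (e.ev m)) ≤ v) :
    Run O ((Cmd.setNat a i e).bound W) (.setNat a i e) m Q f v := by
  refine Run.of_pure (fun k q => .setNat _ _ _ _) (fun k q => ?_) (fun k q => ?_) hQ hf
  · have h1 : Nat.size (e.eval (m.st k q)) ≤ W := by
      rw [NExp.eval_eq]
      -- A number has at most as many binary digits as its value, so a bound for the value also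
      -- bounds the time to store it.
      exact (Nat.size_le.2 Nat.lt_two_pow_self).trans hW
    simp only [State.tick, State.writeNat, Mem.st, Cmd.bound] at *
    omega
  · simp only [NExp.eval_eq]; rfl

lemma Run.setReal {a : ℕ} {i : NExp} {e : RExp}
    (hQ : Q (m.setR a (i.ev m) (e.ev m))) (hf : f (m.setR a (i.ev m) (e.ev m)) ≤ v) :
    Run O ((Cmd.setReal a i e).bound W) (.setReal a i e) m Q f v := by
  refine Run.of_pure (fun k q => .setReal _ _ _ _) (fun k q => le_rfl) (fun k q => ?_) hQ hf
  simp only [NExp.eval_eq, RExp.eval_eq]; rfl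

lemma Run.query {a : ℕ} {i len : NExp} {b : ℕ} {j : NExp} (hW : len.ev m ≤ W) (hn : n ≤ W)
    (hQ : Q (m.ask O a (i.ev m) (len.ev m) b (j.ev m)))
    (hf : f (m.ask O a (i.ev m) (len.ev m) b (j.ev m)) ≤ v) :
    Run O ((Cmd.query a i len b j).bound W) (.query a i len b j) m Q f v := by
  refine Run.of_pure (fun k q => .query _ _ _ _ _ _) (fun k q => ?_) (fun k q => ?_) hQ hf
  · have h1 : len.eval (m.st k q) ≤ W := by rwa [NExp.eval_eq]
    simp only [State.tick, State.writeAnswer, Mem.st, Cmd.bound] at *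
    omega
  · simp only [NExp.eval_eq]
    simp only [State.tick, State.writeAnswer, State.mem, Mem.ask, Mem.mk.injEq]
    refine ⟨rfl, ?_⟩
    simp only [Mem.st]
    congr 1
    funext c
    by_cases h : j.ev m ≤ c ∧ c - j.ev m < n
    · simp only [h, and_self, dite_true, if_true, LogitLearning.ask, State.answer, and_true]
    · rw [if_neg h]
      exact dif_neg h

lemma Run.flip {a : ℕ} {i : NExp} {e : RExp} {p : ℝ} (he : e.ev m = p) (h0 : 0 ≤ p) (h1 : p ≤ 1)
    (hQ1 : 0 < p → Q (m.setN a (i.ev m) 1)) (hQ0 : p < 1 → Q (m.setN a (i.ev m) 0))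
    (hf : ENNReal.ofReal p * f (m.setN a (i.ev m) 1) +
      ENNReal.ofReal (1 - p) * f (m.setN a (i.ev m) 0) ≤ v) :
    Run O ((Cmd.flip a i e).bound W) (.flip a i e) m Q f v := by
  intro k q
  have hm : ∀ x : Bool, ((((m.st k q).writeNat a (i.eval (m.st k q)) (if x then 1 else 0)).tick
      (1 + i.cost + e.cost)).mem) = m.setN a (i.ev m) (if x then 1 else 0) := by
    intro x
    simp only [NExp.eval_eq]; rfl
  have hp : min 1 (ENNReal.ofReal p) = ENNReal.ofReal p := by
    rw [min_eq_right]
    simpa using h1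
  refine ⟨_, .flip _ _ _ _, fun s hs => ?_, ?_⟩
  · rw [PMF.support_map] at hs
    obtain ⟨x, hx, rfl⟩ := hs
    refine ⟨by simp only [State.tick, State.writeNat, Mem.st, Cmd.bound]; omega, ?_⟩
    rw [hm]
    rw [PMF.mem_support_iff, coin, PMF.ofFintype_apply, RExp.eval_eq,
      show (m.st k q).mem = m from rfl, he, hp] at hx
    cases x
    · simp only [Bool.false_eq_true, if_false] at hx ⊢
      refine hQ0 (lt_of_not_ge fun h => hx ?_)
      rw [le_antisymm h1 h]
      simp
    · simp only [if_true] at hx ⊢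
      refine hQ1 (lt_of_not_ge fun h => hx ?_)
      simpa using h
  · rw [← PMF.bind_pure_comp]
    have : ∀ κ : Bool → PMF State, ∑' s, ((coin (e.eval (m.st k q))).bind κ) s * f s.mem =
        ∑' x, coin (e.eval (m.st k q)) x * ∑' s, κ x s * f s.mem := by
      intro κ
      simp only [PMF.bind_apply, ← ENNReal.tsum_mul_right, ← ENNReal.tsum_mul_left, mul_assoc]
      exact ENNReal.tsum_comm
    rw [this, tsum_fintype, Fintype.sum_bool]
    simp only [Function.comp_apply, tsum_pure_mul, hm]
    refine le_trans (le_of_eq ?_) hf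
    rw [coin, PMF.ofFintype_apply, PMF.ofFintype_apply, RExp.eval_eq,
      show (m.st k q).mem = m from rfl, he, hp]
    have h1' := hm true
    simp only [if_true] at h1'
    simp only [if_true, Bool.false_eq_true, if_false]
    rw [ENNReal.ofReal_sub _ h0, ENNReal.ofReal_one, h1']

/-- The sum of the two costs, instead of their maximum, keeps the bound polynomial in `W`. -/
lemma Run.branch {b : BExp} (h₁ : b.ev m → Run O B₁ c₁ m Q f v)
    (h₂ : ¬ b.ev m → Run O B₂ c₂ m Q f v) :
    Run O (1 + b.cost + (B₁ + B₂)) (.branch b c₁ c₂) m Q f v := by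
  intro k q
  by_cases hb : b.ev m
  · obtain ⟨μ, e, h, hv⟩ := h₁ hb (k + (1 + b.cost)) q
    exact ⟨μ, .branchTrue _ _ _ _ _ ((BExp.eval_eq _ _).2 hb) e,
      fun s hs => ⟨by have := (h s hs).1; omega, (h s hs).2⟩, hv⟩
  · obtain ⟨μ, e, h, hv⟩ := h₂ hb (k + (1 + b.cost)) q
    exact ⟨μ, .branchFalse _ _ _ _ _ (fun h => hb ((BExp.eval_eq _ _).1 h)) e,
      fun s hs => ⟨by have := (h s hs).1; omega, (h s hs).2⟩, hv⟩

lemma Det.seq (h₁ : Det O W c₁ m Q) (h₂ : ∀ m', Q m' → Det O W c₂ m' Q') :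
    Det O W (.seq c₁ c₂) m Q' :=
  Run.seq h₁ h₂

lemma Det.setNat {a : ℕ} {i e : NExp} (hW : e.ev m ≤ W)
    (hQ : Q (m.setN a (i.ev m) (e.ev m))) : Det O W (.setNat a i e) m Q :=
  Run.setNat hW hQ le_rfl

lemma Det.setReal {a : ℕ} {i : NExp} {e : RExp}
    (hQ : Q (m.setR a (i.ev m) (e.ev m))) : Det O W (.setReal a i e) m Q :=
  Run.setReal hQ le_rfl

lemma Det.query {a : ℕ} {i len : NExp} {b : ℕ} {j : NExp} (hW : len.ev m ≤ W) (hn : n ≤ W)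
    (hQ : Q (m.ask O a (i.ev m) (len.ev m) b (j.ev m))) : Det O W (.query a i len b j) m Q :=
  Run.query hW hn hQ le_rfl

lemma Det.branch {b : BExp} (h₁ : b.ev m → Det O W c₁ m Q) (h₂ : ¬ b.ev m → Det O W c₂ m Q) :
    Det O W (.branch b c₁ c₂) m Q :=
  Run.branch h₁ h₂

lemma Det.skip (hQ : Q m) : Det O W .skip m Q := Run.skip hQ le_rfl

/-- A scalar variable: the first cell of an array. -/
abbrev NExp.var (x : ℕ) : NExp := .read x (.const 0)

/-- The loop in which the variable `x` runs through the numbers below `e`. -/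
def Cmd.forTo (x : ℕ) (e : NExp) (c : Cmd) : Cmd :=
  .seq (.setNat x (.const 0) (.const 0))
    (.loop (.natLt (.var x) e) (.seq c (.setNat x (.const 0) (.add (.var x) (.const 1)))))

/-- The potential `V` behaves as a supermartingale: one iteration does not raise it in expectation.
The limit `e` is evaluated anew in each iteration, so it must have the same value in all memories
that the loop can reach. -/
lemma Run.forTo {x : ℕ} {e : NExp} {N : ℕ} (I : ℕ → Mem → Prop) (V : ℕ → Mem → ℝ≥0∞)
    (hN : N ≤ W) (hx : x ∉ c.wn)
    (he : ∀ m', Frame (.forTo x e c) m m' → e.ev m' = N)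
    (h0 : I 0 (m.setN x 0 0)) (hv : V 0 (m.setN x 0 0) ≤ v)
    (hs : ∀ i < N, ∀ m', Frame (.forTo x e c) m m' → m'.nat x 0 = i → I i m' →
      Run O (c.bound W) c m' (fun m'' => I (i + 1) (m''.setN x 0 (i + 1)))
        (fun m'' => V (i + 1) (m''.setN x 0 (i + 1))) (V i m')) :
    Run O ((Cmd.forTo x e c).bound W) (.forTo x e c) m (fun m' => I N m') (V N) v := by
  have hwx : x ∈ (Cmd.forTo x e c).wn := by simp [Cmd.forTo, Cmd.wn]
  have hwc : c.wn ⊆ (Cmd.forTo x e c).wn := by intro a ha; simp [Cmd.forTo, Cmd.wn, ha]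
  have hwr : c.wr ⊆ (Cmd.forTo x e c).wr := by simp [Cmd.forTo, Cmd.wr]
  have hset : ∀ m' k, Frame (.forTo x e c) m m' → Frame (.forTo x e c) m (m'.setN x 0 k) := by
    intro m' k h
    refine ⟨fun a ha => ?_, fun a ha => h.real a ha⟩
    have : a ≠ x := fun hax => ha (hax ▸ hwx)
    simpa [this] using h.nat a ha
  set b : BExp := .natLt (.var x) e
  set c' : Cmd := .seq c (.setNat x (.const 0) (.add (.var x) (.const 1)))
  -- Induction on the number `j` of remaining iterations; the factor `j + 1` accounts for the final
  -- test of the loop condition.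
  have main : ∀ j i, i + j = N → ∀ m', Frame (.forTo x e c) m m' → m'.nat x 0 = i → I i m' →
      Run O ((j + 1) * (1 + b.cost + c'.bound W)) (.loop b c') m' (fun m' => I N m') (V N)
        (V i m') := by
    intro j
    induction j with
    | zero =>
      intro i hi m' hF hxi hI
      obtain rfl : i = N := by omega
      refine (Run.loop_exit (Q := fun m' => I i m') (f := V i) (v := V i m')
        (by simp [b, hxi, he m' hF]) hI le_rfl).mono (by simp)
        (fun m'' h => ⟨h, le_rfl⟩) le_rfl
    | succ j ih =>
      intro i hi m' hF hxi hI
      have h1 := (hs i (by omega) m' hF hxi hI).frame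
      have h2 : Run O (c'.bound W) c' m' (fun m'' => Frame (.forTo x e c) m m'' ∧
          m''.nat x 0 = i + 1 ∧ I (i + 1) m'') (V (i + 1)) (V i m') := by
        refine Run.seq h1 fun m'' hm => ?_
        have hx'' : m''.nat x 0 = i := by rw [hm.2.nat x hx, hxi]
        refine Run.setNat (by simp [hx'']; omega) ⟨?_, ?_, ?_⟩ ?_
        · exact hset _ _ (hF.trans hm.2 hwc hwr)
        · simp [hx'']
        · simpa [hx''] using hm.1
        · simp [hx'']
      refine (Run.loop_step (by simp [b, hxi, he m' hF, ← hi]) h2 fun m'' hm =>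
        ih (i + 1) (by omega) m'' hm.1 hm.2.1 hm.2.2).mono (le_of_eq (by ring))
        (fun m'' h => ⟨h, le_rfl⟩) le_rfl
  have hfirst : Run O ((Cmd.setNat x (.const 0) (.const 0)).bound W)
      (.setNat x (.const 0) (.const 0)) m (fun m' => m' = m.setN x 0 0) (V 0) v :=
    Run.setNat (by simp) rfl hv
  refine (Run.seq hfirst fun m' hm' => main N 0 (by omega) m' ?_ ?_ ?_).mono ?_
    (fun m'' h => ⟨h, le_rfl⟩) le_rfl
  · rw [hm']; exact hset _ _ (Frame.refl _ _)
  · simp [hm']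
  · rw [hm']; exact h0
  · simp only [Cmd.forTo, Cmd.bound, b, c']
    gcongr

lemma Det.forTo {x : ℕ} {e : NExp} {N : ℕ} (I : ℕ → Mem → Prop)
    (hN : N ≤ W) (hx : x ∉ c.wn)
    (he : ∀ m', Frame (.forTo x e c) m m' → e.ev m' = N)
    (h0 : I 0 (m.setN x 0 0))
    (hs : ∀ i < N, ∀ m', Frame (.forTo x e c) m m' → m'.nat x 0 = i → I i m' →
      Det O W c m' (fun m'' => I (i + 1) (m''.setN x 0 (i + 1)))) :
    Det O W (.forTo x e c) m (fun m' => I N m') :=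
  Run.forTo I (fun _ _ => 0) hN hx he h0 le_rfl hs

end Exec

/-! ## Hypotheses and their refinement -/

/-- The string that agrees with `p` before the position `i` and with `w` from there on. -/
def splice (i : ℕ) (p w : ℕ → ℕ) : ℕ → ℕ := fun c => if c < i then p c else w c

lemma splice_lt {i n : ℕ} {p w : ℕ → ℕ} (hp : ∀ c, p c < n) (hw : ∀ c, w c < n) (c : ℕ) :
    splice i p w c < n := by
  unfold splice; split_ifs <;> simp [hp, hw]

/-- The logit of `y` after the prefix of length `e` of the splice of `p` and `w` at `i`. -/
def val {n : ℕ} (O : LogitOracle n) (i e : ℕ) (p w : ℕ → ℕ) (y : ℕ) : ℝ :=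
  ask O (splice i p w) e y

lemma val_congr {n : ℕ} (O : LogitOracle n) {i e y : ℕ} {p p' w w' : ℕ → ℕ}
    (hp : ∀ c < i, p c = p' c) (hw : ∀ c < e, w c = w' c) :
    val O i e p w y = val O i e p' w' y := by
  refine ask_congr O y fun j hj => ?_
  unfold splice
  split_ifs with h
  · exact hp j h
  · exact hw j hj

/-- The token at position `i` may be counted with the continuation or with the prefix. This moves a
logit from level `i` to level `i + 1`. -/
lemma val_splice {n : ℕ} (O : LogitOracle n) (i e : ℕ) (p w : ℕ → ℕ) (y : ℕ) :
    val O (i + 1) e (splice i p w) w y = val O i e p w y := by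
  refine ask_congr O y fun j _ => ?_
  unfold splice
  split_ifs <;> first | rfl | omega

/-- The logits after a prefix are linear functions of a `k`-dimensional state of each shorter
prefix. -/
def IsLinear {n : ℕ} (O : LogitOracle n) (k : ℕ) : Prop :=
  ∃ X : ℕ → (ℕ → ℕ) → Fin k → ℝ, ∀ i e w y, i ≤ e → (∀ c, w c < n) → y < n →
    ∃ α : Fin k → ℝ, ∀ p, (∀ c, p c < n) → val O i e p w y = α ⬝ᵥ X i p

/-- For each level `i` a list of `r i` strings `p i j`, whose first `i` tokens are used as
prefixes, a list of `r i` tests, each of which asks for the logit of `y i l` after the prefix of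
length `e i l` of the string `w i l`, and coefficients `K i`. -/
structure Hyp where
  p : ℕ → ℕ → ℕ → ℕ
  w : ℕ → ℕ → ℕ → ℕ
  e : ℕ → ℕ → ℕ
  y : ℕ → ℕ → ℕ
  K : ℕ → ℕ → ℕ → ℝ
  r : ℕ → ℕ

namespace Hyp

variable {n : ℕ} (O : LogitOracle n) (d : ℕ) (H : Hyp)

/-- The value of the test `l` of the level `i` on the prefix `x`. -/
def test (i : ℕ) (x : ℕ → ℕ) (l : ℕ) : ℝ := val O i (H.e i l) x (H.w i l) (H.y i l)

/-- The combination of the prefixes of the level `i` with the coefficients `K i l`. -/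
def basis (i l : ℕ) (φ : (ℕ → ℕ) → ℝ) : ℝ := ∑ j ∈ Finset.range d, H.K i l j * φ (H.p i j)

/-- The value of the combination `l` at the logit of `y` after the first `t` tokens of `z`. -/
def dualVal (i t : ℕ) (z : ℕ → ℕ) (y l : ℕ) : ℝ := H.basis d i l fun p => val O i t p z y

/-- The extension by a token of `z` of the prefix `j` of the level before `i`. -/
def cand (i j : ℕ) (z : ℕ → ℕ) : ℕ → ℕ := splice (i - 1) (H.p (i - 1) j) z

/-- The error of the interpolation of the prefix `x` by the prefixes of the level `i`. -/
def resid (i t : ℕ) (x z : ℕ → ℕ) (y : ℕ) : ℝ :=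
  val O i t x z y - ∑ l ∈ Finset.range d, H.test O i x l * H.dualVal O d i t z y l

/-- The coefficients of the normalized error of interpolation. -/
def coef (i t : ℕ) (x z : ℕ → ℕ) (y j : ℕ) : ℝ :=
  ((if j = H.r i then 1 else 0) - ∑ l ∈ Finset.range d, H.test O i x l * H.K i l j) /
    H.resid O d i t x z y

/-- The refinement by a prefix `x` and a test whose interpolation error does not vanish. -/
def pivot (i t : ℕ) (x z : ℕ → ℕ) (y : ℕ) : Hyp where
  p i' j := if i' = i ∧ j = H.r i then x else H.p i' j
  w i' l := if i' = i ∧ l = H.r i then z else H.w i' l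
  e i' l := if i' = i ∧ l = H.r i then t else H.e i' l
  y i' l := if i' = i ∧ l = H.r i then y else H.y i' l
  -- Rank-one update of the inverse matrix. Row `H.r i` of the old `K` vanishes under the invariant,
  -- so the factor `-1` makes the new row equal to `coef`; the other rows lose the multiple that
  -- makes them vanish on the new test.
  K i' l j := if i' = i then
      H.K i l j - (if l = H.r i then -1 else H.dualVal O d i t z y l) * H.coef O d i t x z y j
    else H.K i' l j
  r := Function.update H.r i (H.r i + 1)

/-- The prefixes and tests of each level are dual to each other. -/
structure Inv (T : ℕ) : Prop where
  p_lt : ∀ i j c, H.p i j c < n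
  w_lt : ∀ i j c, H.w i j c < n
  y_lt : ∀ i l, H.y i l < n
  e_le : ∀ i l, H.e i l ≤ T
  le_e : ∀ i, ∀ l < H.r i, i ≤ H.e i l
  r_le : ∀ i, H.r i ≤ d
  K_zero : ∀ i l j, H.r i ≤ l ∨ H.r i ≤ j → H.K i l j = 0
  dual : ∀ i, ∀ l < H.r i, ∀ m < H.r i,
    H.basis d i l (fun p => H.test O i p m) = if l = m then 1 else 0

variable {O d H} {T : ℕ}

/-- All lists are padded to length `d`. The zero coefficients of the padding make its arbitrary
prefixes and tests harmless, so sums can run over `range d` at every level. -/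
lemma Inv.basis_zero (hH : H.Inv O d T) {i l : ℕ} (hl : H.r i ≤ l) (φ : (ℕ → ℕ) → ℝ) :
    H.basis d i l φ = 0 :=
  Finset.sum_eq_zero fun j _ => by rw [hH.K_zero i l j (Or.inl hl), zero_mul]

/-- By duality, interpolation is exact on the tests already stored at the level. -/
lemma Inv.sum_basis (hH : H.Inv O d T) {i m : ℕ} (hm : m < H.r i) (c : ℕ → ℝ) :
    ∑ l ∈ Finset.range d, c l * H.basis d i l (fun p => H.test O i p m) = c m := by
  rw [Finset.sum_eq_single m]
  · rw [hH.dual i m hm m hm, if_pos rfl, mul_one]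
  · intro l _ hlm
    by_cases hl : l < H.r i
    · rw [hH.dual i l hl m hm, if_neg hlm, mul_zero]
    · rw [hH.basis_zero (not_lt.1 hl), mul_zero]
  · intro h
    exact absurd (Finset.mem_range.2 (hm.trans_le (hH.r_le i))) h

/-- Vectors with a nonsingular triangular matrix of products are at most as many as the
dimension. -/
lemma card_le_of_triangular {k R : ℕ} (α v : ℕ → Fin k → ℝ) (h0 : ∀ l < R, α l ⬝ᵥ v l ≠ 0)
    (h1 : ∀ l < R, ∀ m < l, α m ⬝ᵥ v l = 0) : R ≤ k := by
  have hli : LinearIndependent ℝ (fun l : Fin R => v l) := by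
    rw [Fintype.linearIndependent_iff]
    intro c hc
    have key : ∀ j : ℕ, ∀ hj : j < R, c ⟨j, hj⟩ = 0 := by
      intro j
      induction j using Nat.strong_induction_on with
      | _ j ih =>
        intro hj
        have h2 : α j ⬝ᵥ (∑ l : Fin R, c l • v l) = 0 := by rw [hc, dotProduct_zero]
        rw [dotProduct_sum, Finset.sum_eq_single ⟨j, hj⟩] at h2
        · rw [dotProduct_smul, smul_eq_mul] at h2
          exact (mul_eq_zero.1 h2).resolve_right (h0 j hj)
        · intro l _ hl
          rcases lt_trichotomy (l : ℕ) j with h | h | h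
          · rw [ih l h l.2, zero_smul, dotProduct_zero]
          · exact absurd (Fin.ext h) hl
          · rw [dotProduct_smul, h1 l l.2 j h, smul_zero]
        · simp
    exact fun l => key l l.2
  simpa using hli.fintype_card_le_finrank

/-- A prefix can only be added while the rank is smaller than the dimension of the state. -/
lemma Inv.r_lt (hH : H.Inv O d T) {k : ℕ} (hO : IsLinear O k) {i t y : ℕ} {x z : ℕ → ℕ}
    (hit : i ≤ t) (hx : ∀ c, x c < n) (hz : ∀ c, z c < n) (hy : y < n)
    (hs : H.resid O d i t x z y ≠ 0) : H.r i < k := by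
  obtain ⟨X, hX⟩ := hO
  have h1 : ∀ l, ∃ α : Fin k → ℝ, l < H.r i →
      ∀ p, (∀ c, p c < n) → H.test O i p l = α ⬝ᵥ X i p := by
    intro l
    by_cases hl : l < H.r i
    · obtain ⟨α, hα⟩ := hX i (H.e i l) (H.w i l) (H.y i l) (hH.le_e i l hl) (hH.w_lt i l)
        (hH.y_lt i l)
      exact ⟨α, fun _ => hα⟩
    · exact ⟨0, fun h => absurd h hl⟩
  choose α hα using h1
  obtain ⟨β, hβ⟩ := hX i t z y hit hz hy
  set v : ℕ → Fin k → ℝ := fun l => ∑ j ∈ Finset.range d, H.K i l j • X i (H.p i j)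
  have hbasis : ∀ (γ : Fin k → ℝ) (φ : (ℕ → ℕ) → ℝ),
      (∀ p, (∀ c, p c < n) → φ p = γ ⬝ᵥ X i p) → ∀ l, H.basis d i l φ = γ ⬝ᵥ v l := by
    intro γ φ h l
    simp only [basis, v, dotProduct_sum, dotProduct_smul, smul_eq_mul]
    exact Finset.sum_congr rfl fun j _ => by rw [h _ (hH.p_lt i j)]
  -- The part of the state of `x` missed by interpolation. It is annihilated by the functionals `α`
  -- of the stored tests, while `β` takes the value `resid` on it.
  set x' : Fin k → ℝ := X i x - ∑ l ∈ Finset.range d, H.test O i x l • v l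
  have hαv : ∀ l < H.r i, ∀ m < H.r i, α m ⬝ᵥ v l = if l = m then 1 else 0 := by
    intro l hl m hm
    rw [← hH.dual i l hl m hm, hbasis (α m) _ (hα m hm)]
  have hγx : ∀ (γ : Fin k → ℝ) (φ : (ℕ → ℕ) → ℝ),
      (∀ p, (∀ c, p c < n) → φ p = γ ⬝ᵥ X i p) →
      γ ⬝ᵥ x' = φ x - ∑ l ∈ Finset.range d, H.test O i x l * H.basis d i l φ := by
    intro γ φ h
    simp only [x', dotProduct_sub, dotProduct_sum, dotProduct_smul, smul_eq_mul,
      hbasis γ φ h, h x hx]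
  have hαx : ∀ m < H.r i, α m ⬝ᵥ x' = 0 := by
    intro m hm
    rw [hγx (α m) _ (hα m hm), hH.sum_basis hm, sub_self]
  have hβx : β ⬝ᵥ x' ≠ 0 := by
    rw [hγx β _ hβ]
    exact hs
  -- Adjoining the pair `(β, x')` to the biorthogonal pairs `(α l, v l)` gives a triangular system
  -- of `H.r i + 1` vectors in dimension `k`.
  refine Nat.lt_of_succ_le (card_le_of_triangular (R := H.r i + 1)
    (fun l => if l = H.r i then β else α l) (fun l => if l = H.r i then x' else v l) ?_ ?_)
  · intro l hl
    by_cases h : l = H.r i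
    · simpa [h] using hβx
    · simp only [h, if_false]
      rw [hαv l (by omega) l (by omega)]
      simp
  · intro l hl m hm
    have h : m ≠ H.r i := by omega
    simp only [h, if_false]
    split_ifs with h'
    · exact hαx m (by omega)
    · rw [hαv l (by omega) m (by omega), if_neg (by omega)]

/-- The coefficients `coef` represent the functional "interpolation error at `x`, divided by
`resid`", and the update subtracts multiples of it. -/
lemma pivot_basis (hH : H.Inv O d T) {i t y : ℕ} {x z : ℕ → ℕ} (hr : H.r i < d)
    (φ : (ℕ → ℕ) → ℝ) (l : ℕ) :
    (H.pivot O d i t x z y).basis d i l φ = H.basis d i l φ -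
      -- In the new slot the old combination is zero, so the sign `-1` leaves the normalized error
      -- itself.
      (if l = H.r i then -1 else H.dualVal O d i t z y l) *
        ((φ x - ∑ m ∈ Finset.range d, H.test O i x m * H.basis d i m φ) /
          H.resid O d i t x z y) := by
  -- The column `H.r i` of the old coefficients is zero, so replacing the padding prefix there by
  -- `x` changes nothing.
  have hK : ∀ l j, H.K i l j * φ (if j = H.r i then x else H.p i j) =
      H.K i l j * φ (H.p i j) := by
    intro l j
    split_ifs with h
    · rw [hH.K_zero i l j (Or.inr h.ge), zero_mul, zero_mul]
    · rfl
  have hδ : ∑ j ∈ Finset.range d,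
      (if j = H.r i then (1 : ℝ) else 0) * φ (if j = H.r i then x else H.p i j) = φ x := by
    rw [Finset.sum_eq_single (H.r i)]
    · simp
    · intro j _ hj; simp [hj]
    · intro h; exact absurd (Finset.mem_range.2 hr) h
  have hcoef : ∑ j ∈ Finset.range d,
      H.coef O d i t x z y j * φ (if j = H.r i then x else H.p i j) =
      (φ x - ∑ m ∈ Finset.range d, H.test O i x m * H.basis d i m φ) /
          H.resid O d i t x z y := by
    simp only [coef, div_mul_eq_mul_div, ← Finset.sum_div, sub_mul, Finset.sum_sub_distrib, hδ,
      Finset.sum_mul, mul_assoc, hK, basis, Finset.mul_sum]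
    rw [Finset.sum_comm]
  simp only [basis, pivot, true_and, if_true, sub_mul, hK, Finset.sum_sub_distrib, mul_assoc,
    ← Finset.mul_sum, hcoef]

/-- The normalized error vanishes on all old tests and equals one on the new test. Subtracting from
each old combination its value at the new test times this functional restores duality. The rank
bound provides the free slot. -/
lemma Inv.pivot (hH : H.Inv O d T) {k : ℕ} (hO : IsLinear O k) (hk : k ≤ d) {i t y : ℕ}
    {x z : ℕ → ℕ} (hit : i ≤ t) (htT : t ≤ T) (hx : ∀ c, x c < n) (hz : ∀ c, z c < n)
    (hy : y < n) (hs : H.resid O d i t x z y ≠ 0) : (H.pivot O d i t x z y).Inv O d T := by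
  have hrd : H.r i < d := (hH.r_lt hO hit hx hz hy hs).trans_le hk
  have hrne : ∀ i', i' ≠ i → (H.pivot O d i t x z y).r i' = H.r i' := fun i' h => by
    simp [Hyp.pivot, h]
  have hreq : (H.pivot O d i t x z y).r i = H.r i + 1 := by simp [Hyp.pivot]
  refine ⟨fun i' j c => ?_, fun i' j c => ?_, fun i' l => ?_, fun i' l => ?_, fun i' l hl => ?_,
    fun i' => ?_, fun i' l j h => ?_, fun i' l hl m hm => ?_⟩
  · simp only [Hyp.pivot]; split_ifs; exacts [hx c, hH.p_lt i' j c]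
  · simp only [Hyp.pivot]; split_ifs; exacts [hz c, hH.w_lt i' j c]
  · simp only [Hyp.pivot]; split_ifs; exacts [hy, hH.y_lt i' l]
  · simp only [Hyp.pivot]; split_ifs; exacts [htT, hH.e_le i' l]
  · by_cases h : i' = i
    · subst h
      rw [hreq] at hl
      simp only [Hyp.pivot]
      split_ifs with h'
      · exact hit
      · exact hH.le_e i' l (by simp at h'; omega)
    · rw [hrne i' h] at hl
      simpa [Hyp.pivot, h] using hH.le_e i' l hl
  · by_cases h : i' = i
    · subst h; rw [hreq]; omega
    · rw [hrne i' h]; exact hH.r_le i'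
  · by_cases hi : i' = i
    · subst hi
      rw [hreq] at h
      simp only [Hyp.pivot, if_true]
      rw [hH.K_zero i' l j (by omega)]
      rcases h with h | h
      · rw [if_neg (by omega), dualVal, hH.basis_zero (by omega)]
        simp
      · have : H.coef O d i' t x z y j = 0 := by
          rw [coef, if_neg (by omega), Finset.sum_eq_zero, sub_zero, zero_div]
          intro l _
          rw [hH.K_zero i' l j (by omega), mul_zero]
        rw [this]
        simp
    · rw [hrne i' hi] at h
      simpa [Hyp.pivot, hi] using hH.K_zero i' l j h
  · by_cases hi : i' = i
    · subst hi
      rw [hreq] at hl hm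
      rw [pivot_basis hH hrd]
      by_cases hmr : m = H.r i'
      · have h1 : (fun p => (H.pivot O d i' t x z y).test O i' p m) =
            fun p => val O i' t p z y := by
          funext p; simp [test, Hyp.pivot, hmr]
        rw [h1, congrFun h1 x]
        have h2 : (val O i' t x z y - ∑ m ∈ Finset.range d, H.test O i' x m *
            H.basis d i' m fun p => val O i' t p z y) / H.resid O d i' t x z y = 1 := div_self hs
        rw [h2]
        by_cases hlr : l = H.r i'
        · rw [if_pos hlr, hH.basis_zero hlr.ge, if_pos (by omega)]
          ring
        · rw [if_neg hlr, if_neg (by omega), dualVal]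
          ring
      · have h1 : (fun p => (H.pivot O d i' t x z y).test O i' p m) =
            fun p => H.test O i' p m := by
          funext p; simp [test, Hyp.pivot, hmr]
        rw [h1, congrFun h1 x, hH.sum_basis (by omega), sub_self, zero_div, mul_zero, sub_zero]
        by_cases hlr : l = H.r i'
        · rw [hH.basis_zero hlr.ge, if_neg (by omega)]
        · exact hH.dual i' l (by omega) m (by omega)
    · rw [hrne i' hi] at hl hm
      simpa [basis, test, Hyp.pivot, hi] using hH.dual i' l hl m hm

/-! ## The predictions of a hypothesis -/

variable (O d H)

/-- The predicted transition matrices. -/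
def trans (t : ℕ) (z : ℕ → ℕ) (l m : ℕ) : ℝ :=
  H.basis d t m fun p => H.test O (t + 1) (splice t p z) l

/-- The predicted state. -/
def state (z : ℕ → ℕ) : ℕ → ℕ → ℝ
  | 0, l => H.test O 0 z l
  | t + 1, l => ∑ m ∈ Finset.range d, H.trans O d t z l m * state z t m

/-- All interpolation errors that are computed from the sequence `z` vanish. -/
def Good (T : ℕ) (z : ℕ → ℕ) : Prop :=
  ∀ t < T, ∀ i ≤ t, ∀ j < d, ∀ y < n, H.resid O d i t (H.cand i j z) z y = 0

variable {O d H}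

/-- Only the empty prefix exists at level `0`, so the initial state of the prediction is the same
for all sequences. -/
lemma test_zero (x x' : ℕ → ℕ) (l : ℕ) : H.test O 0 x l = H.test O 0 x' l :=
  val_congr O (fun c hc => absurd hc (Nat.not_lt_zero c)) fun _ _ => rfl

/-- A hypothesis is correct along the sequences on which it is consistent. -/
lemma Good.predict {z : ℕ → ℕ} (h : H.Good O d T z) (hd : 0 < d) {t y : ℕ} (ht : t < T)
    (hy : y < n) :
    ask O z t y = ∑ m ∈ Finset.range d, H.dualVal O d t t z y m * H.state O d z t m := by
  -- The identity at `i` expresses the true logit through the predicted state at time `i`. To pass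
  -- to `i + 1`, every stored prefix of level `i`, extended by the token `z i`, is interpolated at
  -- level `i + 1`; vanishing errors turn the dual values at `i` into dual values at `i + 1` times
  -- the transition matrix.
  have key : ∀ i ≤ t,
      ask O z t y = ∑ m ∈ Finset.range d, H.dualVal O d i t z y m * H.state O d z i m := by
    intro i
    induction i with
    | zero =>
      intro _
      have h0 := h t ht 0 (Nat.zero_le _) 0 hd y hy
      rw [resid, sub_eq_zero] at h0
      have h1 : val O 0 t (H.cand 0 0 z) z y = ask O z t y :=
        ask_congr O y fun j _ => by simp [splice]
      rw [← h1, h0]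
      refine Finset.sum_congr rfl fun l _ => ?_
      rw [mul_comm, state, test_zero]
    | succ i ih =>
      intro hi
      rw [ih (by omega)]
      have h1 : ∀ m, H.dualVal O d i t z y m = ∑ l ∈ Finset.range d,
          H.dualVal O d (i + 1) t z y l * H.trans O d i z l m := by
        intro m
        have h2 : ∀ j ∈ Finset.range d, H.K i m j * val O i t (H.p i j) z y =
            ∑ l ∈ Finset.range d, H.dualVal O d (i + 1) t z y l *
              (H.K i m j * H.test O (i + 1) (splice i (H.p i j) z) l) := by
          intro j hj
          have h3 := h t ht (i + 1) hi j (Finset.mem_range.1 hj) y hy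
          rw [resid, sub_eq_zero] at h3
          simp only [cand, Nat.add_sub_cancel] at h3
          rw [← val_splice, h3, Finset.mul_sum]
          exact Finset.sum_congr rfl fun l _ => by ring
        rw [dualVal, basis, Finset.sum_congr rfl h2, Finset.sum_comm]
        exact Finset.sum_congr rfl fun l _ => by rw [trans, basis, Finset.mul_sum]
      simp only [h1, state, Finset.sum_mul, Finset.mul_sum]
      rw [Finset.sum_comm]
      exact Finset.sum_congr rfl fun l _ => Finset.sum_congr rfl fun m _ => by ring
  exact key t le_rfl

/-- The sum of the ranks of all levels. -/
def total (H : Hyp) (T : ℕ) : ℕ := ∑ i ∈ Finset.range T, H.r i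

lemma Inv.total_le (hH : H.Inv O d T) : H.total T ≤ T * d := by
  simpa [total] using Finset.sum_le_card_nsmul (Finset.range T) H.r d fun i _ => hH.r_le i

lemma total_pivot {i t y : ℕ} {x z : ℕ → ℕ} (hi : i < T) :
    (H.pivot O d i t x z y).total T = H.total T + 1 := by
  have := Finset.sum_update_of_mem (Finset.mem_range.2 hi) H.r (H.r i + 1)
  rw [total, Hyp.pivot, this, total, ← Finset.add_sum_erase _ H.r (Finset.mem_range.2 hi),
    Finset.sdiff_singleton_eq_erase]
  ring

lemma cand_lt (hH : H.Inv O d T) {z : ℕ → ℕ} (hz : ∀ c, z c < n) (i j c : ℕ) :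
    H.cand i j z c < n := splice_lt (hH.p_lt _ _) hz c

/-- A hypothesis that is not consistent can be refined. -/
lemma Inv.total_lt (hH : H.Inv O d T) {k : ℕ} (hO : IsLinear O k) (hk : k ≤ d) {z : ℕ → ℕ}
    (hz : ∀ c, z c < n) (h : ¬ H.Good O d T z) : H.total T < T * d := by
  simp only [Good, not_forall] at h
  obtain ⟨t, ht, i, hi, j, hj, y, hy, hs⟩ := h
  have h1 := (hH.pivot hO hk hi ht.le (cand_lt hH hz i j) hz hy hs).total_le
  rw [total_pivot (by omega)] at h1
  omega

/-- The hypothesis without prefixes and tests. -/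
def zero : Hyp := ⟨fun _ _ _ => 0, fun _ _ _ => 0, fun _ _ => 0, fun _ _ => 0, fun _ _ _ => 0,
  fun _ => 0⟩

lemma inv_zero (hn : 0 < n) : zero.Inv O d T := by
  constructor <;> simp [zero, hn]

end Hyp

/-! ## Distributions on sequences -/

/-- The expectation of `g` over the strings obtained from `b` by sampling the `j` tokens from the
position `c` on from the conditional distributions `κ`. -/
def expect (n : ℕ) (κ : ℕ → (ℕ → ℕ) → ℕ → ℝ) (g : (ℕ → ℕ) → ℝ) : ℕ → ℕ → (ℕ → ℕ) → ℝ
  | 0, _, b => g b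
  | j + 1, c, b =>
    ∑ y ∈ Finset.range n, κ c b y * expect n κ g j (c + 1) (Function.update b c y)

/-- The string `b` with the tokens from the position `c` on replaced by `z`. -/
def overwrite {n j : ℕ} (c : ℕ) (z : Fin j → Fin n) (b : ℕ → ℕ) : ℕ → ℕ := fun q =>
  if h : c ≤ q ∧ q - c < j then z ⟨q - c, h.2⟩ else b q

lemma overwrite_cons {n j c : ℕ} (y : Fin n) (z : Fin j → Fin n) (b : ℕ → ℕ) :
    overwrite c (Fin.cons y z : Fin (j + 1) → Fin n) b =
      overwrite (c + 1) z (Function.update b c y) := by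
  funext q
  unfold overwrite
  rcases lt_trichotomy q c with h | rfl | h
  · rw [dif_neg (by omega), dif_neg (by omega), Function.update_of_ne (by omega)]
  · rw [dif_pos (by omega), dif_neg (by omega), Function.update_self]
    simp
  · obtain ⟨q', rfl⟩ : ∃ q', q = c + 1 + q' := ⟨q - c - 1, by omega⟩
    by_cases h' : q' < j
    · rw [dif_pos (by omega), dif_pos (by omega)]
      have h1 : (⟨c + 1 + q' - c, by omega⟩ : Fin (j + 1)) = Fin.succ ⟨q', h'⟩ :=
        Fin.ext (by simp; omega)
      have h2 : (⟨c + 1 + q' - (c + 1), by omega⟩ : Fin j) = ⟨q', h'⟩ := Fin.ext (by simp)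
      rw [h1, h2, Fin.cons_succ]
    · rw [dif_neg (by omega), dif_neg (by omega), Function.update_of_ne (by omega)]

/-- Because `κ t` reads only the positions before `t`, the conditional probabilities met during
sampling can be read off the completed string, and the iterated sum becomes a sum of products. -/
lemma expect_eq_sum {n : ℕ} (κ : ℕ → (ℕ → ℕ) → ℕ → ℝ)
    (hκ : ∀ t b b' y, (∀ j < t, b j = b' j) → κ t b y = κ t b' y) (g : (ℕ → ℕ) → ℝ)
    (j c : ℕ) (b : ℕ → ℕ) :
    expect n κ g j c b = ∑ z : Fin j → Fin n,
      (∏ i : Fin j, κ (c + i) (overwrite c z b) (z i)) * g (overwrite c z b) := by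
  induction j generalizing c b with
  | zero =>
    have : ∀ z : Fin 0 → Fin n, overwrite c z b = b := by
      intro z; funext q; simp [overwrite]
    simp [expect, this]
  | succ j ih =>
    rw [expect, Finset.sum_range, ← (Fin.consEquiv fun _ => Fin n).sum_comp,
      Fintype.sum_prod_type]
    refine Finset.sum_congr rfl fun y _ => ?_
    rw [ih, Finset.mul_sum]
    refine Finset.sum_congr rfl fun z _ => ?_
    have hcons : (Fin.consEquiv fun _ => Fin n) (y, z) = (Fin.cons y z : Fin (j + 1) → Fin n) :=
      rfl
    rw [hcons, Fin.prod_univ_succ, overwrite_cons, Fin.cons_zero, mul_assoc]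
    congr 1
    · refine hκ _ _ _ _ fun q hq => ?_
      rw [overwrite, dif_neg (by omega), Function.update_of_ne (by omega)]
    · congr 1
      refine Finset.prod_congr rfl fun i _ => ?_
      rw [Fin.cons_succ, Fin.val_succ]
      congr 1
      omega

lemma softmax_add {n : ℕ} (v : Fin n → ℝ) (a : ℝ) : softmax (fun z => v z - a) = softmax v := by
  funext z
  simp only [softmax, Real.exp_sub, ← Finset.sum_div]
  field_simp

lemma softmax_pos {n : ℕ} (v : Fin n → ℝ) (z : Fin n) : 0 < softmax v z :=
  div_pos (Real.exp_pos _) (Finset.sum_pos (fun _ _ => Real.exp_pos _) ⟨z, Finset.mem_univ z⟩)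

lemma sum_softmax {n : ℕ} (hn : 0 < n) (v : Fin n → ℝ) : ∑ z, softmax v z = 1 := by
  simp only [softmax, ← Finset.sum_div]
  exact div_self (Finset.sum_pos (fun _ _ => Real.exp_pos _) ⟨⟨0, hn⟩, Finset.mem_univ _⟩).ne'

/-- Centering cancels the logarithm of the normalizing sum, the only nonlinear term; what remains is
linear in `v`, and hence in the hidden state. -/
lemma meanCenteredLogit_softmax {n : ℕ} (v : Fin n → ℝ) (z : Fin n) :
    meanCenteredLogit (softmax v) z = v z - (1 / (n : ℝ)) * ∑ z', v z' := by
  have hn : (n : ℝ) ≠ 0 := by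
    have := z.pos
    positivity
  have hpos : 0 < ∑ z', Real.exp (v z') :=
    Finset.sum_pos (fun _ _ => Real.exp_pos _) ⟨z, Finset.mem_univ z⟩
  have h : ∀ z, Real.log (softmax v z) = v z - Real.log (∑ z', Real.exp (v z')) := by
    intro z
    rw [softmax, Real.log_div (Real.exp_pos _).ne' hpos.ne', Real.log_exp]
  simp only [meanCenteredLogit, h, Finset.sum_sub_distrib, Finset.sum_const, Finset.card_univ,
    Fintype.card_fin, nsmul_eq_mul]
  field_simp
  ring

/-! ### Linearity of the logits in the hidden state, and sequence probabilities -/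

namespace ISAN

variable {n T k : ℕ} (M : ISAN n T k)

/-- The hidden state after the first `t` tokens of a string. -/
def hid (t : ℕ) (b : ℕ → ℕ) : Fin k → ℝ :=
  if h : t ≤ T ∧ ∀ j : Fin t, b j < n then M.hidden t h.1 fun j => ⟨b j, h.2 j⟩ else 0

/-- The conditional probability of `y` after the first `t` tokens of a string. -/
def nextP (t : ℕ) (b : ℕ → ℕ) (y : ℕ) : ℝ :=
  if h : t < T ∧ (∀ j : Fin t, b j < n) ∧ y < n then
    M.nextProb t h.1 (fun j => ⟨b j, h.2.1 j⟩) ⟨y, h.2.2⟩ else 0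

variable {M} {t : ℕ} {b : ℕ → ℕ}

lemma hid_zero : M.hid 0 b = M.x₀ := by
  rw [hid, dif_pos ⟨Nat.zero_le _, fun j => j.elim0⟩, hidden]

lemma hid_succ (ht : t < T) (hb : ∀ c, b c < n) :
    M.hid (t + 1) b = (M.A ⟨t, ht⟩ ⟨b t, hb t⟩).mulVec (M.hid t b) := by
  rw [hid, hid, dif_pos ⟨ht, fun _ => hb _⟩, dif_pos ⟨ht.le, fun _ => hb _⟩, hidden]
  rfl

lemma nextP_eq (ht : t < T) (hb : ∀ c, b c < n) (y : Fin n) :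
    M.nextP t b y = softmax ((M.B ⟨t, ht⟩).mulVec (M.hid t b)) y := by
  rw [nextP, dif_pos ⟨ht, fun _ => hb _, y.2⟩, nextProb, hid, dif_pos ⟨ht.le, fun _ => hb _⟩]

lemma nextP_congr {b' : ℕ → ℕ} (y : ℕ) (h : ∀ j < t, b j = b' j) :
    M.nextP t b y = M.nextP t b' y := by
  have h' : ∀ j : Fin t, b j = b' j := fun j => h j j.2
  simp only [nextP, h']

lemma ask_oracle (ht : t < T) (hb : ∀ c, b c < n) (y : Fin n) :
    ask M.oracle b t y = (M.B ⟨t, ht⟩).mulVec (M.hid t b) y -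
      (1 / (n : ℝ)) * ∑ y', (M.B ⟨t, ht⟩).mulVec (M.hid t b) y' := by
  rw [ask, dif_pos ⟨fun _ => hb _, y.2⟩, oracle, dif_pos ht, nextProb,
    meanCenteredLogit_softmax, hid, dif_pos ⟨ht.le, fun _ => hb _⟩]

lemma ask_oracle_of_le (ht : T ≤ t) (y : ℕ) : ask M.oracle b t y = 0 := by
  rw [ask]
  split_ifs with h
  · rw [oracle, dif_neg (by omega)]
  · rfl

/-- Logits determine the conditional probabilities. -/
lemma nextP_eq_softmax_ask (ht : t < T) (hb : ∀ c, b c < n) (y : Fin n) :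
    M.nextP t b y = softmax (fun y' : Fin n => ask M.oracle b t y') y := by
  rw [nextP_eq ht hb]
  simp only [ask_oracle ht hb]
  rw [softmax_add]

/-- The fixed continuation acts on the hidden state by a product of transition matrices, followed by
a centered row of the readout matrix. Each induction step moves one matrix of the continuation to
the functional. -/
lemma isLinear_oracle (M : ISAN n T k) : IsLinear M.oracle k := by
  refine ⟨M.hid, fun i e w y hie hw hy => ?_⟩
  by_cases he : e < T
  · obtain ⟨j, rfl⟩ := Nat.exists_eq_add_of_le hie
    induction j generalizing i with
    | zero =>
      refine ⟨fun a => M.B ⟨i, he⟩ ⟨y, hy⟩ a - (1 / (n : ℝ)) * ∑ y', M.B ⟨i, he⟩ y' a,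
        fun p hp => ?_⟩
      have h1 : val M.oracle i (i + 0) p w y = ask M.oracle p i y :=
        ask_congr _ _ fun c hc => by simp at hc; simp [splice, hc]
      refine h1.trans ((ask_oracle he hp ⟨y, hy⟩).trans ?_)
      simp only [Matrix.mulVec, dotProduct, sub_mul, Finset.sum_sub_distrib, Finset.mul_sum,
        Finset.sum_mul]
      rw [Finset.sum_comm]
      simp only [mul_assoc]
      rfl
    | succ j ih =>
      obtain ⟨α, hα⟩ := ih (i + 1) (by omega) (by omega)
      refine ⟨Matrix.vecMul α (M.A ⟨i, by omega⟩ ⟨w i, hw i⟩), fun p hp => ?_⟩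
      rw [← Matrix.dotProduct_mulVec, ← val_splice, ← add_assoc, add_right_comm]
      rw [hα _ (splice_lt hp hw), hid_succ (by omega) (splice_lt hp hw)]
      have h1 : splice i p w i = w i := by simp [splice]
      have h2 : M.hid i (splice i p w) = M.hid i p := by
        have : ∀ j : Fin i, splice i p w j = p j := fun j => by simp [splice]
        simp only [hid, this]
      simp only [h1, h2]
  -- Prefixes of length at least `T` are answered by zeros, which is the zero functional.
  · exact ⟨0, fun p _ => by rw [val, ask_oracle_of_le (by omega), zero_dotProduct]⟩

lemma prob_eq (z : Fin T → Fin n) (b : ℕ → ℕ) :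
    M.prob z = ∏ i : Fin T, M.nextP (0 + i) (overwrite 0 z b) (z i) := by
  refine Finset.prod_congr rfl fun t _ => ?_
  have h : ∀ j : ℕ, ∀ hj : j < T, overwrite 0 z b j = z ⟨j, hj⟩ := by
    intro j hj
    simp [overwrite, hj]
  rw [zero_add, nextP, dif_pos ⟨t.2, fun j => by rw [h j (by omega)]; exact Fin.is_lt _,
    Fin.is_lt _⟩]
  congr 1
  funext j
  exact Fin.ext (h j (by omega)).symm

lemma prob_pos (z : Fin T → Fin n) : 0 < M.prob z :=
  Finset.prod_pos fun _ _ => softmax_pos _ _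

lemma expect_nextP (g : (ℕ → ℕ) → ℝ) (b : ℕ → ℕ) :
    expect n M.nextP g T 0 b = ∑ z, M.prob z * g (overwrite 0 z b) := by
  rw [expect_eq_sum M.nextP fun t b b' y h => nextP_congr y h]
  exact Finset.sum_congr rfl fun z _ => by rw [← prob_eq]

lemma overwrite_lt {z : Fin T → Fin n} (hb : ∀ c, b c < n) (c : ℕ) : overwrite 0 z b c < n := by
  unfold overwrite
  split_ifs
  · exact Fin.is_lt _
  · exact hb c

lemma sum_prob (hn : 0 < n) : ∑ z, M.prob z = 1 := by
  have h : ∀ j c b, c + j = T → (∀ q, b q < n) → expect n M.nextP (fun _ => 1) j c b = 1 := by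
    intro j
    induction j with
    | zero => intro c b _ _; rfl
    | succ j ih =>
      intro c b hc hb
      rw [expect, Finset.sum_range]
      refine (Finset.sum_congr rfl fun y _ => ?_).trans
        (sum_softmax hn fun y' : Fin n => ask M.oracle b c y')
      rw [ih _ _ (by omega), mul_one, nextP_eq_softmax_ask (by omega) hb]
      intro q
      rw [Function.update_apply]
      split_ifs
      · exact y.2
      · exact hb q
  have h1 := h T 0 (fun _ => 0) (by omega) fun _ => hn
  rw [expect_nextP] at h1
  simpa using h1

open Classical in
/-- Two models that agree outside of the set `bad` have small distance. -/
lemma tvDist_le {k' : ℕ} {M' : ISAN n T k'} (hn : 0 < n) (bad : (Fin T → Fin n) → Prop)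
    (h : ∀ z, ¬ bad z → M'.prob z = M.prob z) :
    tvDist M.prob M'.prob ≤ ∑ z, M.prob z * if bad z then 1 else 0 := by
  -- On bad sequences this is `|p - q| ≤ p + q`; on the others both sides vanish. After summation `p
  -- - q` cancels because both masses are one, so the bound involves only the probability of `bad`
  -- under `M`.
  have h1 : ∀ z, |M.prob z - M'.prob z| ≤
      2 * (M.prob z * if bad z then 1 else 0) - (M.prob z - M'.prob z) := by
    intro z
    have := (M.prob_pos z).le
    have := (M'.prob_pos z).le
    split_ifs with hz
    · rw [abs_le]
      constructor <;> linarith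
    · rw [h z hz]; simp
  have h2 := Finset.sum_le_sum fun z (_ : z ∈ Finset.univ) => h1 z
  rw [Finset.sum_sub_distrib, Finset.sum_sub_distrib, sum_prob hn, sum_prob hn, sub_self,
    sub_zero, ← Finset.mul_sum] at h2
  rw [tvDist]
  linarith

end ISAN

/-! ### Models that realize a hypothesis -/

namespace Hyp

variable {n T k d : ℕ} {H : Hyp} {M : ISAN n T k} {M' : ISAN n T d}

/-- The model `M'` makes the predictions of the hypothesis `H`. -/
structure Realizes (O : LogitOracle n) (H : Hyp) (M' : ISAN n T d) : Prop where
  init : ∀ l z, M'.x₀ l = H.test O 0 z l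
  trans : ∀ t l m z (hz : ∀ c : ℕ, z c < n), M'.A t ⟨z t, hz t⟩ l m = H.trans O d t z l m
  read : ∀ (t : Fin T) y m z, M'.B t y m = H.dualVal O d t t z y m

/-- The hidden state of `M'` along `z` is the predicted state, its readout is the true centered
logit by `Good.predict`, and softmax does not see the centering. -/
lemma Realizes.prob_eq (hM : H.Realizes M.oracle M') (hk : k ≤ d) {z : Fin T → Fin n}
    {b : ℕ → ℕ} (hb : ∀ c, b c < n) (h : H.Good M.oracle d T (overwrite 0 z b)) :
    M'.prob z = M.prob z := by
  rw [M'.prob_eq z b, M.prob_eq z b]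
  set w := overwrite 0 z b
  have hw : ∀ c, w c < n := ISAN.overwrite_lt hb
  refine Finset.prod_congr rfl fun t _ => ?_
  rw [zero_add, ISAN.nextP_eq t.2 hw, ISAN.nextP_eq_softmax_ask t.2 hw]
  have hstate : ∀ t ≤ T, ∀ l : Fin d, M'.hid t w l = H.state M.oracle d w t l := by
    intro t
    induction t with
    | zero => intro _ l; rw [ISAN.hid_zero, state, hM.init l w]
    | succ t ih =>
      intro ht l
      rw [ISAN.hid_succ (by omega) hw, state, Finset.sum_range]
      simp only [Matrix.mulVec, dotProduct]
      refine Finset.sum_congr rfl fun m _ => ?_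
      rw [ih (by omega)]
      congr 1
      exact hM.trans ⟨t, by omega⟩ l m w hw
  congr 1
  funext y
  -- For `d = 0` the consistency check is vacuous, but then both models have dimension zero and all
  -- logits vanish.
  rcases Nat.eq_zero_or_pos d with rfl | hd
  · obtain rfl : k = 0 := by omega
    rw [ISAN.ask_oracle t.2 hw]
    simp [Matrix.mulVec, dotProduct]
  · rw [h.predict hd t.2 y.2, Finset.sum_range]
    simp only [Matrix.mulVec, dotProduct]
    refine Finset.sum_congr rfl fun m _ => ?_
    rw [hstate t t.2.le]
    congr 1
    exact hM.read t y m w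

end Hyp

/-! ## Building blocks of the program -/

section Blocks

variable {n W : ℕ} {O : LogitOracle n} {m : Mem} {c : Cmd}

/-- A loop that fills a segment of an array of real numbers. -/
lemma Det.map {x a off N : ℕ} {e : NExp} (ε : ℕ → ℝ) (hN : N ≤ W) (hx : x ∉ c.wn)
    (he : ∀ m', Frame (.forTo x e c) m m' → e.ev m' = N)
    (hc : ∀ l < N, ∀ m', Frame (.forTo x e c) m m' → m'.nat x 0 = l →
      Det O W c m' (fun m'' => m''.real a = Function.update (m'.real a) (off + l) (ε l))) :
    Det O W (.forTo x e c) m (fun m' => ∀ q,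
      m'.real a q = if off ≤ q ∧ q < off + N then ε (q - off) else m.real a q) := by
  refine Det.forTo (fun i m' => ∀ q,
    m'.real a q = if off ≤ q ∧ q < off + i then ε (q - off) else m.real a q) hN hx he
    (fun q => ?_) fun l hl m' hF hxl hI => ?_
  · rw [if_neg (by omega)]; rfl
  · refine (hc l hl m' hF hxl).mono fun m'' hm _ q => ?_
    rw [Mem.setN_real, hm, Function.update_apply, hI]
    by_cases h : q = off + l
    · rw [if_pos h, if_pos (by omega)]
      congr 1; omega
    · rw [if_neg h]
      by_cases h' : off ≤ q ∧ q < off + l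
      · rw [if_pos h', if_pos (by omega)]
      · rw [if_neg h', if_neg (by omega)]

/-- The loop that adds the values of `e` for all values of `x` to a cell of an array. -/
def Cmd.accum (x a : ℕ) (N i : NExp) (e : RExp) : Cmd :=
  .forTo x N (.setReal a i (.add (.read a i) e))

/-- The value of the summand is required in every memory of the frame, whatever the array `a` holds;
so partial sums cannot influence later terms. -/
lemma Det.accum {x a i₀ N₀ : ℕ} {N i : NExp} {e : RExp} (ε : ℕ → ℝ) (hN : N₀ ≤ W)
    (hn : ∀ m', Frame (.accum x a N i e) m m' → N.ev m' = N₀)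
    (hi : ∀ m', Frame (.accum x a N i e) m m' → i.ev m' = i₀)
    (he : ∀ l < N₀, ∀ m', Frame (.accum x a N i e) m m' → m'.nat x 0 = l → e.ev m' = ε l) :
    Det O W (.accum x a N i e) m (fun m' =>
      m'.real a = Function.update (m.real a) i₀ (m.real a i₀ + ∑ l ∈ Finset.range N₀, ε l)) := by
  refine Det.forTo (fun k m' => m'.real a =
    Function.update (m.real a) i₀ (m.real a i₀ + ∑ l ∈ Finset.range k, ε l)) hN
    (by simp [Cmd.wn]) hn (by simp) fun l hl m' hF hxl hI => ?_
  refine Det.setReal ?_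
  simp only [Mem.setN_real, Mem.setR_real_self, RExp.ev_add, RExp.ev_read, hi m' hF,
    he l hl m' hF hxl, hI, Function.update_self, Function.update_idem, Finset.sum_range_succ,
    add_assoc]

/-- Uniqueness of digits in base `d`: flattened multi-indices address distinct cells. -/
lemma flat_inj {d a a' j j' : ℕ} (hj : j < d) (hj' : j' < d) :
    a * d + j = a' * d + j' ↔ a = a' ∧ j = j' := by
  refine ⟨fun h => ?_, by rintro ⟨rfl, rfl⟩; rfl⟩
  have h1 : a = a' := by
    have := congrArg (· / d) h
    simpa [Nat.mul_comm _ d, Nat.mul_add_div (by omega : 0 < d), Nat.div_eq_of_lt hj,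
      Nat.div_eq_of_lt hj'] using this
  subst h1
  exact ⟨rfl, by omega⟩

/-- The loops that add the values of `e` to the block `q` of an array of square matrices. -/
def Cmd.addBlock (x x' a : ℕ) (D q : NExp) (e : RExp) : Cmd :=
  .forTo x D (.forTo x' D (.setReal a (.add (.mul (.add (.mul q D) (.var x)) D) (.var x'))
    (.add (.read a (.add (.mul (.add (.mul q D) (.var x)) D) (.var x'))) e)))

lemma Det.addBlock {x x' a d q₀ : ℕ} {D q : NExp} {e : RExp} (ε : ℕ → ℕ → ℝ) (hd : d ≤ W)
    (hxx' : x ≠ x')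
    (hD : ∀ m', Frame (.addBlock x x' a D q e) m m' → D.ev m' = d)
    (hq : ∀ m', Frame (.addBlock x x' a D q e) m m' → q.ev m' = q₀)
    (he : ∀ l < d, ∀ j < d, ∀ m', Frame (.addBlock x x' a D q e) m m' → m'.nat x 0 = l →
      m'.nat x' 0 = j → e.ev m' = ε l j) :
    Det O W (.addBlock x x' a D q e) m (fun m' => ∀ q, ∀ l < d, ∀ j < d,
      m'.real a ((q * d + l) * d + j) =
        m.real a ((q * d + l) * d + j) + if q = q₀ then ε l j else 0) := by
  refine (Det.forTo (fun i m' => ∀ q, ∀ l < d, ∀ j < d, m'.real a ((q * d + l) * d + j) =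
    m.real a ((q * d + l) * d + j) + if q = q₀ ∧ l < i then ε l j else 0) hd
    (by simp [Cmd.forTo, Cmd.wn, hxx']) hD (by simp) fun i hi m' hF hxi hI => ?_).mono
    fun m' h _ q l hl j hj => by rw [h q l hl j hj]; simp only [hl, and_true]
  have hsub : ∀ {m''}, Frame (.forTo x' D (.setReal a
      (.add (.mul (.add (.mul q D) (.var x)) D) (.var x'))
      (.add (.read a (.add (.mul (.add (.mul q D) (.var x)) D) (.var x'))) e))) m' m'' →
      Frame (.addBlock x x' a D q e) m m'' := by
    intro m'' h
    refine hF.trans h ?_ ?_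
    · simp [Cmd.forTo, Cmd.wn]
    · simp [Cmd.forTo, Cmd.wr]
  -- The entries already updated are those whose index pair lexicographically precedes `(i, i')`.
  refine (Det.forTo (fun i' m'' => ∀ q, ∀ l < d, ∀ j < d, m''.real a ((q * d + l) * d + j) =
    m.real a ((q * d + l) * d + j) +
      if q = q₀ ∧ (l < i ∨ l = i ∧ j < i') then ε l j else 0) hd
    (by simp [Cmd.wn]) (fun m'' h => hD m'' (hsub h)) ?_ fun i' hi' m'' hF' hxi' hI' => ?_).mono
    fun m'' h _ q l hl j hj => ?_
  · intro q l hl j hj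
    simp only [Mem.setN_real, hI q l hl j hj, Nat.not_lt_zero, and_false, or_false]
  · refine Det.setReal ?_
    intro q' l hl j hj
    have hx : m''.nat x 0 = i := by
      rw [hF'.nat x (by simp [Cmd.forTo, Cmd.wn, hxx']), hxi]
    simp only [Mem.setN_real, Mem.setR_real_self, RExp.ev_add, RExp.ev_read, NExp.ev_add,
      NExp.ev_mul, NExp.ev_read, NExp.ev_const, hx, hxi', hD m'' (hsub hF'), hq m'' (hsub hF'),
      he i hi i' hi' m'' (hsub hF') hx hxi', Function.update_apply, flat_inj hj hi',
      flat_inj hl hi, hI' q₀ i hi i' hi', hI' q' l hl j hj]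
    by_cases h : (q' = q₀ ∧ l = i) ∧ j = i'
    · obtain ⟨⟨rfl, rfl⟩, rfl⟩ := h
      simp
    · rw [if_neg h]
      by_cases h' : q' = q₀ ∧ (l < i ∨ l = i ∧ j < i')
      · rw [if_pos h', if_pos (by omega)]
      · rw [if_neg h', if_neg (by omega)]
  · rw [Mem.setN_real, h q l hl j hj]
    congr 2
    apply propext
    omega

/-- The sequence length. -/
abbrev NExp.seqLen : NExp := .read 0 (.const 2)
/-- The number of tokens. -/
abbrev NExp.tokens : NExp := .read 0 (.const 1)
/-- The dimension. -/
abbrev NExp.dim : NExp := .read 0 (.const 0)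

/-- Splice two strings. -/
def Cmd.copy (dst a₁ : ℕ) (o₁ : NExp) (a₂ : ℕ) (o₂ cut : NExp) : Cmd :=
  .forTo 16 .seqLen (.branch (.natLt (.var 16) cut)
    (.setNat dst (.var 16) (.read a₁ (.add o₁ (.var 16))))
    (.setNat dst (.var 16) (.read a₂ (.add o₂ (.var 16)))))

lemma Det.copy {dst a₁ a₂ T k₁ k₂ i : ℕ} {o₁ o₂ cut : NExp} {p w : ℕ → ℕ}
    (hT : m.nat 0 2 = T) (hTW : T ≤ W) (hnW : n ≤ W) (hdst : dst ∉ [0, 16, a₁, a₂])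
    (h16 : 16 ∉ [a₁, a₂])
    (ho₁ : ∀ m', Frame (.copy dst a₁ o₁ a₂ o₂ cut) m m' → o₁.ev m' = k₁)
    (ho₂ : ∀ m', Frame (.copy dst a₁ o₁ a₂ o₂ cut) m m' → o₂.ev m' = k₂)
    (hcut : ∀ m', Frame (.copy dst a₁ o₁ a₂ o₂ cut) m m' → cut.ev m' = i)
    (hp : ∀ c < T, c < i → m.nat a₁ (k₁ + c) = p c) (hw : ∀ c < T, m.nat a₂ (k₂ + c) = w c)
    (hpn : ∀ c, p c < n) (hwn : ∀ c, w c < n) :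
    Det O W (.copy dst a₁ o₁ a₂ o₂ cut) m (fun m' => ∀ c < T, m'.nat dst c = splice i p w c) := by
  simp only [List.mem_cons, List.not_mem_nil, or_false, not_or] at hdst h16
  obtain ⟨h0, hd16, hd1, hd2⟩ := hdst
  refine Det.forTo (fun k m' => ∀ c < k, m'.nat dst c = splice i p w c) hTW
    (by simp [Cmd.wn, Ne.symm hd16]) (fun m' hF => ?_) (by simp) fun k hk m' hF hxk hI => ?_
  · have : m'.nat 0 = m.nat 0 := hF.nat 0 (by simp [Cmd.forTo, Cmd.wn, Ne.symm h0])
    simp [this, hT]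
  have e1 : m'.nat a₁ = m.nat a₁ :=
    hF.nat _ (by simp [Cmd.forTo, Cmd.wn, Ne.symm hd1, Ne.symm h16.1])
  have e2 : m'.nat a₂ = m.nat a₂ :=
    hF.nat _ (by simp [Cmd.forTo, Cmd.wn, Ne.symm hd2, Ne.symm h16.2])
  have key : ∀ v, v = splice i p w k → ∀ c < k + 1,
      ((m'.setN dst k v).setN 16 0 (k + 1)).nat dst c = splice i p w c := by
    intro v hv c hc
    rw [Mem.setN_nat_of_ne _ _ _ hd16, Mem.setN_nat_self, Function.update_apply]
    split_ifs with h
    · rw [hv, h]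
    · exact hI c (by omega)
  refine Det.branch (fun hb => ?_) fun hb => ?_
  · simp only [BExp.ev_natLt, NExp.ev_read, NExp.ev_const, hxk, hcut m' hF] at hb
    have hv : (NExp.read a₁ (.add o₁ (.var 16))).ev m' = splice i p w k := by
      simp [hxk, ho₁ m' hF, e1, hp k hk hb, splice, hb]
    refine Det.setNat ?_ ?_
    · rw [hv]; exact (splice_lt hpn hwn k).le.trans hnW
    · simpa only [NExp.ev_read, NExp.ev_const, hxk] using key _ hv
  · simp only [BExp.ev_natLt, NExp.ev_read, NExp.ev_const, hxk, hcut m' hF] at hb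
    have hv : (NExp.read a₂ (.add o₂ (.var 16))).ev m' = splice i p w k := by
      simp [hxk, ho₂ m' hF, e2, hw k hk, splice, hb]
    refine Det.setNat ?_ ?_
    · rw [hv]; exact (splice_lt hpn hwn k).le.trans hnW
    · simpa only [NExp.ev_read, NExp.ev_const, hxk] using key _ hv

/-- Store a logit after a prefix of a splice of two strings. -/
def Cmd.logit (dst : ℕ) (j : NExp) (a₁ : ℕ) (o₁ : NExp) (a₂ : ℕ) (o₂ cut len y : NExp) : Cmd :=
  .seq (.copy 4 a₁ o₁ a₂ o₂ cut)
    (.seq (.query 4 (.const 0) len 4 (.const 0)) (.setReal dst j (.read 4 y)))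

lemma Det.logit {dst a₁ a₂ T k₁ k₂ i e y₀ j₀ : ℕ} {j o₁ o₂ cut len y : NExp} {p w : ℕ → ℕ}
    (hT : m.nat 0 2 = T) (hTW : T ≤ W) (hnW : n ≤ W) (hdst : dst ≠ 4)
    (h4 : 4 ∉ [a₁, a₂]) (h16 : 16 ∉ [a₁, a₂])
    (ho₁ : ∀ m', Frame (.logit dst j a₁ o₁ a₂ o₂ cut len y) m m' → o₁.ev m' = k₁)
    (ho₂ : ∀ m', Frame (.logit dst j a₁ o₁ a₂ o₂ cut len y) m m' → o₂.ev m' = k₂)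
    (hcut : ∀ m', Frame (.logit dst j a₁ o₁ a₂ o₂ cut len y) m m' → cut.ev m' = i)
    (hlen : ∀ m', Frame (.logit dst j a₁ o₁ a₂ o₂ cut len y) m m' → len.ev m' = e)
    (hy : ∀ m', Frame (.logit dst j a₁ o₁ a₂ o₂ cut len y) m m' → y.ev m' = y₀)
    (hj : ∀ m', Frame (.logit dst j a₁ o₁ a₂ o₂ cut len y) m m' → j.ev m' = j₀)
    (hp : ∀ c < T, c < i → m.nat a₁ (k₁ + c) = p c) (hw : ∀ c < T, m.nat a₂ (k₂ + c) = w c)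
    (hpn : ∀ c, p c < n) (hwn : ∀ c, w c < n) (heT : e ≤ T) (hyn : y₀ < n) :
    Det O W (.logit dst j a₁ o₁ a₂ o₂ cut len y) m
      (fun m' => m'.real dst = Function.update (m.real dst) j₀ (val O i e p w y₀)) := by
  set L : Cmd := .logit dst j a₁ o₁ a₂ o₂ cut len y with hL
  have hsub : ∀ {m'}, Frame (.copy 4 a₁ o₁ a₂ o₂ cut) m m' → Frame L m m' := fun h =>
    h.mono (by simp [hL, Cmd.logit, Cmd.wn]) (by simp [Cmd.copy, Cmd.forTo, Cmd.wr])
  refine Det.seq ((Det.copy (k₁ := k₁) (k₂ := k₂) (i := i) (p := p) (w := w) hT hTW hnW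
    (by simpa using h4) h16 (fun m' h => ho₁ m' (hsub h)) (fun m' h => ho₂ m' (hsub h))
    (fun m' h => hcut m' (hsub h)) hp hw hpn hwn).mono
    (Q' := fun m' => (∀ c < T, m'.nat 4 c = splice i p w c) ∧ Frame L m m' ∧
      m'.real = m.real) fun m' h hF => ⟨h, hsub hF, ?_⟩) ?_
  · funext a
    exact hF.real a (by simp [Cmd.copy, Cmd.forTo, Cmd.wr])
  rintro m₁ ⟨h1, hF1, hr1⟩
  refine Det.seq (Q := fun m₂ => m₂.real 4 y₀ = val O i e p w y₀ ∧ Frame L m m₂ ∧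
      m₂.real dst = m.real dst) ?_ ?_
  · have hlen1 := hlen m₁ hF1
    refine Det.query (by omega) hnW ?_
    refine ⟨?_, ⟨fun a ha => hF1.nat a ha, fun a ha => ?_⟩, ?_⟩
    · have h2 : val O i e p w y₀ = ask O (fun l => m₁.nat 4 l) e y₀ :=
        ask_congr O y₀ fun c hc => (h1 c (by omega)).symm
      simp [Mem.ask, hlen1, h2, hyn]
    · have : a ≠ 4 := by
        rintro rfl
        exact ha (by simp [hL, Cmd.logit, Cmd.wr])
      simpa [Mem.ask, this] using hF1.real a ha
    · simp [Mem.ask, hdst, hr1]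
  · rintro m₂ ⟨h2, hF2, hr2⟩
    refine Det.setReal ?_
    simp [hj m₂ hF2, hy m₂ hF2, h2, hr2]

end Blocks

/-! ## The representation of hypotheses in memory

The strings `p` and `w` are in the arrays `1` and `2` of naturals, `e`, `y` and `r` in the arrays
`6`, `7` and `8`, and the coefficients in the array `5` of reals. The current sequence is in the
array `3` of naturals, and the current prefix in the array `5`. -/

/-- The memory holds the inputs and the hypothesis `H`. -/
structure Rep (d n T : ℕ) (H : Hyp) (m : Mem) : Prop where
  dim : m.nat 0 0 = d
  tokens : m.nat 0 1 = n
  len : m.nat 0 2 = T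
  p : ∀ i, ∀ j < d, ∀ c < T, m.nat 1 ((i * d + j) * T + c) = H.p i j c
  w : ∀ i, ∀ j < d, ∀ c < T, m.nat 2 ((i * d + j) * T + c) = H.w i j c
  e : ∀ i, ∀ l < d, m.nat 6 (i * d + l) = H.e i l
  y : ∀ i, ∀ l < d, m.nat 7 (i * d + l) = H.y i l
  r : ∀ i, m.nat 8 i = H.r i
  K : ∀ i, ∀ l < d, ∀ j < d, m.real 5 ((i * d + l) * d + j) = H.K i l j

/-- The program does not change the representation of a hypothesis. -/
def Cmd.Preserves (c : Cmd) : Prop := (∀ a ∈ [0, 1, 2, 6, 7, 8], a ∉ c.wn) ∧ 5 ∉ c.wr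

instance (c : Cmd) : Decidable c.Preserves := by unfold Cmd.Preserves; infer_instance

lemma Rep.frame {d n T : ℕ} {H : Hyp} {m m' : Mem} {c : Cmd} (h : Rep d n T H m)
    (hF : Frame c m m') (hc : c.Preserves) : Rep d n T H m' := by
  have h0 := hF.nat 0 (hc.1 0 (by simp))
  have h1 := hF.nat 1 (hc.1 1 (by simp))
  have h2 := hF.nat 2 (hc.1 2 (by simp))
  have h6 := hF.nat 6 (hc.1 6 (by simp))
  have h7 := hF.nat 7 (hc.1 7 (by simp))
  have h8 := hF.nat 8 (hc.1 8 (by simp))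
  have h5 := hF.real 5 hc.2
  constructor
  · rw [h0]; exact h.dim
  · rw [h0]; exact h.tokens
  · rw [h0]; exact h.len
  · rw [h1]; exact h.p
  · rw [h2]; exact h.w
  · rw [h6]; exact h.e
  · rw [h7]; exact h.y
  · rw [h8]; exact h.r
  · rw [h5]; exact h.K

/-- The number of the pair of the level `i` and the index `j`. -/
abbrev NExp.pair (i j : NExp) : NExp := .add (.mul i .dim) j

/-- The coefficient `K i l j`. -/
abbrev RExp.kernel (i l j : NExp) : RExp := .read 5 (.add (.mul (.pair i l) .dim) j)

/-- Compute the extension of the prefix `12` of the previous level by the current sequence. -/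
def Cmd.candidate : Cmd :=
  .copy 5 1 (.mul (.pair (.sub (.var 11) (.const 1)) (.var 12)) .seqLen) 3 (.const 0)
    (.sub (.var 11) (.const 1))

/-- Compute the values of all tests on the current prefix. -/
def Cmd.tests : Cmd :=
  .forTo 14 .dim (.logit 8 (.var 14) 5 (.const 0) 2 (.mul (.pair (.var 11) (.var 14)) .seqLen)
    (.var 11) (.read 6 (.pair (.var 11) (.var 14))) (.read 7 (.pair (.var 11) (.var 14))))

/-- Compute the values of all prefixes at the current test. -/
def Cmd.prefixes : Cmd :=
  .forTo 14 .dim (.logit 6 (.var 14) 1 (.mul (.pair (.var 11) (.var 14)) .seqLen) 3 (.const 0)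
    (.var 11) (.var 10) (.var 13))

/-- Compute the values of the dual combinations of the prefixes at the current test. -/
def Cmd.duals : Cmd :=
  .forTo 14 .dim (.seq (.setReal 7 (.var 14) (.cast (.const 0)))
    (.accum 15 7 .dim (.var 14)
      (.mul (.kernel (.var 11) (.var 14) (.var 15)) (.read 6 (.var 15)))))

/-- Compute the error of interpolation. -/
def Cmd.residual : Cmd :=
  .seq (.logit 9 (.const 0) 5 (.const 0) 3 (.const 0) (.var 11) (.var 10) (.var 13))
    (.accum 14 9 .dim (.const 0)
      (.sub (.cast (.const 0)) (.mul (.read 8 (.var 14)) (.read 7 (.var 14)))))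

/-- Compute the coefficients of the normalized error of interpolation. -/
def Cmd.coefs : Cmd :=
  .forTo 15 .dim (.seq
    (.branch (.natEq (.var 15) (.read 8 (.var 11)))
      (.setReal 10 (.var 15) (.cast (.const 1))) (.setReal 10 (.var 15) (.cast (.const 0))))
    (.seq
      (.accum 14 10 .dim (.var 15) (.sub (.cast (.const 0))
        (.mul (.read 8 (.var 14)) (.kernel (.var 11) (.var 14) (.var 15)))))
      (.setReal 10 (.var 15) (.div (.read 10 (.var 15)) (.read 9 (.const 0))))))

/-- Update the coefficients of the hypothesis. -/
def Cmd.updateKernel : Cmd :=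
  .seq (.setReal 7 (.read 8 (.var 11)) (.sub (.cast (.const 0)) (.cast (.const 1))))
    (.addBlock 14 15 5 .dim (.var 11)
      (.sub (.cast (.const 0)) (.mul (.read 7 (.var 14)) (.read 10 (.var 15)))))

/-- Add the current prefix and the current test to the hypothesis. -/
def Cmd.store : Cmd :=
  .seq (.forTo 16 .seqLen
    (.seq (.setNat 1 (.add (.mul (.pair (.var 11) (.read 8 (.var 11))) .seqLen) (.var 16))
        (.read 5 (.var 16)))
      (.setNat 2 (.add (.mul (.pair (.var 11) (.read 8 (.var 11))) .seqLen) (.var 16))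
        (.read 3 (.var 16)))))
    (.seq (.setNat 6 (.pair (.var 11) (.read 8 (.var 11))) (.var 10))
      (.seq (.setNat 7 (.pair (.var 11) (.read 8 (.var 11))) (.var 13))
        (.setNat 8 (.var 11) (.add (.read 8 (.var 11)) (.const 1)))))

/-- Check the consistency of the hypothesis with the current sequence at one place, and refine it
if it is not consistent. -/
def Cmd.check : Cmd :=
  .seq .candidate (.seq .tests (.seq .prefixes (.seq .duals (.seq .residual
    (.branch (.realEq (.read 9 (.const 0)) (.cast (.const 0))) .skip
      (.seq .coefs (.seq .updateKernel .store)))))))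

/-- Check the consistency of the hypothesis with the current sequence, and refine it. -/
def Cmd.sweep : Cmd :=
  .forTo 10 .seqLen (.forTo 11 (.add (.var 10) (.const 1))
    (.forTo 12 .dim (.forTo 13 .tokens .check)))

/-- Sample a sequence. -/
def Cmd.sample : Cmd :=
  .forTo 10 .seqLen (.seq (.query 3 (.const 0) (.var 10) 4 (.const 0))
    (.seq (.setReal 9 (.const 0) (.cast (.const 0)))
      (.forTo 13 .tokens (.seq
        (.setReal 9 (.const 0) (.add (.read 9 (.const 0)) (.exp (.read 4 (.var 13)))))
        (.seq (.flip 18 (.const 0) (.div (.exp (.read 4 (.var 13))) (.read 9 (.const 0))))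
          (.branch (.natEq (.var 18) (.const 1)) (.setNat 3 (.var 10) (.var 13)) .skip))))))

/-- Write the initial state of the predicted model. -/
def Cmd.outputInit : Cmd :=
  .seq (.setNat 11 (.const 0) (.const 0)) (.seq .candidate (.seq .tests
    (.forTo 14 .dim (.setReal 1 (.var 14) (.read 8 (.var 14))))))

/-- Write the readout matrices of the predicted model. -/
def Cmd.outputRead : Cmd :=
  .forTo 10 .seqLen (.seq (.setNat 11 (.const 0) (.var 10)) (.forTo 13 .tokens
    (.seq .prefixes (.seq .duals (.forTo 14 .dim
      (.setReal 3 (.add (.mul (.add (.mul (.var 10) .tokens) (.var 13)) .dim) (.var 14))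
        (.read 7 (.var 14))))))))

/-- Write the transition matrices of the predicted model. -/
def Cmd.outputTrans : Cmd :=
  .forTo 10 .seqLen (.seq (.setNat 11 (.const 0) (.add (.var 10) (.const 1)))
    (.forTo 13 .tokens (.seq (.setNat 3 (.var 10) (.var 13)) (.forTo 12 .dim
      (.seq .candidate (.seq .tests (.addBlock 14 15 2 .dim (.add (.mul (.var 10) .tokens) (.var 13))
        (.mul (.kernel (.var 10) (.var 15) (.var 12)) (.read 8 (.var 14))))))))))

/-- Write the parameters of the predicted model. -/
def Cmd.output : Cmd := .seq .outputInit (.seq .outputRead .outputTrans)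

/-- The loop that computes the number of rounds. -/
def Cmd.search : Cmd :=
  .loop (.realLt (.mul (.cast (.var 17)) (.read 0 (.const 0)))
    (.cast (.mul .dim .seqLen))) (.setNat 17 (.const 0) (.add (.var 17) (.const 1)))

/-- One round: stop at a random time and write the predicted model, or refine the hypothesis by a
sampled sequence. -/
def Cmd.round : Cmd :=
  .seq (.flip 18 (.const 0) (.div (.cast (.const 1)) (.cast (.var 17))))
    (.branch (.natEq (.var 18) (.const 1)) (.seq .output (.setNat 17 (.const 0) (.const 0)))
      (.seq .sample (.seq .sweep
        (.setNat 17 (.const 0) (.sub (.var 17) (.const 1))))))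

/-- The learning algorithm. -/
def Cmd.learn : Cmd :=
  .seq (.setNat 17 (.const 0) (.const 1))
    (.seq .search (.loop (.natLt (.const 0) (.var 17)) .round))

/-! ### Correctness of the interpolation subroutines -/

section Specs

variable {n d T W : ℕ} {O : LogitOracle n} {m : Mem} {H : Hyp} {i t y j : ℕ} {x z : ℕ → ℕ}

/-- The bound `W` is larger than all numbers that occur. -/
structure Large (d n T W : ℕ) : Prop where
  dim : d ≤ W
  tokens : n ≤ W
  len : T + 1 ≤ W

/-- At level `0` the truncated subtraction gives the cut `0`: no stored prefix is read, and `j` may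
be out of range. -/
lemma Rep.det_candidate (hR : Rep d n T H m) (hW : Large d n T W) (hH : H.Inv O d T)
    (hi : m.nat 11 0 = i) (hj : m.nat 12 0 = j) (hjd : i = 0 ∨ j < d)
    (hz : ∀ c < T, m.nat 3 c = z c) (hzn : ∀ c, z c < n) :
    Det O W .candidate m (fun m' => ∀ c < T, m'.nat 5 c = H.cand i j z c) := by
  have h0 : ∀ m', Frame .candidate m m' → m'.nat 0 = m.nat 0 := fun m' h => h.nat 0 (by decide)
  have h11 : ∀ m', Frame .candidate m m' → m'.nat 11 = m.nat 11 := fun m' h => h.nat 11 (by decide)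
  have h12 : ∀ m', Frame .candidate m m' → m'.nat 12 = m.nat 12 := fun m' h => h.nat 12 (by decide)
  refine Det.copy (k₁ := ((i - 1) * d + j) * T) (k₂ := 0) (i := i - 1) hR.len
    (by have := hW.len; omega) hW.tokens (by simp) (by simp) (fun m' h => ?_) (fun m' h => rfl)
    (fun m' h => ?_) (fun c hc hci => hR.p _ j (by omega) c hc) (by simpa using hz)
    (hH.p_lt _ _) hzn
  · simp [h0 m' h, h11 m' h, h12 m' h, hi, hj, hR.dim, hR.len]
  · simp [h11 m' h, hi]

lemma Rep.det_tests (hR : Rep d n T H m) (hW : Large d n T W) (hH : H.Inv O d T)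
    (hi : m.nat 11 0 = i) (hx : ∀ c < T, m.nat 5 c = x c) (hxn : ∀ c, x c < n) :
    Det O W .tests m (fun m' => ∀ l < d, m'.real 8 l = H.test O i x l) := by
  refine (Det.map (a := 8) (off := 0) (N := d) (fun l => H.test O i x l) hW.dim (by decide)
    (fun m' hF => ?_) fun l hl m' hF hl14 => ?_).mono fun m' h _ l hl => ?_
  · simp [hF.nat 0 (by decide), hR.dim]
  · have hR' : Rep d n T H m' := hR.frame hF (by decide)
    have h5 := hF.nat 5 (by decide)
    have h11 := hF.nat 11 (by decide)
    rw [zero_add]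
    refine Det.logit (k₁ := 0) (k₂ := (i * d + l) * T) (i := i) (e := H.e i l) (y₀ := H.y i l)
      (p := x) (w := H.w i l) hR'.len (by have := hW.len; omega) hW.tokens (by simp) (by simp)
      (by simp)
      (fun m'' h => rfl) (fun m'' h => ?_) (fun m'' h => ?_) (fun m'' h => ?_) (fun m'' h => ?_)
      (fun m'' h => ?_) (fun c hc _ => ?_) (fun c hc => ?_) hxn (hH.w_lt i l) (hH.e_le i l)
      (hH.y_lt i l)
    · simp [h.nat 0 (by decide), h.nat 11 (by decide), h.nat 14 (by decide), h11, hi, hl14,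
        hR'.dim, hR'.len]
    · simp [h.nat 11 (by decide), h11, hi]
    · simp [h.nat 0 (by decide), h.nat 11 (by decide), h.nat 14 (by decide),
        h.nat 6 (by decide), h11, hi, hl14, hR'.dim, hR'.e i l hl]
    · simp [h.nat 0 (by decide), h.nat 11 (by decide), h.nat 14 (by decide),
        h.nat 7 (by decide), h11, hi, hl14, hR'.dim, hR'.y i l hl]
    · simp [h.nat 14 (by decide), hl14]
    · rw [zero_add, h5, hx c hc]
    · exact hR'.w i l hl c hc
  · rw [h, if_pos (by omega), Nat.sub_zero]

lemma Rep.det_prefixes (hR : Rep d n T H m) (hW : Large d n T W) (hH : H.Inv O d T)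
    (ht : m.nat 10 0 = t) (hi : m.nat 11 0 = i) (hy : m.nat 13 0 = y) (htT : t ≤ T) (hyn : y < n)
    (hz : ∀ c < T, m.nat 3 c = z c) (hzn : ∀ c, z c < n) :
    Det O W .prefixes m (fun m' => ∀ j < d, m'.real 6 j = val O i t (H.p i j) z y) := by
  refine (Det.map (a := 6) (off := 0) (N := d) (fun j => val O i t (H.p i j) z y) hW.dim
    (by decide) (fun m' hF => ?_) fun l hl m' hF hl14 => ?_).mono fun m' h _ l hl => ?_
  · simp [hF.nat 0 (by decide), hR.dim]
  · have hR' : Rep d n T H m' := hR.frame hF (by decide)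
    have h3 := hF.nat 3 (by decide)
    have h10 := hF.nat 10 (by decide)
    have h11 := hF.nat 11 (by decide)
    have h13 := hF.nat 13 (by decide)
    rw [zero_add]
    refine Det.logit (k₁ := (i * d + l) * T) (k₂ := 0) (i := i) (e := t) (y₀ := y)
      (p := H.p i l) (w := z) hR'.len (by have := hW.len; omega) hW.tokens (by simp) (by simp)
      (by simp)
      (fun m'' h => ?_) (fun m'' h => rfl) (fun m'' h => ?_) (fun m'' h => ?_) (fun m'' h => ?_)
      (fun m'' h => ?_) (fun c hc _ => ?_) (fun c hc => ?_) (hH.p_lt i l) hzn htT hyn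
    · simp [h.nat 0 (by decide), h.nat 11 (by decide), h.nat 14 (by decide), h11, hi, hl14,
        hR'.dim, hR'.len]
    · simp [h.nat 11 (by decide), h11, hi]
    · simp [h.nat 10 (by decide), h10, ht]
    · simp [h.nat 13 (by decide), h13, hy]
    · simp [h.nat 14 (by decide), hl14]
    · exact hR'.p i l hl c hc
    · rw [zero_add, h3, hz c hc]
  · rw [h, if_pos (by omega), Nat.sub_zero]

lemma Rep.det_duals (hR : Rep d n T H m) (hW : Large d n T W) (hi : m.nat 11 0 = i)
    {φ : (ℕ → ℕ) → ℝ} (hφ : ∀ j < d, m.real 6 j = φ (H.p i j)) :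
    Det O W .duals m (fun m' => ∀ l < d, m'.real 7 l = H.basis d i l φ) := by
  refine (Det.map (a := 7) (off := 0) (N := d) (fun l => H.basis d i l φ) hW.dim (by decide)
    (fun m' hF => ?_) fun l hl m' hF hl14 => ?_).mono fun m' h _ l hl => ?_
  · simp [hF.nat 0 (by decide), hR.dim]
  · rw [zero_add]
    have h11 := hF.nat 11 (by decide)
    have h6 := hF.real 6 (by decide)
    have hR' : Rep d n T H m' := hR.frame hF (by decide)
    refine Det.seq (Q := fun m'' => m'' = m'.setR 7 l 0) (Det.setReal (by simp [hl14])) ?_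
    rintro _ rfl
    have hR'' : Rep d n T H (m'.setR 7 l 0) := by
      obtain ⟨a1, a2, a3, a4, a5, a6, a7, a8, a9⟩ := hR'
      exact ⟨a1, a2, a3, a4, a5, a6, a7, a8, by simpa using a9⟩
    refine (Det.accum (i₀ := l) (N₀ := d) (fun j => H.K i l j * φ (H.p i j)) hW.dim
      (fun m'' h => ?_) (fun m'' h => ?_) fun j hj m'' h hj15 => ?_).mono fun m'' h hF'' => ?_
    · simp [h.nat 0 (by decide), hR'.dim]
    · simp [h.nat 14 (by decide), hl14]
    · have hR3 : Rep d n T H m'' := hR''.frame h (by decide)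
      have e14 : m''.nat 14 0 = l := by rw [h.nat 14 (by decide)]; exact hl14
      have e11 : m''.nat 11 0 = i := by rw [h.nat 11 (by decide)]; simp [h11, hi]
      have e6 : m''.real 6 j = φ (H.p i j) := by
        rw [h.real 6 (by decide)]; simp [h6, hφ j hj]
      simp [e14, e11, e6, hj15, hR3.dim, hR3.K i l hl j hj]
    · rw [h]
      simp [Hyp.basis]
  · rw [h, if_pos (by omega), Nat.sub_zero]

lemma Rep.det_residual (hR : Rep d n T H m) (hW : Large d n T W)
    (ht : m.nat 10 0 = t) (hi : m.nat 11 0 = i) (hy : m.nat 13 0 = y) (htT : t ≤ T) (hyn : y < n)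
    (hz : ∀ c < T, m.nat 3 c = z c) (hzn : ∀ c, z c < n)
    (hx : ∀ c < T, m.nat 5 c = x c) (hxn : ∀ c, x c < n)
    (hu : ∀ l < d, m.real 8 l = H.test O i x l)
    (hg : ∀ l < d, m.real 7 l = H.dualVal O d i t z y l) :
    Det O W .residual m (fun m' => m'.real 9 0 = H.resid O d i t x z y) := by
  refine Det.seq ((Det.logit (k₁ := 0) (k₂ := 0) (i := i) (e := t) (y₀ := y) (j₀ := 0)
      (p := x) (w := z) hR.len (by have := hW.len; omega) hW.tokens (by simp) (by simp)
      (by simp)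
      (fun m'' h => rfl) (fun m'' h => rfl) (fun m'' h => ?_) (fun m'' h => ?_) (fun m'' h => ?_)
      (fun m'' h => rfl) (fun c hc _ => ?_) (fun c hc => ?_) hxn hzn htT hyn).mono
      (Q' := fun m' => m'.real 9 0 = val O i t x z y ∧ m'.nat 0 0 = d ∧ m'.real 8 = m.real 8 ∧
        m'.real 7 = m.real 7)
      fun m' h hF => ⟨?_, ?_, hF.real 8 (by decide), hF.real 7 (by decide)⟩) ?_
  · simp [h.nat 11 (by decide), hi]
  · simp [h.nat 10 (by decide), ht]
  · simp [h.nat 13 (by decide), hy]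
  · rw [zero_add, hx c hc]
  · rw [zero_add, hz c hc]
  · simp [h]
  · rw [hF.nat 0 (by decide), hR.dim]
  · rintro m' ⟨h9, hd, h8, h7⟩
    refine (Det.accum (i₀ := 0) (N₀ := d)
      -- The machine has no negation; the program adds `0 - e`.
      (fun l => -(H.test O i x l * H.dualVal O d i t z y l)) hW.dim
      (fun m'' h => ?_) (fun m'' h => rfl) fun l hl m'' h hl14 => ?_).mono fun m'' h hF'' => ?_
    · simp [h.nat 0 (by decide), hd]
    · simp [h.real 8 (by decide), h.real 7 (by decide), h8, h7, hl14, hu l hl, hg l hl]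
    · rw [h]
      simp [h9, Hyp.resid, sub_eq_add_neg]

lemma Rep.det_coefs (hR : Rep d n T H m) (hW : Large d n T W) (hi : m.nat 11 0 = i)
    (hu : ∀ l < d, m.real 8 l = H.test O i x l) (hs : m.real 9 0 = H.resid O d i t x z y) :
    Det O W .coefs m (fun m' => ∀ j < d, m'.real 10 j = H.coef O d i t x z y j) := by
  refine (Det.map (a := 10) (off := 0) (N := d) (fun j => H.coef O d i t x z y j) hW.dim
    (by decide) (fun m' hF => ?_) fun j hj m' hF hj15 => ?_).mono fun m' h _ j hj => ?_
  · simp [hF.nat 0 (by decide), hR.dim]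
  · rw [zero_add]
    have h11 := hF.nat 11 (by decide)
    have hR' : Rep d n T H m' := hR.frame hF (by decide)
    have h8 := hF.real 8 (by decide)
    have h9 := hF.real 9 (by decide)
    refine Det.seq (Q := fun m'' => m'' = m'.setR 10 j (if j = H.r i then 1 else 0)) ?_ ?_
    · refine Det.branch (fun hb => Det.setReal ?_) fun hb => Det.setReal ?_
      · simp only [BExp.ev_natEq, NExp.ev_read, NExp.ev_const, hj15, h11, hi, hR'.r] at hb
        simp [hj15, hb]
      · simp only [BExp.ev_natEq, NExp.ev_read, NExp.ev_const, hj15, h11, hi, hR'.r] at hb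
        simp [hj15, hb]
    rintro _ rfl
    generalize hδ : (if j = H.r i then (1 : ℝ) else 0) = δ
    have hR'' : Rep d n T H (m'.setR 10 j δ) := by
      obtain ⟨a1, a2, a3, a4, a5, a6, a7, a8, a9⟩ := hR'
      exact ⟨a1, a2, a3, a4, a5, a6, a7, a8, by simpa using a9⟩
    refine Det.seq ((Det.accum (i₀ := j) (N₀ := d) (fun l => -(H.test O i x l * H.K i l j)) hW.dim
      (fun m'' h => ?_) (fun m'' h => ?_) fun l hl m'' h hl14 => ?_).mono
      (Q' := fun m'' => m''.real 10 = Function.update (m'.real 10) j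
        (δ - ∑ l ∈ Finset.range d, H.test O i x l * H.K i l j) ∧ m''.nat 15 0 = j ∧
        m''.real 9 0 = H.resid O d i t x z y) fun m'' h hF'' => ⟨?_, ?_, ?_⟩) ?_
    · simp [h.nat 0 (by decide), hR'.dim]
    · simp [h.nat 15 (by decide), hj15]
    · have hR3 : Rep d n T H m'' := hR''.frame h (by decide)
      have e15 : m''.nat 15 0 = j := by rw [h.nat 15 (by decide)]; exact hj15
      have e11 : m''.nat 11 0 = i := by rw [h.nat 11 (by decide)]; simp [h11, hi]
      have e8 : m''.real 8 l = H.test O i x l := by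
        rw [h.real 8 (by decide)]; simp [h8, hu l hl]
      simp [e15, e11, e8, hl14, hR3.dim, hR3.K i l hl j hj]
    · rw [h]
      simp [sub_eq_add_neg]
    · rw [hF''.nat 15 (by decide)]; exact hj15
    · rw [hF''.real 9 (by decide)]; simp [h9, hs]
    · rintro m'' ⟨h10, h15, h9'⟩
      refine Det.setReal ?_
      simp [h15, h9', h10, Hyp.coef, hδ]
  · rw [h, if_pos (by omega), Nat.sub_zero]

end Specs

/-! ### Refinement along one sampled sequence -/

section Sweep

variable {n d T W k : ℕ} {O : LogitOracle n} {m : Mem} {H : Hyp} {i t y j : ℕ} {x z : ℕ → ℕ}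

lemma Rep.setN (h : Rep d n T H m) {a v q : ℕ} (ha : a ∉ [0, 1, 2, 6, 7, 8]) :
    Rep d n T H (m.setN a q v) := by
  simp only [List.mem_cons, List.not_mem_nil, or_false, not_or] at ha
  obtain ⟨h0, h1, h2, h6, h7, h8⟩ := ha
  obtain ⟨a1, a2, a3, a4, a5, a6, a7, a8, a9⟩ := h
  constructor <;> simpa [Ne.symm h0, Ne.symm h1, Ne.symm h2, Ne.symm h6, Ne.symm h7, Ne.symm h8]

/-- Writing `-1` into slot `H.r i` of the dual values lets one uniform rank-one update produce the
new row and correct the old ones. -/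
lemma Rep.det_updateKernel (hR : Rep d n T H m) (hW : Large d n T W) (hi : m.nat 11 0 = i)
    (hg : ∀ l < d, m.real 7 l = H.dualVal O d i t z y l)
    (hw : ∀ j < d, m.real 10 j = H.coef O d i t x z y j) :
    Det O W .updateKernel m (fun m' => ∀ i', ∀ l < d, ∀ j < d,
      m'.real 5 ((i' * d + l) * d + j) = (H.pivot O d i t x z y).K i' l j) := by
  refine Det.seq (Q := fun m' => m' = m.setR 7 (H.r i) (-1)) (Det.setReal (by simp [hi, hR.r])) ?_
  rintro _ rfl
  refine (Det.addBlock (d := d) (q₀ := i) (fun l j =>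
    -((if l = H.r i then -1 else H.dualVal O d i t z y l) * H.coef O d i t x z y j)) hW.dim
    (by simp) (fun m' h => ?_) (fun m' h => ?_) fun l hl j hj m' h hl14 hj15 => ?_).mono
    fun m' h hF i' l hl j hj => ?_
  · simp [h.nat 0 (by decide), hR.dim]
  · simp [h.nat 11 (by decide), hi]
  · simp [h.real 7 (by decide), h.real 10 (by decide), hl14, hj15, hw j hj,
      Function.update_apply, hg l hl]
  · rw [h i' l hl j hj, Mem.setR_real_of_ne _ _ _ (by simp), hR.K i' l hl j hj]
    by_cases h1 : i' = i
    · subst h1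
      simp only [Hyp.pivot, if_true, sub_eq_add_neg]
    · simp only [Hyp.pivot, h1, if_false, add_zero]

/-- The program starts from `m₁`, where the coefficients are already those of the refinement; `m`
has the same naturals but still represents `H`. The rank is incremented last because it addresses
the new slot. -/
lemma det_store (hR : Rep d n T H m) (hW : Large d n T W)
    {m₁ : Mem} (hm₁ : ∀ a, m₁.nat a = m.nat a)
    (hK : ∀ i', ∀ l < d, ∀ j < d,
      m₁.real 5 ((i' * d + l) * d + j) = (H.pivot O d i t x z y).K i' l j)
    (ht : m.nat 10 0 = t) (hi : m.nat 11 0 = i) (hy : m.nat 13 0 = y) (htT : t ≤ T) (hyn : y < n)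
    (hz : ∀ c < T, m.nat 3 c = z c) (hzn : ∀ c, z c < n)
    (hx : ∀ c < T, m.nat 5 c = x c) (hxn : ∀ c, x c < n) (hr : H.r i < d) :
    Det O W .store m₁ (fun m' => Rep d n T (H.pivot O d i t x z y) m') := by
  have hnW := hW.tokens
  have hTW := hW.len
  have hdW := hW.dim
  refine Det.seq ((Det.forTo (N := T) (fun k m' =>
    (∀ i', ∀ j < d, ∀ c < T, m'.nat 1 ((i' * d + j) * T + c) =
      if (i' = i ∧ j = H.r i) ∧ c < k then x c else H.p i' j c) ∧
    (∀ i', ∀ j < d, ∀ c < T, m'.nat 2 ((i' * d + j) * T + c) =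
      if (i' = i ∧ j = H.r i) ∧ c < k then z c else H.w i' j c)) (by omega)
    (by decide) (fun m' h => ?_) ?_ fun k hk m' h hk16 hI => ?_).mono
    (Q' := fun m' => (∀ i', ∀ j < d, ∀ c < T, m'.nat 1 ((i' * d + j) * T + c) =
      (H.pivot O d i t x z y).p i' j c) ∧ (∀ i', ∀ j < d, ∀ c < T,
      m'.nat 2 ((i' * d + j) * T + c) = (H.pivot O d i t x z y).w i' j c) ∧
      (∀ a, a ∉ [1, 2, 16] → m'.nat a = m.nat a) ∧ m'.real 5 = m₁.real 5)
    fun m' h hF => ⟨fun i' j hj c hc => ?_, fun i' j hj c hc => ?_, fun a ha => ?_,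
      hF.real 5 (by decide)⟩) ?_
  · simp [h.nat 0 (by decide), hm₁, hR.len]
  · refine ⟨fun i' j hj c hc => ?_, fun i' j hj c hc => ?_⟩
    · simp [hm₁, hR.p i' j hj c hc]
    · simp [hm₁, hR.w i' j hj c hc]
  · have h0 : m'.nat 0 = m.nat 0 := by rw [h.nat 0 (by decide), hm₁]
    have h3 : m'.nat 3 = m.nat 3 := by rw [h.nat 3 (by decide), hm₁]
    have h5 : m'.nat 5 = m.nat 5 := by rw [h.nat 5 (by decide), hm₁]
    have h8 : m'.nat 8 = m.nat 8 := by rw [h.nat 8 (by decide), hm₁]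
    have h11 : m'.nat 11 = m.nat 11 := by rw [h.nat 11 (by decide), hm₁]
    refine Det.seq (Q := fun m'' => m'' = m'.setN 1 ((i * d + H.r i) * T + k) (x k))
      (Det.setNat ?_ ?_) ?_
    · have := hxn k
      simp [hk16, h5, hx k hk]; omega
    · simp [hk16, h5, hx k hk, h0, h8, h11, hi, hR.r, hR.dim, hR.len]
    rintro _ rfl
    refine Det.setNat ?_ ?_
    · have := hzn k
      simp [hk16, h3, hz k hk]; omega
    · simp only [NExp.ev_add, NExp.ev_mul, NExp.ev_read, NExp.ev_const, ne_eq,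
        OfNat.ofNat_ne_one, Nat.reduceEqDiff, not_false_eq_true, Mem.setN_nat_of_ne,
        Mem.setN_nat_self, zero_ne_one, OfNat.one_ne_ofNat,
        h0, h8, h11, h3, hk16, hi,
        hR.r, hR.dim, hR.len, hz k hk]
      refine ⟨fun i' j hj c hc => ?_, fun i' j hj c hc => ?_⟩
      · simp only [Function.update_apply, flat_inj hc hk, flat_inj hj hr, hI.1 i' j hj c hc]
        by_cases h : (i' = i ∧ j = H.r i) ∧ c = k
        · rw [if_pos h, if_pos (by omega), h.2]
        · rw [if_neg h]
          by_cases h' : (i' = i ∧ j = H.r i) ∧ c < k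
          · rw [if_pos h', if_pos (by omega)]
          · rw [if_neg h', if_neg (by omega)]
      · simp only [Function.update_apply, flat_inj hc hk, flat_inj hj hr, hI.2 i' j hj c hc]
        by_cases h : (i' = i ∧ j = H.r i) ∧ c = k
        · rw [if_pos h, if_pos (by omega), h.2]
        · rw [if_neg h]
          by_cases h' : (i' = i ∧ j = H.r i) ∧ c < k
          · rw [if_pos h', if_pos (by omega)]
          · rw [if_neg h', if_neg (by omega)]
  · rw [h.1 i' j hj c hc]
    simp only [hc, and_true, Hyp.pivot]
    split_ifs <;> rfl
  · rw [h.2 i' j hj c hc]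
    simp only [hc, and_true, Hyp.pivot]
    split_ifs <;> rfl
  · simp only [List.mem_cons, List.not_mem_nil, or_false, not_or] at ha
    rw [hF.nat a (by simp [Cmd.forTo, Cmd.wn, ha]), hm₁]
  rintro m' ⟨hp, hw, hnat, h5⟩
  have e0 := hnat 0 (by simp)
  have e6 := hnat 6 (by simp)
  have e7 := hnat 7 (by simp)
  have e8 := hnat 8 (by simp)
  have e10 := hnat 10 (by simp)
  have e11 := hnat 11 (by simp)
  have e13 := hnat 13 (by simp)
  refine Det.seq (Q := fun m'' => m'' = m'.setN 6 (i * d + H.r i) t)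
    (Det.setNat (by simp [e10, ht]; omega) (by simp [e0, e8, e10, e11, ht, hi, hR.r, hR.dim])) ?_
  rintro _ rfl
  refine Det.seq (Q := fun m'' => m'' = (m'.setN 6 (i * d + H.r i) t).setN 7 (i * d + H.r i) y)
    (Det.setNat (by simp [e13, hy]; omega) (by simp [e0, e8, e13, e11, hy, hi, hR.r, hR.dim])) ?_
  rintro _ rfl
  refine Det.setNat (by simp [e8, e11, hi, hR.r]; omega) ?_
  constructor
  · simp [e0, hR.dim]
  · simp [e0, hR.tokens]
  · simp [e0, hR.len]
  · simpa using hp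
  · simpa using hw
  · intro i' l hl
    simp [Function.update_apply, flat_inj hl hr, e6, hR.e i' l hl, Hyp.pivot]
  · intro i' l hl
    simp [Function.update_apply, flat_inj hl hr, e7, hR.y i' l hl, Hyp.pivot]
  · intro i'
    simp [Function.update_apply, e8, e11, hi, hR.r, Hyp.pivot]
  · intro i' l hl j hj
    simpa [h5] using hK i' l hl j hj

lemma Rep.det_check (hR : Rep d n T H m) (hW : Large d n T W) (hH : H.Inv O d T)
    (hO : IsLinear O k) (hk : k ≤ d)
    (ht : m.nat 10 0 = t) (hi : m.nat 11 0 = i) (hj : m.nat 12 0 = j) (hy : m.nat 13 0 = y)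
    (htT : t < T) (hit : i ≤ t) (hjd : j < d) (hyn : y < n)
    (hz : ∀ c < T, m.nat 3 c = z c) (hzn : ∀ c, z c < n) :
    Det O W .check m (fun m' =>
      (H.resid O d i t (H.cand i j z) z y = 0 ∧ Rep d n T H m') ∨
      (H.resid O d i t (H.cand i j z) z y ≠ 0 ∧
        Rep d n T (H.pivot O d i t (H.cand i j z) z y) m')) := by
  set x := H.cand i j z
  have hxn : ∀ c, x c < n := Hyp.cand_lt hH hzn i j
  refine Det.seq ((hR.det_candidate hW hH hi hj (Or.inr hjd) hz hzn).mono
    (Q' := fun m₁ => (∀ c < T, m₁.nat 5 c = x c) ∧ (∀ a ∉ [4, 5, 16], m₁.nat a = m.nat a) ∧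
      Rep d n T H m₁) fun m₁ h hF => ⟨h, fun a ha => hF.nat a ?_, hR.frame hF (by decide)⟩) ?_
  · simp only [List.mem_cons, List.not_mem_nil, or_false, not_or] at ha
    simp [Cmd.candidate, Cmd.copy, Cmd.forTo, Cmd.wn, ha]
  rintro m₁ ⟨hx₁, hn₁, hR₁⟩
  refine Det.seq ((hR₁.det_tests hW hH (by rw [hn₁ 11 (by simp), hi]) hx₁ hxn).mono
    (Q' := fun m₂ => (∀ c < T, m₂.nat 5 c = x c) ∧
      (∀ a ∉ [4, 5, 14, 16], m₂.nat a = m.nat a) ∧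
      Rep d n T H m₂ ∧ ∀ l < d, m₂.real 8 l = H.test O i x l)
    fun m₂ h hF => ⟨?_, fun a ha => ?_, hR₁.frame hF (by decide), h⟩) ?_
  · rw [hF.nat 5 (by decide)]; exact hx₁
  · simp only [List.mem_cons, List.not_mem_nil, or_false, not_or] at ha
    rw [hF.nat a (by simp [Cmd.tests, Cmd.logit, Cmd.copy, Cmd.forTo, Cmd.wn, ha]),
      hn₁ a (by simp [ha])]
  rintro m₂ ⟨hx₂, hn₂, hR₂, hu₂⟩
  refine Det.seq ((hR₂.det_prefixes (t := t) (i := i) (y := y) (z := z) hW hH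
    (by rw [hn₂ 10 (by simp), ht]) (by rw [hn₂ 11 (by simp), hi])
    (by rw [hn₂ 13 (by simp), hy]) htT.le hyn (by rw [hn₂ 3 (by simp)]; exact hz) hzn).mono
    (Q' := fun m₃ => (∀ c < T, m₃.nat 5 c = x c) ∧
      (∀ a ∉ [4, 5, 14, 16], m₃.nat a = m.nat a) ∧
      Rep d n T H m₃ ∧ (∀ l < d, m₃.real 8 l = H.test O i x l) ∧
      ∀ j < d, m₃.real 6 j = val O i t (H.p i j) z y)
    fun m₃ h hF => ⟨?_, fun a ha => ?_, hR₂.frame hF (by decide), ?_, h⟩) ?_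
  · rw [hF.nat 5 (by decide)]; exact hx₂
  · rw [← hn₂ a ha]
    simp only [List.mem_cons, List.not_mem_nil, or_false, not_or] at ha
    exact hF.nat a (by simp [Cmd.prefixes, Cmd.logit, Cmd.copy, Cmd.forTo, Cmd.wn, ha])
  · rw [hF.real 8 (by decide)]; exact hu₂
  rintro m₃ ⟨hx₃, hn₃, hR₃, hu₃, hf₃⟩
  refine Det.seq ((hR₃.det_duals hW (by rw [hn₃ 11 (by simp), hi]) hf₃).mono
    (Q' := fun m₄ => (∀ c < T, m₄.nat 5 c = x c) ∧
      (∀ a ∉ [4, 5, 14, 15, 16], m₄.nat a = m.nat a) ∧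
      Rep d n T H m₄ ∧ (∀ l < d, m₄.real 8 l = H.test O i x l) ∧
      ∀ l < d, m₄.real 7 l = H.dualVal O d i t z y l)
    fun m₄ h hF => ⟨?_, fun a ha => ?_, hR₃.frame hF (by decide), ?_, h⟩) ?_
  · rw [hF.nat 5 (by decide)]; exact hx₃
  · simp only [List.mem_cons, List.not_mem_nil, or_false, not_or] at ha
    rw [hF.nat a (by simp [Cmd.duals, Cmd.accum, Cmd.forTo, Cmd.wn, ha]), hn₃ a (by simp [ha])]
  · rw [hF.real 8 (by decide)]; exact hu₃
  rintro m₄ ⟨hx₄, hn₄, hR₄, hu₄, hg₄⟩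
  refine Det.seq ((hR₄.det_residual (t := t) (i := i) (y := y) (z := z) hW
    (by rw [hn₄ 10 (by simp), ht]) (by rw [hn₄ 11 (by simp), hi])
    (by rw [hn₄ 13 (by simp), hy]) htT.le hyn (by rw [hn₄ 3 (by simp)]; exact hz) hzn
    hx₄ hxn hu₄ hg₄).mono
    (Q' := fun m₅ => (∀ c < T, m₅.nat 5 c = x c) ∧
      (∀ a ∉ [4, 5, 14, 15, 16], m₅.nat a = m.nat a) ∧
      Rep d n T H m₅ ∧ (∀ l < d, m₅.real 8 l = H.test O i x l) ∧
      (∀ l < d, m₅.real 7 l = H.dualVal O d i t z y l) ∧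
      m₅.real 9 0 = H.resid O d i t x z y)
    fun m₅ h hF => ⟨?_, fun a ha => ?_, hR₄.frame hF (by decide), ?_, ?_, h⟩) ?_
  · rw [hF.nat 5 (by decide)]; exact hx₄
  · rw [← hn₄ a ha]
    simp only [List.mem_cons, List.not_mem_nil, or_false, not_or] at ha
    exact hF.nat a (by simp [Cmd.residual, Cmd.accum, Cmd.logit, Cmd.copy, Cmd.forTo, Cmd.wn, ha])
  · rw [hF.real 8 (by decide)]; exact hu₄
  · rw [hF.real 7 (by decide)]; exact hg₄
  rintro m₅ ⟨hx₅, hn₅, hR₅, hu₅, hg₅, hs₅⟩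
  refine Det.branch (fun hb => Det.skip (Or.inl ⟨?_, hR₅⟩)) fun hb => ?_
  · simpa [hs₅] using hb
  have hs : H.resid O d i t x z y ≠ 0 := by simpa [hs₅] using hb
  refine Det.seq ((hR₅.det_coefs hW (by rw [hn₅ 11 (by simp), hi]) hu₅ hs₅).mono
    (Q' := fun m₆ => (∀ c < T, m₆.nat 5 c = x c) ∧
      (∀ a ∉ [4, 5, 14, 15, 16], m₆.nat a = m.nat a) ∧
      Rep d n T H m₆ ∧
      (∀ l < d, m₆.real 7 l = H.dualVal O d i t z y l) ∧
      ∀ j < d, m₆.real 10 j = H.coef O d i t x z y j)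
    fun m₆ h hF => ⟨?_, fun a ha => ?_, hR₅.frame hF (by decide), ?_, h⟩) ?_
  · rw [hF.nat 5 (by decide)]; exact hx₅
  · rw [← hn₅ a ha]
    simp only [List.mem_cons, List.not_mem_nil, or_false, not_or] at ha
    exact hF.nat a (by simp [Cmd.coefs, Cmd.accum, Cmd.forTo, Cmd.wn, ha])
  · rw [hF.real 7 (by decide)]; exact hg₅
  rintro m₆ ⟨hx₆, hn₆, hR₆, hg₆, hw₆⟩
  refine Det.seq ((hR₆.det_updateKernel hW (by rw [hn₆ 11 (by simp), hi]) hg₆ hw₆).mono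
    (Q' := fun m₇ => (∀ a ∉ [14, 15], m₇.nat a = m₆.nat a) ∧
      ∀ i', ∀ l < d, ∀ j < d,
        m₇.real 5 ((i' * d + l) * d + j) = (H.pivot O d i t x z y).K i' l j)
    fun m₇ h hF => ⟨fun a ha => ?_, h⟩) ?_
  · simp only [List.mem_cons, List.not_mem_nil, or_false, not_or] at ha
    exact hF.nat a (by simp [Cmd.updateKernel, Cmd.addBlock, Cmd.forTo, Cmd.wn, ha])
  rintro m₇ ⟨hn₇, hK₇⟩
  -- A fictitious memory with the naturals after the coefficient update and the reals before it: at
  -- this moment no actual memory represents either hypothesis.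
  have hR₇ : Rep d n T H ⟨m₇.nat, m₆.real⟩ := by
    obtain ⟨a1, a2, a3, a4, a5, a6, a7, a8, a9⟩ := hR₆
    constructor
    · simpa [hn₇] using a1
    · simpa [hn₇] using a2
    · simpa [hn₇] using a3
    · simpa [hn₇] using a4
    · simpa [hn₇] using a5
    · simpa [hn₇] using a6
    · simpa [hn₇] using a7
    · simpa [hn₇] using a8
    · exact a9
  refine (det_store hR₇ hW (m₁ := m₇) (fun a => rfl) hK₇ ?_ ?_ ?_ htT.le hyn ?_ hzn ?_ hxn
    ((hH.r_lt hO hit hxn hzn hyn hs).trans_le hk)).mono fun m' h _ => Or.inr ⟨hs, h⟩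
  · simp [hn₇, hn₆, ht]
  · simp [hn₇, hn₆, hi]
  · simp [hn₇, hn₆, hy]
  · simpa [hn₇, hn₆] using hz
  · simpa [hn₇] using hx₆

/-- The memory holds a refinement of the hypothesis `H`, which is a proper one unless `P` holds. -/
def Swept (O : LogitOracle n) (d T : ℕ) (H : Hyp) (P : Prop) (m : Mem) : Prop :=
  ∃ H' : Hyp, Rep d n T H' m ∧ H'.Inv O d T ∧ ((H' = H ∧ P) ∨ H.total T < H'.total T)

/-- The conditions `P' l` accumulate only while the hypothesis is still `H`. After a refinement only
the growth of the total rank is remembered. -/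
lemma Swept.forTo {P : Prop} {c : Cmd} {a : ℕ} {e : NExp} {N : ℕ} (P' : ℕ → Prop)
    (hm : Swept O d T H P m) (hN : N ≤ W) (hx : a ∉ c.wn) (ha : a ∉ [0, 1, 2, 6, 7, 8])
    (he : ∀ m', Frame (.forTo a e c) m m' → e.ev m' = N)
    (hs : ∀ l < N, ∀ m' P₀, Frame (.forTo a e c) m m' → m'.nat a 0 = l → Swept O d T H P₀ m' →
      Det O W c m' (fun m'' => Swept O d T H (P₀ ∧ P' l) m'')) :
    Det O W (.forTo a e c) m (fun m' => Swept O d T H (P ∧ ∀ l < N, P' l) m') := by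
  refine Det.forTo (fun i m' => Swept O d T H (P ∧ ∀ l < i, P' l) m') hN hx he ?_
    fun l hl m' hF hal hI => (hs l hl m' _ hF hal hI).mono fun m'' h _ => ?_
  · obtain ⟨H', h1, h2, h3⟩ := hm
    exact ⟨H', h1.setN ha, h2, by simpa using h3⟩
  · obtain ⟨H', h1, h2, h3⟩ := h
    refine ⟨H', h1.setN ha, h2, h3.imp_left fun h => ⟨h.1, h.2.1.1, fun l' hl' => ?_⟩⟩
    rcases Nat.lt_succ_iff_lt_or_eq.1 hl' with h' | rfl
    · exact h.2.1.2 l' h'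
    · exact h.2.2

/-- A refinement in the middle of the sweep may invalidate earlier checks. This does no harm: the
final hypothesis need not be consistent with `z`; it suffices that an inconsistent `H` gains rank.
-/
lemma Rep.det_sweep (hR : Rep d n T H m) (hW : Large d n T W) (hH : H.Inv O d T)
    (hO : IsLinear O k) (hk : k ≤ d) (hz : ∀ c < T, m.nat 3 c = z c) (hzn : ∀ c, z c < n) :
    Det O W .sweep m (fun m' => Swept O d T H (H.Good O d T z) m') := by
  have hTW := hW.len
  have h0 : Swept O d T H True m := ⟨H, hR, hH, Or.inl ⟨rfl, trivial⟩⟩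
  refine (h0.forTo (fun t => ∀ i < t + 1, ∀ j < d, ∀ y < n,
    H.resid O d i t (H.cand i j z) z y = 0) (N := T) (by omega) (by decide) (by simp)
    (fun m' h => ?_) fun t ht m₁ P₁ hF₁ ht₁ h₁ => ?_).mono fun m' h _ => ?_
  · simp [h.nat 0 (by decide), hR.len]
  · refine h₁.forTo (fun i => ∀ j < d, ∀ y < n, H.resid O d i t (H.cand i j z) z y = 0)
      (N := t + 1) (by omega) (by decide) (by simp) (fun m' h => ?_)
      fun i hi m₂ P₂ hF₂ hi₂ h₂ => ?_
    · simp [h.nat 10 (by decide), ht₁]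
    refine h₂.forTo (fun j => ∀ y < n, H.resid O d i t (H.cand i j z) z y = 0)
      (N := d) hW.dim (by decide) (by simp) (fun m' h => ?_)
      fun j hj m₃ P₃ hF₃ hj₃ h₃ => ?_
    · simp [h.nat 0 (by decide), hF₂.nat 0 (by decide), hF₁.nat 0 (by decide), hR.dim]
    refine h₃.forTo (fun y => H.resid O d i t (H.cand i j z) z y = 0)
      (N := n) hW.tokens (by decide) (by simp) (fun m' h => ?_)
      fun y hy m₄ P₄ hF₄ hy₄ h₄ => ?_
    · simp [h.nat 0 (by decide), hF₃.nat 0 (by decide), hF₂.nat 0 (by decide),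
        hF₁.nat 0 (by decide), hR.tokens]
    obtain ⟨H', hR', hH', hor⟩ := h₄
    have hz₄ : ∀ c < T, m₄.nat 3 c = z c := by
      rw [hF₄.nat 3 (by decide), hF₃.nat 3 (by decide), hF₂.nat 3 (by decide),
        hF₁.nat 3 (by decide)]
      exact hz
    have ht₄ : m₄.nat 10 0 = t := by
      rw [hF₄.nat 10 (by decide), hF₃.nat 10 (by decide), hF₂.nat 10 (by decide), ht₁]
    have hi₄ : m₄.nat 11 0 = i := by
      rw [hF₄.nat 11 (by decide), hF₃.nat 11 (by decide), hi₂]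
    have hj₄ : m₄.nat 12 0 = j := by rw [hF₄.nat 12 (by decide), hj₃]
    refine (hR'.det_check hW hH' hO hk ht₄ hi₄ hj₄ hy₄ ht (by omega) hj hy hz₄ hzn).mono
      fun m' h _ => ?_
    rcases h with ⟨h, hRep⟩ | ⟨h, hRep⟩
    · refine ⟨H', hRep, hH', hor.imp_left ?_⟩
      rintro ⟨rfl, hP⟩
      exact ⟨rfl, hP, h⟩
    · refine ⟨_, hRep, hH'.pivot hO hk (by omega) ht.le (Hyp.cand_lt hH' hzn i j) hzn hy h,
        Or.inr ?_⟩
      rw [Hyp.total_pivot (by omega)]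
      rcases hor with ⟨rfl, -⟩ | h' <;> omega
  · obtain ⟨H', h1, h2, h3⟩ := h
    exact ⟨H', h1, h2, h3.imp_left fun h => ⟨h.1, fun t ht i hi j hj y hy =>
      h.2.2 t ht i (by omega) j hj y hy⟩⟩

end Sweep

/-! ### Sampling from the model through logit queries -/

section Sample

variable {n d T W k : ℕ} {m : Mem} {M : ISAN n T k}

lemma Det.seq_run {O : LogitOracle n} {c₁ c₂ : Cmd} {Q Q' : Mem → Prop} {f : Mem → ℝ≥0∞}
    {v : ℝ≥0∞} {B : ℕ} (h₁ : Det O W c₁ m Q) (h₂ : ∀ m', Q m' → Run O B c₂ m' Q' f v) :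
    Run O (c₁.bound W + B) (.seq c₁ c₂) m Q' f v :=
  Run.seq (Run.const (f := fun _ => v) h₁ fun _ _ => le_rfl) h₂

lemma expect_nonneg {κ : ℕ → (ℕ → ℕ) → ℕ → ℝ} (hκ : ∀ c b y, 0 ≤ κ c b y) {g : (ℕ → ℕ) → ℝ}
    (hg : ∀ b, 0 ≤ g b) (j c : ℕ) (b : ℕ → ℕ) : 0 ≤ expect n κ g j c b := by
  induction j generalizing c b with
  | zero => exact hg b
  | succ j ih => exact Finset.sum_nonneg fun y _ => mul_nonneg (hκ _ _ _) (ih _ _)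

lemma ISAN.nextP_nonneg (c : ℕ) (b : ℕ → ℕ) (y : ℕ) : 0 ≤ M.nextP c b y := by
  unfold ISAN.nextP
  split_ifs
  · exact (softmax_pos _ _).le
  · exact le_rfl

/-- Reservoir sampling of a token from the softmax distribution. -/
lemma run_sampleToken {O : LogitOracle n} (hW : Large d n T W) {t : ℕ} {b : ℕ → ℕ}
    {a : ℕ → ℝ} {E : (ℕ → ℕ) → ℝ} (hE : ∀ b, 0 ≤ E b) (hn : 0 < n)
    (hN : m.nat 0 1 = n) (ht : m.nat 10 0 = t) (hb : m.nat 3 = b)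
    (hbn : ∀ c, b c < n)
    (ha : ∀ y < n, m.real 4 y = a y) (h9 : m.real 9 0 = 0) :
    Run O ((Cmd.forTo 13 .tokens (.seq
        (.setReal 9 (.const 0) (.add (.read 9 (.const 0)) (.exp (.read 4 (.var 13)))))
        (.seq (.flip 18 (.const 0) (.div (.exp (.read 4 (.var 13))) (.read 9 (.const 0))))
          (.branch (.natEq (.var 18) (.const 1)) (.setNat 3 (.var 10) (.var 13)) .skip)))).bound W)
      (Cmd.forTo 13 .tokens (.seq
        (.setReal 9 (.const 0) (.add (.read 9 (.const 0)) (.exp (.read 4 (.var 13)))))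
        (.seq (.flip 18 (.const 0) (.div (.exp (.read 4 (.var 13))) (.read 9 (.const 0))))
          (.branch (.natEq (.var 18) (.const 1)) (.setNat 3 (.var 10) (.var 13)) .skip)))) m
      (fun m' => ∀ c, m'.nat 3 c < n) (fun m' => ENNReal.ofReal (E (m'.nat 3)))
      (ENNReal.ofReal (∑ y ∈ Finset.range n,
        Real.exp (a y) / (∑ y' ∈ Finset.range n, Real.exp (a y')) * E (Function.update b t y))) := by
  have hnW := hW.tokens
  set S : ℕ → ℝ := fun y => ∑ y' ∈ Finset.range y, Real.exp (a y') with hS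
  have hS0 : ∀ y, 0 ≤ S y := fun y => Finset.sum_nonneg fun _ _ => (Real.exp_pos _).le
  have hS1 : ∀ y, S (y + 1) = S y + Real.exp (a y) := fun y => Finset.sum_range_succ _ _
  have hSpos : ∀ y, 0 < S (y + 1) := fun y => by
    rw [hS1]; exact add_pos_of_nonneg_of_pos (hS0 y) (Real.exp_pos _)
  have hSn : 0 < S n := by
    obtain ⟨n', rfl⟩ := Nat.exists_eq_succ_of_ne_zero hn.ne'
    exact hSpos n'
  set R : ℕ → ℝ := fun y => ∑ y' ∈ Finset.Ico y n, Real.exp (a y') * E (Function.update b t y')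
    with hRdef
  have hR0 : ∀ y, 0 ≤ R y := fun y =>
    Finset.sum_nonneg fun _ _ => mul_nonneg (Real.exp_pos _).le (hE _)
  have hR1 : ∀ y < n, R y = Real.exp (a y) * E (Function.update b t y) + R (y + 1) :=
    fun y hy => Finset.sum_eq_sum_Ico_succ_bot hy _
  -- The expected final value of `E` when `y` tokens have been processed: the current content
  -- survives with probability `S y / S n`, and a later token `y'` is the final choice with
  -- probability `exp (a y') / S n`.
  set V : ℕ → (ℕ → ℕ) → ℝ := fun y z => (S y * E z + R y) / S n with hV
  have hV0 : ∀ y z, 0 ≤ V y z := fun y z =>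
    div_nonneg (add_nonneg (mul_nonneg (hS0 _) (hE _)) (hR0 _)) hSn.le
  refine (Run.forTo (N := n) (v := ENNReal.ofReal (V 0 b))
    (fun y m' => (∀ c, m'.nat 3 c < n) ∧ m'.real 9 0 = S y ∧
      -- This says that the string has changed at most in position `t`.
      ∀ v, Function.update (m'.nat 3) t v = Function.update b t v)
    (fun y m' => ENNReal.ofReal (V y (m'.nat 3))) hnW (by decide) (fun m' h => ?_)
    ⟨by simpa [hb] using hbn, by simp [h9, hS], by simp [hb]⟩ (by simp [hb])
    fun y hy m₁ hF hy₁ hI => ?_).mono le_rfl (fun m' h => ⟨h.1, le_of_eq ?_⟩) (le_of_eq ?_)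
  · simp [h.nat 0 (by decide), hN]
  · obtain ⟨hzn, hacc, hupd⟩ := hI
    have e4 : m₁.real 4 y = a y := by rw [hF.real 4 (by decide), ha y hy]
    have e10 : m₁.nat 10 0 = t := by rw [hF.nat 10 (by decide), ht]
    set p : ℝ := Real.exp (a y) / S (y + 1) with hp
    refine Det.seq_run (Q := fun m₂ => m₂ = m₁.setR 9 0 (S (y + 1))) (Det.setReal ?_) ?_
    · simp [hy₁, hacc, e4, hS1]
    rintro _ rfl
    have hp0 : 0 ≤ p := div_nonneg (Real.exp_pos _).le (hS0 _)
    have hp1 : p ≤ 1 := by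
      rw [hp, div_le_one (hSpos y), hS1]
      linarith [hS0 y]
    refine Run.seq (Q := fun m₂ => m₂ = (m₁.setR 9 0 (S (y + 1))).setN 18 0 1 ∨
        m₂ = (m₁.setR 9 0 (S (y + 1))).setN 18 0 0)
      (g := fun m₂ => if m₂.nat 18 0 = 1 then ENNReal.ofReal (V (y + 1) (Function.update b t y))
        else ENNReal.ofReal (V (y + 1) (m₁.nat 3)))
      (Run.flip (p := p) ?_ hp0 hp1 (fun _ => Or.inl rfl) (fun _ => Or.inr rfl) ?_) ?_
    · simp [hy₁, e4, hp]
    · simp only [NExp.ev_const, Mem.setN_nat_self, Function.update_self, if_true, zero_ne_one,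
        if_false]
      rw [← ENNReal.ofReal_mul hp0, ← ENNReal.ofReal_mul (by linarith),
        ← ENNReal.ofReal_add (mul_nonneg hp0 (hV0 _ _)) (mul_nonneg (by linarith) (hV0 _ _))]
      -- The potential is a martingale: replacing the content with probability `exp (a y) / S (y +
      -- 1)` preserves it exactly.
      refine ENNReal.ofReal_le_ofReal (le_of_eq ?_)
      have h1 := (hSpos y).ne'
      have h2 := hSn.ne'
      simp only [hV, hp, hR1 y hy]
      rw [hS1] at h1 ⊢
      field_simp
      ring
    · rintro m₂ (rfl | rfl)
      · refine Run.branch (fun _ => Run.setNat (W := W) ?_ ?_ ?_)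
          (fun h => (h (by simp)).elim)
        · simp [hy₁]; omega
        · simp only [NExp.ev_read, NExp.ev_const, ne_eq, Nat.reduceEqDiff, not_false_eq_true,
            Mem.setN_nat_of_ne, Mem.setR_nat, e10, hy₁, Mem.setN_nat_self, Mem.setN_real,
            Mem.setR_real_self, Function.update_self, Function.update_idem, true_and]
          refine ⟨fun c => ?_, hupd⟩
          rw [Function.update_apply]
          split_ifs
          · exact hy
          · exact hzn c
        · simp only [NExp.ev_read, NExp.ev_const, ne_eq, Nat.reduceEqDiff, not_false_eq_true,
            Mem.setN_nat_of_ne, Mem.setR_nat, e10, hy₁, Mem.setN_nat_self, hupd,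
            Function.update_self, if_true]
          exact le_rfl
      · refine Run.branch (fun h => ?_) (fun _ => Run.skip ?_ ?_)
        · simp at h
        · simpa using ⟨hzn, hupd⟩
        · simp
  · have h2 := hSn.ne'
    simp only [hV, hRdef, Finset.Ico_self, Finset.sum_empty, add_zero]
    rw [mul_div_cancel_left₀ _ h2]
  -- Since `S 0 = 0`, the former content of the cell has weight zero.
  · simp only [hV, hRdef, hS, Finset.range_zero, Finset.sum_empty, zero_mul, zero_add,
      ← Finset.range_eq_Ico, Finset.sum_div]
    congr 1
    exact Finset.sum_congr rfl fun y _ => by ring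

/-- The sampler draws from the distribution of the model. -/
lemma run_sample (hW : Large d n T W) (hn : 0 < n) {g : (ℕ → ℕ) → ℝ} (hg : ∀ b, 0 ≤ g b)
    (hN : m.nat 0 1 = n) (hT : m.nat 0 2 = T) (hz : ∀ c, m.nat 3 c < n) :
    Run M.oracle (Cmd.sample.bound W) .sample m (fun m' => ∀ c, m'.nat 3 c < n)
      (fun m' => ENNReal.ofReal (g (m'.nat 3)))
      (ENNReal.ofReal (expect n M.nextP g T 0 (m.nat 3))) := by
  have hTW := hW.len
  refine (Run.forTo (N := T) (fun t m' => ∀ c, m'.nat 3 c < n)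
    -- The potential is the conditional expectation of `g` given the first `t` tokens.
    (fun t m' => ENNReal.ofReal (expect n M.nextP g (T - t) t (m'.nat 3))) (by omega) (by decide)
    (fun m' h => ?_) (by simpa using hz) (by simp)
    fun t ht m₁ hF ht₁ hI => ?_).mono le_rfl (fun m' h => ⟨h, ?_⟩) le_rfl
  · simp [h.nat 0 (by decide), hT]
  · refine Det.seq_run (Q := fun m₂ => m₂ = m₁.ask M.oracle 3 0 t 4 0)
      (Det.query (by simp [ht₁]; omega) hW.tokens (by simp [ht₁])) ?_
    rintro _ rfl
    refine Det.seq_run (Q := fun m₂ => m₂ = (m₁.ask M.oracle 3 0 t 4 0).setR 9 0 0)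
      (Det.setReal (by simp)) ?_
    rintro _ rfl
    have key := run_sampleToken (O := M.oracle) (m := (m₁.ask M.oracle 3 0 t 4 0).setR 9 0 0)
      (b := m₁.nat 3) (a := fun y => ask M.oracle (m₁.nat 3) t y) (t := t)
      (E := fun b => expect n M.nextP g (T - (t + 1)) (t + 1) b) hW
      (fun b => expect_nonneg ISAN.nextP_nonneg hg _ _ _) hn
      (by simp [Mem.ask, hF.nat 0 (by decide), hN]) ht₁ rfl hI
      (fun y hy => by simp [Mem.ask, hy]) (by simp)
    refine key.mono le_rfl (fun m' h => ⟨by simpa using h, by simp⟩)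
      (le_of_eq ?_)
    congr 1
    obtain ⟨j, hj⟩ : ∃ j, T - t = j + 1 := ⟨T - t - 1, by omega⟩
    have hj' : T - (t + 1) = j := by omega
    rw [hj, hj', expect]
    refine Finset.sum_congr rfl fun y hy => ?_
    congr 1
    rw [show y = ((⟨y, Finset.mem_range.1 hy⟩ : Fin n) : ℕ) from rfl,
      ISAN.nextP_eq_softmax_ask ht hI, softmax, Finset.sum_range]
  · simp [expect]

end Sample

/-! ### Writing the parameters of the predicted model -/

section Output

variable {n d T W k : ℕ} {O : LogitOracle n} {m : Mem} {H : Hyp}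

lemma Hyp.test_congr {i l : ℕ} {x x' : ℕ → ℕ} (h : ∀ c < i, x c = x' c) :
    H.test O i x l = H.test O i x' l := val_congr O h fun _ _ => rfl

/-- When the prefix already has length `t`, no token of the continuation is read; so the readout
matrix is well defined without reference to a sequence. -/
lemma Hyp.dualVal_congr {t y l : ℕ} (z z' : ℕ → ℕ) :
    H.dualVal O d t t z y l = H.dualVal O d t t z' y l := by
  unfold dualVal basis
  refine Finset.sum_congr rfl fun j _ => ?_
  congr 1
  exact ask_congr O y fun c hc => by simp [splice, hc]

lemma Hyp.test_splice_congr {t l : ℕ} {p z z' : ℕ → ℕ} (h : z t = z' t) :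
    H.test O (t + 1) (splice t p z) l = H.test O (t + 1) (splice t p z') l := by
  refine test_congr fun c hc => ?_
  unfold splice
  split_ifs with h'
  · rfl
  · obtain rfl : c = t := by omega
    exact h

/-- The transition at time `t` sees only one token of the sequence, as a matrix `A t (z t)` must. -/
lemma Hyp.trans_congr {t l j : ℕ} {z z' : ℕ → ℕ} (h : z t = z' t) :
    H.trans O d t z l j = H.trans O d t z' l j := by
  simp only [trans, test_splice_congr h]

/-- The model described by the memory. -/
def Mem.out (d n T : ℕ) (m : Mem) : ISAN n T d := (m.st 0 0).output d n T

lemma Rep.det_outputInit (hR : Rep d n T H m) (hW : Large d n T W) (hH : H.Inv O d T)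
    (hz : ∀ c, m.nat 3 c < n) :
    Det O W .outputInit m (fun m' => ∀ l < d, ∀ x, m'.real 1 l = H.test O 0 x l) := by
  refine Det.seq (Q := fun m' => m' = m.setN 11 0 0) (Det.setNat (by simp) (by simp)) ?_
  rintro _ rfl
  have hR₁ : Rep d n T H (m.setN 11 0 0) := hR.setN (by simp)
  refine Det.seq ((hR₁.det_candidate (i := 0) (j := m.nat 12 0) (z := m.nat 3) hW hH (by simp)
    (by simp) (Or.inl rfl) (by simp) hz).mono
    (Q' := fun m₂ => (∀ c < T, m₂.nat 5 c = H.cand 0 (m.nat 12 0) (m.nat 3) c) ∧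
      m₂.nat 11 0 = 0 ∧ Rep d n T H m₂)
    fun m₂ h hF => ⟨h, by rw [hF.nat 11 (by decide)]; simp, hR₁.frame hF (by decide)⟩) ?_
  rintro m₂ ⟨h5, h11, hR₂⟩
  refine Det.seq ((hR₂.det_tests hW hH h11 h5 (Hyp.cand_lt hH hz _ _)).mono
    (Q' := fun m₃ => (∀ l < d, m₃.real 8 l = H.test O 0 (m.nat 3) l) ∧ Rep d n T H m₃)
    fun m₃ h hF => ⟨fun l hl => by rw [h l hl, Hyp.test_zero], hR₂.frame hF (by decide)⟩) ?_
  rintro m₃ ⟨h8, hR₃⟩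
  refine (Det.map (a := 1) (off := 0) (N := d) (fun l => H.test O 0 (m.nat 3) l) hW.dim (by decide)
    (fun m' hF => ?_) fun l hl m' hF hl14 => ?_).mono fun m' h _ l hl x => ?_
  · simp [hF.nat 0 (by decide), hR₃.dim]
  · refine Det.setReal ?_
    simp [hl14, hF.real 8 (by decide), h8 l hl]
  · rw [h, if_pos (by omega), Nat.sub_zero, Hyp.test_zero]

lemma Rep.det_outputRead (hR : Rep d n T H m) (hW : Large d n T W) (hH : H.Inv O d T)
    (hz : ∀ c, m.nat 3 c < n) :
    Det O W .outputRead m (fun m' => ∀ t < T, ∀ y < n, ∀ l < d, ∀ z,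
      m'.real 3 ((t * n + y) * d + l) = H.dualVal O d t t z y l) := by
  have hTW := hW.len
  refine (Det.forTo (N := T) (fun c m' => ∀ t, ∀ y < n, ∀ l < d, t < c →
      m'.real 3 ((t * n + y) * d + l) = H.dualVal O d t t (m.nat 3) y l) (by omega) (by decide)
      (fun m' hF => ?_) (by simp) fun t ht m₁ hF ht₁ hI => ?_).mono fun m' h _ t ht y hy l hl z => ?_
  · simp [hF.nat 0 (by decide), hR.len]
  · have hR₁ : Rep d n T H m₁ := hR.frame hF (by decide)
    have h3₁ : m₁.nat 3 = m.nat 3 := hF.nat 3 (by decide)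
    refine Det.seq (Q := fun m' => m' = m₁.setN 11 0 t)
      (Det.setNat (by simp [ht₁]; omega) (by simp [ht₁])) ?_
    rintro _ rfl
    have hR₂ : Rep d n T H (m₁.setN 11 0 t) := hR₁.setN (by simp)
    refine (Det.forTo (N := n) (fun c m' => ∀ t', ∀ y < n, ∀ l < d, (t' < t ∨ t' = t ∧ y < c) →
      m'.real 3 ((t' * n + y) * d + l) = H.dualVal O d t' t' (m.nat 3) y l) hW.tokens (by decide)
      (fun m' hF => ?_) ?_ fun y hy m₃ hF₃ hy₃ hI₃ => ?_).mono
      fun m' h _ t' y hy l hl htt' => ?_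
    · simp [hF.nat 0 (by decide), hR₁.tokens]
    · intro t' y hy l hl h
      simpa using hI t' y hy l hl (by omega)
    · have hR₃ : Rep d n T H m₃ := hR₂.frame hF₃ (by decide)
      have h3₃ : m₃.nat 3 = m.nat 3 := by rw [hF₃.nat 3 (by decide)]; simpa using h3₁
      have h10₃ : m₃.nat 10 0 = t := by rw [hF₃.nat 10 (by decide)]; simpa using ht₁
      have h11₃ : m₃.nat 11 0 = t := by rw [hF₃.nat 11 (by decide)]; simp
      refine Det.seq ((hR₃.det_prefixes (z := m.nat 3) hW hH h10₃ h11₃ hy₃ ht.le hy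
        (by simp [h3₃]) hz).mono
        (Q' := fun m' => (∀ j < d, m'.real 6 j = val O t t (H.p t j) (m.nat 3) y) ∧
          Rep d n T H m' ∧ m'.nat 10 0 = t ∧ m'.nat 11 0 = t ∧ m'.nat 13 0 = y ∧
          m'.real 3 = m₃.real 3) fun m' h hF => ⟨h, hR₃.frame hF (by decide), ?_, ?_, ?_,
            hF.real 3 (by decide)⟩) ?_
      · rw [hF.nat 10 (by decide), h10₃]
      · rw [hF.nat 11 (by decide), h11₃]
      · rw [hF.nat 13 (by decide), hy₃]
      rintro m₄ ⟨h6, hR₄, h10₄, h11₄, h13₄, e3⟩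
      refine Det.seq ((hR₄.det_duals (φ := fun p => val O t t p (m.nat 3) y) hW h11₄ h6).mono
        (Q' := fun m' => (∀ l < d, m'.real 7 l = H.dualVal O d t t (m.nat 3) y l) ∧
          Rep d n T H m' ∧ m'.nat 10 0 = t ∧ m'.nat 13 0 = y ∧
          m'.real 3 = m₃.real 3) fun m' h hF => ⟨h, hR₄.frame hF (by decide), ?_, ?_, ?_⟩) ?_
      · rw [hF.nat 10 (by decide), h10₄]
      · rw [hF.nat 13 (by decide), h13₄]
      · rw [hF.real 3 (by decide), e3]
      rintro m₅ ⟨h7, hR₅, h10₅, h13₅, e3₅⟩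
      refine (Det.map (a := 3) (off := (t * n + y) * d) (N := d)
        (fun l => H.dualVal O d t t (m.nat 3) y l) hW.dim (by decide)
        (fun m' hF => ?_) fun l hl m' hF hl14 => ?_).mono fun m' h _ t' y' hy' l hl hty => ?_
      · simp [hF.nat 0 (by decide), hR₅.dim]
      · refine Det.setReal ?_
        simp [hl14, hF.nat 0 (by decide), hF.nat 10 (by decide), hF.nat 13 (by decide), h10₅, h13₅,
          hF.real 7 (by decide), h7 l hl, hR₅.dim, hR₅.tokens]
      · rw [Mem.setN_real, h]
        by_cases heq : t' = t ∧ y' = y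
        · obtain ⟨rfl, rfl⟩ := heq
          rw [if_pos (by omega), Nat.add_sub_cancel_left]
        · have hne : t' * n + y' ≠ t * n + y := fun h' => heq ((flat_inj hy' hy).1 h')
          rw [if_neg, e3₅, hI₃ t' y' hy' l hl (by omega)]
          rintro ⟨ha, hb⟩
          obtain ⟨q, hq⟩ := Nat.exists_eq_add_of_le ha
          have := (flat_inj hl (by omega : q < d)).1 hq
          exact hne this.1
    · rw [Mem.setN_real]
      exact h t' y hy l hl (by omega)
  · rw [h t y hy l hl ht]
    exact Hyp.dualVal_congr _ _

/-- The entries are summed in place over the stored prefixes, whence the requirement that array `2`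
is zero initially. The current sequence serves as scratch space for the token `y`, so of it only the
bound `n` on its entries is maintained. -/
lemma Rep.det_outputTrans (hR : Rep d n T H m) (hW : Large d n T W) (hH : H.Inv O d T)
    (hz : ∀ c, m.nat 3 c < n) (h2 : ∀ q, m.real 2 q = 0) :
    Det O W .outputTrans m (fun m' => ∀ t < T, ∀ y < n, ∀ l < d, ∀ j < d,
      m'.real 2 (((t * n + y) * d + l) * d + j) = H.trans O d t (fun _ => y) l j) := by
  have hTW := hW.len
  have hnW := hW.tokens
  refine (Det.forTo (N := T) (fun c m' => (∀ q, m'.nat 3 q < n) ∧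
      ∀ t, ∀ y < n, ∀ l < d, ∀ j < d, m'.real 2 (((t * n + y) * d + l) * d + j) =
        if t < c then H.trans O d t (fun _ => y) l j else 0) (by omega) (by decide)
      (fun m' hF => ?_) ⟨by simpa using hz, by simp [h2]⟩ fun t ht m₁ hF ht₁ hI => ?_).mono
      fun m' h _ t ht y hy l hl j hj => ?_
  · simp [hF.nat 0 (by decide), hR.len]
  · have hR₁ : Rep d n T H m₁ := hR.frame hF (by decide)
    refine Det.seq (Q := fun m' => m' = m₁.setN 11 0 (t + 1))
      (Det.setNat (by simp [ht₁]; omega) (by simp [ht₁])) ?_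
    rintro _ rfl
    have hR₂ : Rep d n T H (m₁.setN 11 0 (t + 1)) := hR₁.setN (by simp)
    refine (Det.forTo (N := n) (fun c m' => (∀ q, m'.nat 3 q < n) ∧
      ∀ t', ∀ y < n, ∀ l < d, ∀ j < d, m'.real 2 (((t' * n + y) * d + l) * d + j) =
        if t' < t ∨ t' = t ∧ y < c then H.trans O d t' (fun _ => y) l j else 0) hnW
      (by decide) (fun m' hF => ?_) ?_ fun y hy m₃ hF₃ hy₃ hI₃ => ?_).mono
      fun m' h _ => ⟨?_, fun t' y hy l hl j hj => ?_⟩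
    · simp [hF.nat 0 (by decide), hR₁.tokens]
    · simpa using hI
    · have hR₃ : Rep d n T H m₃ := hR₂.frame hF₃ (by decide)
      have h10₃ : m₃.nat 10 0 = t := by rw [hF₃.nat 10 (by decide)]; simpa using ht₁
      have h11₃ : m₃.nat 11 0 = t + 1 := by rw [hF₃.nat 11 (by decide)]; simp
      refine Det.seq (Q := fun m' => m' = m₃.setN 3 t y)
        (Det.setNat (by simp [hy₃]; omega) (by simp [hy₃, h10₃])) ?_
      rintro _ rfl
      set z : ℕ → ℕ := Function.update (m₃.nat 3) t y with hzdef
      have hzn : ∀ c, z c < n := by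
        intro c
        rw [hzdef, Function.update_apply]
        split_ifs
        · exact hy
        · exact hI₃.1 c
      have hR₄ : Rep d n T H (m₃.setN 3 t y) := hR₃.setN (by simp)
      refine (Det.forTo (N := d) (fun c m' => ∀ t', ∀ y' < n, ∀ l < d, ∀ j < d,
        m'.real 2 (((t' * n + y') * d + l) * d + j) =
          (if t' < t ∨ t' = t ∧ y' < y then H.trans O d t' (fun _ => y') l j else 0) +
          if t' * n + y' = t * n + y then ∑ q ∈ Finset.range c,
            H.K t j q * H.test O (t + 1) (splice t (H.p t q) z) l else 0) hW.dim
        (by decide) (fun m' hF => ?_) ?_ fun q hq m₅ hF₅ hq₅ hI₅ => ?_).mono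
        fun m' h hF => ⟨?_, fun t' y' hy' l hl j hj => ?_⟩
      · simp [hF.nat 0 (by decide), hR₃.dim]
      · intro t' y' hy' l hl j hj
        simpa using hI₃.2 t' y' hy' l hl j hj
      · have hR₅ : Rep d n T H m₅ := hR₄.frame hF₅ (by decide)
        have h3₅ : m₅.nat 3 = z := by rw [hF₅.nat 3 (by decide)]; simp [hzdef]
        have h10₅ : m₅.nat 10 0 = t := by rw [hF₅.nat 10 (by decide)]; simpa using h10₃
        have h11₅ : m₅.nat 11 0 = t + 1 := by rw [hF₅.nat 11 (by decide)]; simpa using h11₃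
        have h13₅ : m₅.nat 13 0 = y := by rw [hF₅.nat 13 (by decide)]; simpa using hy₃
        refine Det.seq ((hR₅.det_candidate (z := z) hW hH h11₅ hq₅ (Or.inr hq) (by simp [h3₅])
          hzn).mono
          (Q' := fun m' => (∀ c < T, m'.nat 5 c = H.cand (t + 1) q z c) ∧ Rep d n T H m' ∧
            m'.nat 10 0 = t ∧ m'.nat 11 0 = t + 1 ∧ m'.nat 12 0 = q ∧ m'.nat 13 0 = y ∧
            m'.real = m₅.real)
          fun m' h hF => ⟨h, hR₅.frame hF (by decide), ?_, ?_, ?_, ?_, ?_⟩) ?_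
        · rw [hF.nat 10 (by decide), h10₅]
        · rw [hF.nat 11 (by decide), h11₅]
        · rw [hF.nat 12 (by decide), hq₅]
        · rw [hF.nat 13 (by decide), h13₅]
        · exact funext fun a => hF.real a (by simp [Cmd.candidate, Cmd.copy, Cmd.forTo, Cmd.wr])
        rintro m₆ ⟨h5₆, hR₆, h10₆, h11₆, h12₆, h13₆, er₆⟩
        refine Det.seq ((hR₆.det_tests hW hH h11₆ h5₆ (Hyp.cand_lt hH hzn _ _)).mono
          (Q' := fun m' => (∀ l < d, m'.real 8 l =
            H.test O (t + 1) (splice t (H.p t q) z) l) ∧ Rep d n T H m' ∧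
            m'.nat 10 0 = t ∧ m'.nat 12 0 = q ∧ m'.nat 13 0 = y ∧
            m'.real 2 = m₅.real 2)
          fun m' h hF => ⟨h, hR₆.frame hF (by decide), ?_, ?_, ?_, ?_⟩) ?_
        · rw [hF.nat 10 (by decide), h10₆]
        · rw [hF.nat 12 (by decide), h12₆]
        · rw [hF.nat 13 (by decide), h13₆]
        · rw [hF.real 2 (by decide), er₆]
        rintro m₇ ⟨h8₇, hR₇, h10₇, h12₇, h13₇, er₇⟩
        refine (Det.addBlock (d := d) (q₀ := t * n + y) (fun l j =>
          H.K t j q * H.test O (t + 1) (splice t (H.p t q) z) l) hW.dim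
          (by simp) (fun m' h => ?_) (fun m' h => ?_) fun l hl j hj m' h hl14 hj15 => ?_).mono
          fun m' h hF t' y' hy' l hl j hj => ?_
        · simp [h.nat 0 (by decide), hR₇.dim]
        · simp [h.nat 0 (by decide), h.nat 10 (by decide), h.nat 13 (by decide), h10₇, h13₇,
            hR₇.tokens]
        · simp [h.nat 0 (by decide), h.nat 10 (by decide), h.nat 12 (by decide),
            h.real 5 (by decide), h.real 8 (by decide), hl14, hj15, h10₇, h12₇, hR₇.dim,
            h8₇ l hl, hR₇.K t j hj q hq]
        · rw [Mem.setN_real, h _ l hl j hj, er₇, hI₅ t' y' hy' l hl j hj, Finset.sum_range_succ]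
          by_cases hq' : t' * n + y' = t * n + y
          · simp only [if_pos hq', add_assoc]
          · simp only [if_neg hq', add_zero]
      · intro c
        rw [Mem.setN_nat_of_ne _ _ _ (by simp), hF.nat 3 (by decide), Mem.setN_nat_self]
        exact hzn c
      · rw [Mem.setN_real, h t' y' hy' l hl j hj]
        by_cases heq : t' * n + y' = t * n + y
        · obtain ⟨rfl, rfl⟩ := (flat_inj hy' hy).1 heq
          rw [if_neg (by omega), if_pos rfl, if_pos (by omega), zero_add]
          exact Hyp.trans_congr (z := z) (z' := fun _ => y') (by simp [hzdef])
        · have : ¬ (t' = t ∧ y' = y) := fun h => heq (by rw [h.1, h.2])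
          rw [if_neg heq, add_zero]
          by_cases h' : t' < t ∨ t' = t ∧ y' < y
          · rw [if_pos h', if_pos (by omega)]
          · rw [if_neg h', if_neg (by omega)]
    · simpa using h.1
    · rw [Mem.setN_real, h.2 t' y hy l hl j hj]
      by_cases h' : t' < t + 1
      · rw [if_pos h', if_pos (by omega)]
      · rw [if_neg h', if_neg (by omega)]
  · rw [h.2 t y hy l hl j hj, if_pos ht]

lemma Rep.det_output (hR : Rep d n T H m) (hW : Large d n T W) (hH : H.Inv O d T)
    (hz : ∀ c, m.nat 3 c < n) (h2 : ∀ q, m.real 2 q = 0) :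
    Det O W .output m (fun m' => H.Realizes O (m'.out d n T)) := by
  refine Det.seq ((hR.det_outputInit hW hH hz).mono
    (Q' := fun m' => (∀ l < d, ∀ x, m'.real 1 l = H.test O 0 x l) ∧ Rep d n T H m' ∧
      (∀ c, m'.nat 3 c < n) ∧ ∀ q, m'.real 2 q = 0)
    fun m' h hF => ⟨h, hR.frame hF (by decide), ?_, ?_⟩) ?_
  · rw [hF.nat 3 (by decide)]; exact hz
  · rw [hF.real 2 (by decide)]; exact h2
  rintro m₁ ⟨hx, hR₁, hz₁, h2₁⟩
  refine Det.seq ((hR₁.det_outputRead hW hH hz₁).mono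
    (Q' := fun m' => (∀ t < T, ∀ y < n, ∀ l < d, ∀ z,
      m'.real 3 ((t * n + y) * d + l) = H.dualVal O d t t z y l) ∧
      (∀ l < d, ∀ x, m'.real 1 l = H.test O 0 x l) ∧ Rep d n T H m' ∧
      (∀ c, m'.nat 3 c < n) ∧ ∀ q, m'.real 2 q = 0)
    fun m' h hF => ⟨h, ?_, hR₁.frame hF (by decide), ?_, ?_⟩) ?_
  · rw [hF.real 1 (by decide)]; exact hx
  · rw [hF.nat 3 (by decide)]; exact hz₁
  · rw [hF.real 2 (by decide)]; exact h2₁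
  rintro m₂ ⟨hB, hx₂, hR₂, hz₂, h2₂⟩
  refine (hR₂.det_outputTrans hW hH hz₂ h2₂).mono fun m' h hF => ⟨fun l z => ?_,
    fun t l j z hz => ?_, fun t y j z => ?_⟩
  · exact (congrFun (hF.real 1 (by decide)) _).trans (hx₂ l l.2 z)
  · refine (h t t.2 (z t) (hz t) l l.2 j j.2).trans (Hyp.trans_congr rfl)
  · exact (congrFun (hF.real 3 (by decide)) _).trans (hB t t.2 y y.2 j j.2 z)

end Output

/-! ### The potential argument for the random stopping time -/

section Learn

variable {n d T W k : ℕ} {M : ISAN n T k}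

/-- The invariant of the main loop. -/
structure Ready (M : ISAN n T k) (d : ℕ) (H : Hyp) (m : Mem) : Prop where
  rep : Rep d n T H m
  inv : H.Inv M.oracle d T
  lt : ∀ c, m.nat 3 c < n
  zero : ∀ q, m.real 2 q = 0

lemma Ready.frame {H : Hyp} {m m' : Mem} {c : Cmd} (h : Ready M d H m) (hF : Frame c m m')
    (hc : c.Preserves) (h3 : ∀ c, m'.nat 3 c < n) (h2 : 2 ∉ c.wr) : Ready M d H m' :=
  ⟨h.rep.frame hF hc, h.inv, h3, by rw [hF.real 2 h2]; exact h.zero⟩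

lemma Ready.setN {H : Hyp} {m : Mem} (h : Ready M d H m) {a q v : ℕ}
    (ha : a ∉ [0, 1, 2, 3, 6, 7, 8]) : Ready M d H (m.setN a q v) := by
  simp only [List.mem_cons, List.not_mem_nil, or_false, not_or] at ha
  refine ⟨h.rep.setN (by simp [ha]), h.inv, ?_, h.zero⟩
  rw [Mem.setN_nat_of_ne _ _ _ (Ne.symm ha.2.2.2.1)]
  exact h.lt

/-- The distance of the model from the one described by the memory. -/
def loss (M : ISAN n T k) (d : ℕ) (m : Mem) : ℝ := tvDist M.prob (m.out d n T).prob

open Classical in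
/-- The probability that a sampled sequence is not consistent with the hypothesis. -/
def failure (M : ISAN n T k) (d : ℕ) (H : Hyp) (b : ℕ → ℕ) : ℝ :=
  ∑ z, M.prob z * if H.Good M.oracle d T (overwrite 0 z b) then 0 else 1

lemma Hyp.Realizes.loss_le {H : Hyp} {m : Mem} (hn : 0 < n)
    (h : H.Realizes M.oracle (m.out d n T)) (hk : k ≤ d) {b : ℕ → ℕ} (hb : ∀ c, b c < n) :
    loss M d m ≤ failure M d H b := by
  classical
  refine (ISAN.tvDist_le hn (fun z => ¬ H.Good M.oracle d T (overwrite 0 z b))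
    fun z hz => h.prob_eq hk hb (not_not.1 hz)).trans (le_of_eq ?_)
  refine Finset.sum_congr rfl fun z _ => ?_
  split_ifs <;> rfl

lemma failure_nonneg (H : Hyp) (b : ℕ → ℕ) : 0 ≤ failure M d H b := by
  classical
  exact Finset.sum_nonneg fun z _ => mul_nonneg (M.prob_pos z).le (by split_ifs <;> simp)

open Classical in
lemma expect_gain (hn : 0 < n) (H : Hyp) (φ c : ℝ) (b : ℕ → ℕ) :
    expect n M.nextP (fun z => (φ - if H.Good M.oracle d T z then 0 else 1) / c) T 0 b =
      (φ - failure M d H b) / c := by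
  rw [ISAN.expect_nextP, failure]
  simp only [mul_div_assoc', mul_sub, ← Finset.sum_div, Finset.sum_sub_distrib, ← Finset.sum_mul,
    ISAN.sum_prob hn, one_mul]

/-- An inconsistent sequence can exist only while the total rank is below `T * d`, and then the
integer gap is at least one. This settles the case of a single remaining round. -/
lemma failure_le {H : Hyp} (hn : 0 < n) (hH : H.Inv M.oracle d T) (hk : k ≤ d) {b : ℕ → ℕ}
    (hb : ∀ c, b c < n) : failure M d H b ≤ (T * d : ℝ) - H.total T := by
  classical
  have h1 : ∀ z : Fin T → Fin n, (if H.Good M.oracle d T (overwrite 0 z b) then (0 : ℝ) else 1) ≤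
      (T * d : ℝ) - H.total T := by
    intro z
    split_ifs with h
    · have := hH.total_le
      rw [sub_nonneg]
      exact_mod_cast this
    · have := hH.total_lt (ISAN.isLinear_oracle M) hk (ISAN.overwrite_lt hb) h
      rw [le_sub_iff_add_le, add_comm]
      exact_mod_cast this
  calc failure M d H b ≤ ∑ z, M.prob z * ((T * d : ℝ) - H.total T) :=
        Finset.sum_le_sum fun z _ => mul_le_mul_of_nonneg_left (h1 z) (M.prob_pos z).le
    _ = _ := by rw [← Finset.sum_mul, ISAN.sum_prob hn, one_mul]

lemma Rep.total_eq {H : Hyp} {m : Mem} (h : Rep d n T H m) :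
    H.total T = ∑ i ∈ Finset.range T, m.nat 8 i :=
  Finset.sum_congr rfl fun i _ => (h.r i).symm

/-- A round that is not the last one. -/
lemma run_refine {H : Hyp} {m : Mem} (hW : Large d n T W) (hn : 0 < n) (hk : k ≤ d)
    (hm : Ready M d H m) {j : ℕ} (hj : m.nat 17 0 = j + 1) (hjW : j ≤ W) :
    Run M.oracle ((Cmd.seq .sample (.seq .sweep
        (.setNat 17 (.const 0) (.sub (.var 17) (.const 1))))).bound W)
      (.seq .sample (.seq .sweep (.setNat 17 (.const 0) (.sub (.var 17) (.const 1))))) m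
      (fun m' => m'.nat 17 0 = j ∧ ∃ H', Ready M d H' m')
      (fun m' => ENNReal.ofReal (((T * d : ℝ) - (∑ i ∈ Finset.range T, m'.nat 8 i : ℕ)) / j))
      (ENNReal.ofReal (((T * d : ℝ) - H.total T - failure M d H (m.nat 3)) / j)) := by
  classical
  rw [← expect_gain hn]
  have hg : ∀ z : ℕ → ℕ, (∀ c, z c < n) →
      0 ≤ ((T * d : ℝ) - H.total T - if H.Good M.oracle d T z then 0 else 1) / j := by
    intro z hz
    refine div_nonneg ?_ (Nat.cast_nonneg j)
    split_ifs with h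
    · have := hm.inv.total_le
      rw [sub_zero, sub_nonneg]
      exact_mod_cast this
    · have := hm.inv.total_lt (ISAN.isLinear_oracle M) hk hz h
      rw [sub_nonneg, le_sub_iff_add_le, add_comm]
      exact_mod_cast this
  -- The sampler rule needs a function that is nonnegative on all strings, whereas the gain is known
  -- to be nonnegative only on strings of tokens; hence the `max 0`.
  have hexp : expect n M.nextP
      (fun z => ((T * d : ℝ) - H.total T - if H.Good M.oracle d T z then 0 else 1) / j) T 0
        (m.nat 3) =
      expect n M.nextP (fun z => max 0
        (((T * d : ℝ) - H.total T - if H.Good M.oracle d T z then 0 else 1) / j)) T 0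
        (m.nat 3) := by
    rw [ISAN.expect_nextP, ISAN.expect_nextP]
    exact Finset.sum_congr rfl fun z _ => by rw [max_eq_right (hg _ (ISAN.overwrite_lt hm.lt))]
  rw [hexp]
  refine Run.seq (run_sample hW hn (fun _ => le_max_left _ _) hm.rep.tokens hm.rep.len
    hm.lt).frame ?_
  rintro m₁ ⟨hz₁, hF₁⟩
  have hm₁ : Ready M d H m₁ := hm.frame hF₁ (by decide) hz₁ (by decide)
  have hj₁ : m₁.nat 17 0 = j + 1 := by rw [hF₁.nat 17 (by decide), hj]
  rw [max_eq_right (hg _ hz₁)]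
  refine Det.seq_run ((hm₁.rep.det_sweep hW hm₁.inv (ISAN.isLinear_oracle M) hk
    (z := m₁.nat 3) (fun _ _ => rfl) hz₁).mono
    (Q' := fun m₂ => Swept M.oracle d T H (H.Good M.oracle d T (m₁.nat 3)) m₂ ∧
      m₂.nat 17 0 = j + 1 ∧ (∀ c, m₂.nat 3 c < n) ∧ ∀ q, m₂.real 2 q = 0)
    fun m₂ h hF => ⟨h, ?_, ?_, ?_⟩) ?_
  · rw [hF.nat 17 (by decide), hj₁]
  · rw [hF.nat 3 (by decide)]; exact hz₁
  · rw [hF.real 2 (by decide)]; exact hm₁.zero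
  rintro m₂ ⟨⟨H', hR, hH', hor⟩, hj₂, hz₂, hr₂⟩
  have hready : Ready M d H' m₂ := ⟨hR, hH', hz₂, hr₂⟩
  refine Run.setNat (by simp [hj₂]; omega) ⟨by simp [hj₂], H', hready.setN (by simp)⟩ ?_
  refine ENNReal.ofReal_le_ofReal ?_
  rw [Mem.setN_nat_of_ne _ _ _ (by simp), ← hR.total_eq]
  refine div_le_div_of_nonneg_right ?_ (Nat.cast_nonneg j)
  -- On a consistent sequence the total rank does not decrease; on an inconsistent one it grows by
  -- at least one, which pays for the `1` in the expectation.
  split_ifs with h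
  · rcases hor with ⟨rfl, -⟩ | h'
    · simp
    · have : (H.total T : ℝ) ≤ H'.total T := by exact_mod_cast h'.le
      linarith
  · have h' := hor.resolve_left fun h' => h h'.2
    have : (H.total T : ℝ) + 1 ≤ H'.total T := by exact_mod_cast h'
    linarith

/-- The expected loss of the main loop with `j` remaining rounds. -/
lemma run_rounds (hW : Large d n T W) (hn : 0 < n) (hk : k ≤ d) (j : ℕ) (hj : 0 < j)
    (hjW : j ≤ W) {H : Hyp} {m : Mem} (hm : Ready M d H m) (hmj : m.nat 17 0 = j) :
    Run M.oracle ((j + 1) * (1 + (BExp.natLt (.const 0) (.var 17)).cost + Cmd.round.bound W))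
      (.loop (.natLt (.const 0) (.var 17)) .round) m (fun _ => True)
      (fun m' => ENNReal.ofReal (loss M d m'))
      (ENNReal.ofReal (((T * d : ℝ) - H.total T) / j)) := by
  induction j generalizing H m with
  | zero => omega
  | succ j ih =>
    set b : BExp := .natLt (.const 0) (.var 17)
    set e := failure M d H (m.nat 3) with he
    set φ : ℝ := (T * d : ℝ) - H.total T with hφ
    have he0 : 0 ≤ e := failure_nonneg _ _
    have heφ : e ≤ φ := failure_le hn hm.inv hk hm.lt
    set p : ℝ := 1 / ((j + 1 : ℕ) : ℝ) with hp
    have hj1 : (0 : ℝ) < ((j + 1 : ℕ) : ℝ) := by positivity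
    have hp0 : 0 ≤ p := by positivity
    have hp1 : p ≤ 1 := by
      rw [hp, div_le_one hj1]
      exact_mod_cast hj
    -- Expectations are taken of functions of the memory, so the total rank is expressed through
    -- array `8`. The counter `17` is zero exactly when the model has been written, which selects
    -- between the loss and the potential.
    have hbody : Run M.oracle (Cmd.round.bound W) .round m
        (fun m' => m'.nat 17 0 = 0 ∨ 0 < j ∧ m'.nat 17 0 = j ∧ ∃ H', Ready M d H' m')
        (fun m' => if m'.nat 17 0 = 0 then ENNReal.ofReal (loss M d m') else
          ENNReal.ofReal (((T * d : ℝ) - (∑ i ∈ Finset.range T, m'.nat 8 i : ℕ)) / j))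
        (ENNReal.ofReal (φ / ((j + 1 : ℕ) : ℝ))) := by
      refine Run.seq (Q := fun m₁ => m₁ = m.setN 18 0 1 ∨ 0 < j ∧ m₁ = m.setN 18 0 0)
        (g := fun m₁ => if m₁.nat 18 0 = 1 then ENNReal.ofReal e else
          ENNReal.ofReal ((φ - e) / j))
        (Run.flip (p := p) (by simp [hmj, hp]) hp0 hp1 (fun _ => Or.inl rfl)
          (fun h => Or.inr ⟨?_, rfl⟩) ?_) ?_
      · refine Nat.pos_of_ne_zero fun h0 => ?_
        simp [hp, h0] at h
      · simp only [NExp.ev_const, Mem.setN_nat_self, Function.update_self, if_true, zero_ne_one,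
          if_false]
        have h1 : 0 ≤ (φ - e) / j := div_nonneg (by linarith) (Nat.cast_nonneg j)
        rw [← ENNReal.ofReal_mul hp0, ← ENNReal.ofReal_mul (by linarith),
          ← ENNReal.ofReal_add (mul_nonneg hp0 he0) (mul_nonneg (by linarith) h1)]
        refine ENNReal.ofReal_le_ofReal ?_
        -- In the last round the stopping probability is one, and `e ≤ φ` suffices. Otherwise `e /
        -- (j + 1) + (j / (j + 1)) * ((φ - e) / j) = φ / (j + 1)`.
        rcases Nat.eq_zero_or_pos j with rfl | hjpos
        · simpa [hp] using heφ
        · refine le_of_eq ?_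
          have : (j : ℝ) ≠ 0 := by positivity
          rw [hp]
          push_cast at hj1 ⊢
          field_simp
          ring
      · rintro m₁ (rfl | ⟨hjpos, rfl⟩)
        · have hm₁ : Ready M d H (m.setN 18 0 1) := hm.setN (by simp)
          refine Run.branch (fun _ => ?_) (fun h => (h (by simp)).elim)
          simp only [Mem.setN_nat_self, Function.update_self, if_true]
          refine Det.seq_run (hm₁.rep.det_output hW hm₁.inv hm₁.lt hm₁.zero) fun m₂ h => ?_
          refine Run.setNat (by simp) (Or.inl (by simp)) ?_
          simp only [NExp.ev_const, Mem.setN_nat_self, Function.update_self, if_true]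
          exact ENNReal.ofReal_le_ofReal (h.loss_le hn hk hm.lt)
        · have hm₁ : Ready M d H (m.setN 18 0 0) := hm.setN (by simp)
          refine Run.branch (fun h => ?_) (fun _ => ?_)
          · simp at h
          simp only [Mem.setN_nat_self, Function.update_self, if_false, zero_ne_one]
          have h1 := run_refine hW hn hk hm₁ (j := j) (by simpa using hmj) (by omega)
          refine h1.mono le_rfl (fun m' h => ⟨Or.inr ⟨hjpos, h⟩, ?_⟩) (le_of_eq ?_)
          · rw [if_neg (by rw [h.1]; omega)]
          · simp [he, hφ]
    refine (Run.loop_step (B₂ := (j + 1) * (1 + b.cost + Cmd.round.bound W)) (by simp [b, hmj])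
      hbody fun m' h => ?_).mono (le_of_eq (by ring)) (fun m'' h => ⟨h, le_rfl⟩) le_rfl
    rcases h with h | ⟨hjpos, h, H', hm'⟩
    · refine (Run.loop_exit (Q := fun _ => True) (by simp [b, h]) trivial
        (le_of_eq (if_pos h).symm)).mono ?_ (fun m'' h => ⟨h, le_rfl⟩) le_rfl
      nlinarith [Nat.zero_le (Cmd.round.bound W), Nat.zero_le j,
        Nat.zero_le (j * (1 + b.cost + Cmd.round.bound W))]
    · rw [if_neg (by omega), ← hm'.rep.total_eq]
      exact ih hjpos (by omega) hm' h

/-- The machine cannot round a real to a natural number, so the number of rounds is found by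
counting up. `N` occurs only in the analysis, as a value at which the search must have stopped. -/
lemma det_search {O : LogitOracle n} {m : Mem} {N : ℕ} {ε : ℝ} (hd : m.nat 0 0 = d)
    (hT : m.nat 0 2 = T) (hε : m.real 0 0 = ε) (h1 : m.nat 17 0 = 1) (hN1 : 1 ≤ N)
    (hN : (d * T : ℝ) ≤ N * ε) (hNW : N ≤ W) :
    Det O W .search m (fun m' => 0 < m'.nat 17 0 ∧ m'.nat 17 0 ≤ N ∧
      (d * T : ℝ) ≤ m'.nat 17 0 * ε) := by
  set b : BExp := .realLt (.mul (.cast (.var 17)) (.read 0 (.const 0)))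
    (.cast (.mul .dim .seqLen))
  set c : Cmd := .setNat 17 (.const 0) (.add (.var 17) (.const 1))
  have key : ∀ j i, i + j = N → 0 < i → ∀ m', Frame .search m m' → m'.nat 17 0 = i →
      Run O ((j + 1) * (1 + b.cost + c.bound W)) .search m' (fun m' => 0 < m'.nat 17 0 ∧
        m'.nat 17 0 ≤ N ∧ (d * T : ℝ) ≤ m'.nat 17 0 * ε) (fun _ => 0) 0 := by
    intro j
    induction j with
    | zero =>
      intro i hi hi0 m' hF h
      obtain rfl : i = N := by omega
      refine (Run.loop_exit (v := 0) ?_ ?_ le_rfl).mono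
        (by rw [zero_add, one_mul]; exact Nat.le_add_right _ _) (fun m'' h => ⟨h, le_rfl⟩) le_rfl
      · simp [h, hF.nat 0 (by decide), hF.real 0 (by decide), hd, hT, hε, hN]
      · exact ⟨by omega, by omega, by rw [h]; exact hN⟩
    | succ j ih =>
      intro i hi hi0 m' hF h
      have hev : b.ev m' ↔ (i * ε : ℝ) < d * T := by
        simp [b, h, hF.nat 0 (by decide), hF.real 0 (by decide), hd, hT, hε]
      by_cases hb : b.ev m'
      · refine (Run.loop_step (B₂ := (j + 1) * (1 + b.cost + c.bound W)) hb
          (Run.setNat (W := W) (f := fun _ => 0) (Q := fun m'' => m'' = m'.setN 17 0 (i + 1))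
            (by simp [h]; omega) (by simp [h]) le_rfl)
          ?_).mono (le_of_eq (by ring)) (fun m'' h => ⟨h, le_rfl⟩) le_rfl
        rintro _ rfl
        refine ih (i + 1) (by omega) (by omega) _ ⟨fun a ha => ?_, hF.real⟩ (by simp)
        have : a ≠ 17 := by rintro rfl; exact ha (by decide)
        rw [Mem.setN_nat_of_ne _ _ _ this]
        exact hF.nat a ha
      · refine (Run.loop_exit (v := 0) hb ?_ le_rfl).mono ?_ (fun m'' h => ⟨h, le_rfl⟩) le_rfl
        · rw [hev, not_lt] at hb
          exact ⟨by omega, by omega, by rw [h]; exact hb⟩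
        · nlinarith [Nat.zero_le (c.bound W), Nat.zero_le (j * (1 + b.cost + c.bound W))]
  refine (key (N - 1) 1 (by omega) one_pos m (Frame.refl _ _) h1).mono ?_
    (fun m'' h => ⟨h, le_rfl⟩) le_rfl
  simp only [Cmd.search, Cmd.bound, b, c]
  gcongr
  omega

/-- The expected loss of the learning algorithm. -/
lemma run_learn {ε : ℝ} {N : ℕ} (hW : Large d n T W) (hn : 0 < n) (hk : k ≤ d)
    (hN1 : 1 ≤ N) (hN : (d * T : ℝ) ≤ N * ε) (hNW : N ≤ W) :
    Run M.oracle (Cmd.learn.bound W) .learn (State.init d n T ε).mem (fun _ => True)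
      (fun m' => ENNReal.ofReal (loss M d m')) (ENNReal.ofReal ε) := by
  set m₀ := (State.init d n T ε).mem
  have hready : Ready M d .zero m₀ := by
    refine ⟨?_, Hyp.inv_zero hn, ?_, ?_⟩
    · constructor <;> simp [m₀, State.init, State.mem, Hyp.zero]
    · simp [m₀, State.init, State.mem, hn]
    · simp [m₀, State.init, State.mem]
  have hε₀ : m₀.real 0 0 = ε := by simp [m₀, State.init, State.mem]
  refine Det.seq_run (Q := fun m' => m' = m₀.setN 17 0 1)
    (Det.setNat (by simp; omega) (by simp)) ?_
  rintro _ rfl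
  have h₁ : Ready M d .zero (m₀.setN 17 0 1) := hready.setN (by simp)
  refine Det.seq_run ((det_search (d := d) (T := T) (N := N) (ε := ε) h₁.rep.dim h₁.rep.len
    (by simp [hε₀]) (by simp) hN1 hN hNW).mono (Q' := fun m' => Ready M d .zero m' ∧
      0 < m'.nat 17 0 ∧ m'.nat 17 0 ≤ N ∧ (d * T : ℝ) ≤ m'.nat 17 0 * ε)
    fun m' h hF => ⟨h₁.frame hF (by decide) ?_ (by decide), h⟩) ?_
  · rw [hF.nat 3 (by decide)]; exact h₁.lt
  rintro m₂ ⟨hm₂, hpos, hle, hε₂⟩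
  refine (run_rounds hW hn hk _ hpos (hle.trans hNW) hm₂ rfl).mono ?_
    (fun m' h => ⟨trivial, le_rfl⟩) (ENNReal.ofReal_le_ofReal ?_)
  · rw [Cmd.bound]
    have : m₂.nat 17 0 ≤ W := hle.trans hNW
    exact Nat.mul_le_mul (by omega) le_rfl
  -- The initial potential is at most `T * d` divided by the number of rounds, and the exit
  -- condition of the search bounds this by `ε`.
  · rw [div_le_iff₀ (by exact_mod_cast hpos)]
    have : (0 : ℝ) ≤ Hyp.zero.total T := Nat.cast_nonneg _
    nlinarith

end Learn

/-! ### The polynomial bound in the four parameters -/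

lemma eval₂_le_eval₂ (p : Polynomial ℕ) {x y : ℝ} (hx : 0 ≤ x) (hxy : x ≤ y) :
    p.eval₂ (Nat.castRingHom ℝ) x ≤ p.eval₂ (Nat.castRingHom ℝ) y := by
  rw [Polynomial.eval₂_eq_sum_range, Polynomial.eval₂_eq_sum_range]
  refine Finset.sum_le_sum fun i _ => ?_
  exact mul_le_mul_of_nonneg_left (pow_le_pow_left₀ hx hxy i) (Nat.cast_nonneg _)

end LogitLearning

end

theorem mainTheorem2 :
    ∃ (prog : LogitLearning.Cmd) (P : MvPolynomial (Fin 4) ℝ),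
      ∀ (d n T : ℕ) (ε : ℝ), 0 < n → 0 < ε →
        ∀ (k : ℕ), k ≤ d → ∀ M : LogitLearning.ISAN n T k,
          ∃ μ : PMF LogitLearning.State,
            LogitLearning.Exec M.oracle prog (LogitLearning.State.init d n T ε) μ ∧
            (∀ s ∈ μ.support,
              (s.steps : ℝ) ≤ MvPolynomial.eval ![(d : ℝ), (n : ℝ), (T : ℝ), 1 / ε] P ∧
              (s.queries : ℝ) ≤ MvPolynomial.eval ![(d : ℝ), (n : ℝ), (T : ℝ), 1 / ε] P) ∧
            ∑' s : LogitLearning.State,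
                μ s * ENNReal.ofReal (LogitLearning.tvDist M.prob (s.output d n T).prob)
              ≤ ENNReal.ofReal ε := by
  open LogitLearning in
  obtain ⟨p, hp⟩ := Cmd.learn.exists_polynomial_bound
  -- An upper bound for `W` below. The constant `3` collects the one in `T + 1`, the one in `N`, and
  -- one for rounding up; the last monomial is `d * T / ε`.
  set Q : MvPolynomial (Fin 4) ℝ := .X 0 + .X 1 + .X 2 + 3 + .X 0 * .X 2 * .X 3
  refine ⟨.learn, p.eval₂ (Nat.castRingHom _) Q, fun d n T ε hn hε k hk M => ?_⟩
  set N : ℕ := ⌈(d * T : ℝ) / ε⌉₊ + 1 with hNdef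
  set W : ℕ := d + n + (T + 1) + N with hWdef
  have hx : 0 ≤ (d * T : ℝ) / ε := by positivity
  have hN : (d * T : ℝ) ≤ N * ε := by
    rw [← div_le_iff₀ hε, hNdef]
    push_cast
    linarith [Nat.le_ceil ((d * T : ℝ) / ε)]
  have hbound : (Cmd.learn.bound W : ℝ) ≤
      MvPolynomial.eval ![(d : ℝ), (n : ℝ), (T : ℝ), 1 / ε] (p.eval₂ (Nat.castRingHom _) Q) := by
    rw [hp, Polynomial.hom_eval₂]
    have h1 : ((p.eval W : ℕ) : ℝ) = p.eval₂ (Nat.castRingHom ℝ) (W : ℝ) :=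
      (Polynomial.eval₂_at_natCast (Nat.castRingHom ℝ) W).symm
    have h2 : (MvPolynomial.eval ![(d : ℝ), (n : ℝ), (T : ℝ), 1 / ε]).comp
        -- There is only one ring homomorphism from `ℕ` to `ℝ`.
        (Nat.castRingHom (MvPolynomial (Fin 4) ℝ)) = Nat.castRingHom ℝ := Subsingleton.elim _ _
    rw [h1, h2]
    refine eval₂_le_eval₂ p (Nat.cast_nonneg _) ?_
    have h3 := (Nat.ceil_lt_add_one hx).le
    simp only [Q, map_add, map_mul, MvPolynomial.eval_X, map_ofNat, hWdef, hNdef]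
    push_cast
    rw [mul_one_div]
    linarith
  obtain ⟨μ, h1, h2, h3⟩ := run_learn (M := M) (W := W) (ε := ε) (N := N)
    ⟨by omega, by omega, by omega⟩ hn hk (by omega) hN (by omega) 0 0
  refine ⟨μ, h1, fun s hs => ?_, h3⟩
  have h4 := (h2 s hs).1
  have h5 := h1.queries_le s hs
  -- Each query takes at least one unit of time and both counters start at zero, so the time bound
  -- also bounds the queries.
  have h6 : s.queries ≤ s.steps := by simpa [Mem.st] using h5
  rw [zero_add] at h4
  exact ⟨le_trans (by exact_mod_cast h4) hbound, le_trans (by exact_mod_cast h6.trans h4) hbound⟩
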